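/- Let $d\in\{2,3\}$, $T>0$, $\nu\ge 0$, $\omega>0$. Let $\Omega\subset\mathbb R^d$ be a period cell (the parallelepiped spanned by $d$ linearly independent period vectors); all spatial functions are periodic with respect to these vectors. Consider a sequence of conforming periodic simplicial meshes $\mathcal T_h$ with mesh size $h=\max_{K\in\mathcal T_h}\operatorname{diam}K\to 0$ that is shape regular and, if $d=3$, also quasi-uniform. Let $\mathbf x_1,\dots,\mathbf x_{N_h}$ be the nodes of $\mathcal T_h$ and $\varphi_1,\dots,\varphi_{N_h}$ the periodic continuous piecewise-linear Lagrange basis functions, and put $$m_{ij}=\int_\Omega\varphi_i\varphi_j,\quad m_i=\int_\Omega\varphi_i,\quad \mathbf c_{ij}=\int_\Omega\varphi_i\nabla\varphi_j,\quad s_{ij}=\int_\Omega\nabla\varphi_i\cdot\nabla\varphi_j,\quad \tilde a_{ij}=\frac{\mathbf u_j+\mathbf u_i}{2}\cdot\mathbf c_{ij}.$$ Let $\mathbf u_h(\mathbf x,t)=\sum_j\mathbf u_j(t)\varphi_j(\mathbf x)$ and $p_h(\mathbf x,t)=\sum_jp_j(t)\varphi_j(\mathbf x)$ have nodal values that are continuous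 on $[0,T]$, let the $\mathbf u_i$ be differentiable on $(0,T)$, and let for all $t\in(0,T)$ and $i=1,\dots,N_h$ $$m_i\frac{d\mathbf u_i}{dt}=\sum_{j=1}^{N_h}\big[(d^u_{ij}-\tilde a_{ij}-\nu s_{ij})\mathbf u_j-\mathbf c_{ij}p_j\big],\qquad 0=\sum_{j=1}^{N_h}\big[d^p_{ij}p_j-\mathbf c_{ij}\cdot\mathbf u_j\big],\qquad \int_\Omega p_h\,d\mathbf x=0 .$$ Here $d^p_{ij}=\omega m_{ij}$ for $j\ne i$ and $d^p_{ii}=-\sum_{k\ne i}d^p_{ik}$ (Becker--Hansbo pressure stabilization), and $(d^u_{ij})$, which may depend on $t$ and on the solution, is symmetric with zero row sums, satisfies $0\le d^u_{ij}\le Ch^{d-1}$ for $j\neq i$ with a constant $C$ independent of $h$ and $t$, and vanishes unless the basis functions $\varphi_i$ and $\varphi_j$ have overlapping supports. Assume that, as $h\to0$, $$\mathbf u_h(\cdot,0)\to\mathbf u_0\ \text{in }L^2(\Omega)^d,\qquad \mathbf u_h\to\mathbf u\ \text{in }L^2(\Omega\times(0,T))^d,\qquad p_h\to p\ \text{in }L^2(\Omega\times(0,T)).$$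 Then $(\mathbf u,p)$ is a weak solution of the periodic incompressible Navier--Stokes system (Euler system if $\nu=0$) with initial velocity $\mathbf u_0$ in the following sense: if $\nu>0$, then $\mathbf u$ has a weak spatial gradient $\nabla\mathbf u\in L^2(\Omega\times(0,T))^{d\times d}$ (as a periodic function; for $\nu=0$ the term $\nu\nabla\mathbf u$ below is absent); $$\int_0^T\!\!\int_\Omega\Big[\mathbf u\cdot\frac{\partial\mathbf v}{\partial t}+(\mathbf u\otimes\mathbf u-\nu\nabla\mathbf u):\nabla\mathbf v+p\,\nabla\cdot\mathbf v\Big]d\mathbf x\,dt+\int_\Omega\mathbf u_0(\mathbf x)\cdot\mathbf v(\mathbf x,0)\,d\mathbf x=0$$ for all $\mathbf v\in[C^2_c(\bar\Omega\times[0,T))]^d$ that are periodic in space (compact support is meant with respect to time); and for almost every $t\in(0,T)$ $$\int_\Omega\mathbf u(\mathbf x,t)\cdot\nabla q(\mathbf x)\,d\mathbf x=0$$ for all $q\in C^1(\bar\Omega)$ that are periodic. -/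

import Mathlib

open MeasureTheory Filter Topology Set

noncomputable section

namespace PeriodicFEM

/-- Euclidean space of dimension `d`. -/
abbrev Euc (d : ℕ) : Type := EuclideanSpace ℝ (Fin d)

variable {d : ℕ}

/-- The period cell `Ω`: the half-open parallelepiped spanned by the period vectors `b 0, …, b (d-1)`
(a box, if the period vectors are multiples of the coordinate vectors). -/
def cell (b : Module.Basis (Fin d) ℝ (Euc d)) : Set (Euc d) := ZSpan.fundamentalDomain b

/-- The lattice of periods. -/
def lattice (b : Module.Basis (Fin d) ℝ (Euc d)) : Submodule ℤ (Euc d) :=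
  Submodule.span ℤ (Set.range b)

/-- `f` is periodic in space with respect to the period vectors. -/
def IsPeriodic {F : Type*} (b : Module.Basis (Fin d) ℝ (Euc d)) (f : Euc d → F) : Prop :=
  ∀ (k : Fin d) (x : Euc d), f (x + b k) = f x

/-- Lebesgue measure on the space-time cylinder `(0,T) × Ω`. -/
def cylinder (b : Module.Basis (Fin d) ℝ (Euc d)) (T : ℝ) : Measure (ℝ × Euc d) :=
  (volume.restrict (Ioo 0 T)).prod (volume.restrict (cell b))

/-- The partial derivative `∂_j f_i (x)` of a vector field. -/
def pderiv (f : Euc d → Euc d) (x : Euc d) (i j : Fin d) : ℝ :=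
  fderiv ℝ f x (EuclideanSpace.single j 1) i

/-! ### Periodic simplicial meshes and continuous piecewise linear functions -/

/-- A conforming simplicial mesh of the flat torus `ℝᵈ / lattice b`, given by its lift to a
triangulation of `ℝᵈ` that is invariant under the periods. Faces are given by their vertices. -/
structure PeriodicMesh (b : Module.Basis (Fin d) ℝ (Euc d)) where
  /-- the triangulation of the whole space -/
  complex : Geometry.SimplicialComplex ℝ (Euc d)
  /-- the simplices cover the space -/
  covers : complex.space = Set.univ
  /-- every face is a face of a `d`-dimensional simplex -/
  pure : ∀ s ∈ complex.faces, ∃ t ∈ complex.faces, s ⊆ t ∧ t.card = d + 1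
  /-- the triangulation is invariant under the periods -/
  invariant : ∀ s ∈ complex.faces, ∀ g ∈ lattice b,
    s.map (addRightEmbedding g) ∈ complex.faces
  /-- up to periods, there are finitely many faces -/
  finite : {s : Finset (Euc d) | s ∈ complex.faces ∧ ∃ x ∈ s, x ∈ cell b}.Finite

namespace PeriodicMesh

variable {b : Module.Basis (Fin d) ℝ (Euc d)} (M : PeriodicMesh b)

/-- The `d`-dimensional simplices of the mesh. -/
def simplices : Set (Finset (Euc d)) := {s | s ∈ M.complex.faces ∧ s.card = d + 1}

/-- The mesh size `h`, the largest diameter of a simplex. -/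
def meshSize : ℝ :=
  sSup ((fun s : Finset (Euc d) => Metric.diam (convexHull ℝ (s : Set (Euc d)))) '' M.simplices)

/-- The nodes of the mesh: the vertices up to periods, i.e. the vertices in the (half-open)
period cell. -/
def Node : Type := {x : Euc d // {x} ∈ M.complex.faces ∧ x ∈ cell b}

instance : Finite M.Node := by
  have h : Finite {s : Finset (Euc d) // s ∈ M.complex.faces ∧ ∃ x ∈ s, x ∈ cell b} :=
    M.finite.to_subtype
  refine Finite.of_injective
    (fun x : M.Node => (⟨{x.1}, x.2.1, x.1, by simp, x.2.2⟩ :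
      {s : Finset (Euc d) // s ∈ M.complex.faces ∧ ∃ x ∈ s, x ∈ cell b})) ?_
  intro x y hxy
  have := congrArg Subtype.val hxy
  exact Subtype.ext (Finset.singleton_injective this)

instance : Fintype M.Node := Fintype.ofFinite _

/-- `(s, w)` are barycentric coordinates of `x`: `s` is a face and `x` is the convex combination
of the vertices `y` of `s` with the weights `w y`. -/
def IsBarycentric (x : Euc d) (c : Finset (Euc d) × (Euc d → ℝ)) : Prop :=
  c.1 ∈ M.complex.faces ∧ (∀ y ∈ c.1, 0 ≤ c.2 y) ∧ ∑ y ∈ c.1, c.2 y = 1 ∧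
    ∑ y ∈ c.1, c.2 y • y = x

theorem exists_isBarycentric (x : Euc d) : ∃ c, M.IsBarycentric x c := by
  have hx : x ∈ M.complex.space := by rw [M.covers]; trivial
  obtain ⟨s, hs, hxs⟩ := Geometry.SimplicialComplex.mem_space_iff.1 hx
  rw [Finset.mem_convexHull'] at hxs
  obtain ⟨w, h0, h1, h2⟩ := hxs
  exact ⟨(s, w), hs, h0, h1, h2⟩

/-- Some barycentric coordinates of `x`; they are unique up to vertices of weight zero. -/
def bary (x : Euc d) : Finset (Euc d) × (Euc d → ℝ) := (M.exists_isBarycentric x).choose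

open Classical in
/-- The Lagrange basis function `φ_i`: the periodic continuous function that is affine on every
simplex and equal to one at the translates of the node `i` and to zero at the other vertices. -/
def basisFun (i : M.Node) (x : Euc d) : ℝ :=
  ∑ y ∈ (M.bary x).1, if y - i.1 ∈ lattice b then (M.bary x).2 y else 0

/-- The finite element function `∑ j, φ_j c_j` with nodal values `c`. -/
def fe {F : Type*} [AddCommGroup F] [Module ℝ F] (c : M.Node → F) (x : Euc d) : F :=
  ∑ j, M.basisFun j x • c j

/-- `j ∈ 𝒩_i`: the basis functions `φ_i` and `φ_j` have overlapping supports. -/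
def Neighbor (i j : M.Node) : Prop := ∃ x, M.basisFun i x ≠ 0 ∧ M.basisFun j x ≠ 0

/-- Consistent mass matrix `m_ij = ∫ φ_i φ_j`. -/
def massC (i j : M.Node) : ℝ := ∫ x in cell b, M.basisFun i x * M.basisFun j x

/-- Lumped mass `m_i = ∫ φ_i`. -/
def massL (i : M.Node) : ℝ := ∫ x in cell b, M.basisFun i x

/-- Discrete gradient `c_ij = ∫ φ_i ∇φ_j`. The gradient is the classical one, which exists outside
a set of measure zero. -/
def gradC (i j : M.Node) : Euc d := ∫ x in cell b, M.basisFun i x • gradient (M.basisFun j) x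

/-- Stiffness matrix `s_ij = ∫ ∇φ_i · ∇φ_j`. -/
def stiff (i j : M.Node) : ℝ :=
  ∫ x in cell b, inner ℝ (gradient (M.basisFun i) x) (gradient (M.basisFun j) x)

/-- Quadrature-based convection coefficient `ã_ij = ½ (u_j + u_i) · c_ij`. -/
def convec (u : M.Node → Euc d) (i j : M.Node) : ℝ :=
  inner ℝ ((1 / 2 : ℝ) • (u j + u i)) (M.gradC i j)

/-- Graph Laplacian operators on the mesh: symmetric, zero row sums, nonnegative off-diagonal
entries, and entries only between nodes whose basis functions have overlapping supports. -/
structure IsGraphLaplacian (D : M.Node → M.Node → ℝ) : Prop where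
  rowSum : ∀ i, ∑ j, D i j = 0
  symm : ∀ i j, D i j = D j i
  nonneg : ∀ i j, j ≠ i → 0 ≤ D i j
  sparse : ∀ i j, ¬ M.Neighbor i j → D i j = 0

open Classical in
/-- Becker–Hansbo pressure stabilization with parameter `ω`. -/
def beckerHansbo (ω : ℝ) (i j : M.Node) : ℝ :=
  if j ≠ i then ω * M.massC i j else - ∑ k ∈ Finset.univ.erase i, ω * M.massC i k

/-- `(U, P)` are the nodal values of a solution, on the time interval `[0,T]`, of the stabilized
semi-discrete scheme
`m_i u_i' = ∑_j [(d^u_ij - ã_ij - ν s_ij) u_j - c_ij p_j]`, `0 = ∑_j [d^p_ij p_j - c_ij · u_j]`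
with velocity stabilization `du t` (which may depend on time and on the solution itself)
and Becker–Hansbo pressure stabilization. All coefficients vanish for `j ∉ 𝒩_i`, so that summing
over all nodes `j` is the same as summing over `𝒩_i`. -/
structure IsSemiDiscreteSolution (ν ω T : ℝ) (du : ℝ → M.Node → M.Node → ℝ)
    (U : ℝ → M.Node → Euc d) (P : ℝ → M.Node → ℝ) : Prop where
  laplacian : ∀ t ∈ Ioo 0 T, M.IsGraphLaplacian (du t)
  continuousOn_velocity : ∀ i, ContinuousOn (fun t => U t i) (Icc 0 T)
  continuousOn_pressure : ∀ i, ContinuousOn (fun t => P t i) (Icc 0 T)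
  differentiableAt_velocity : ∀ i, ∀ t ∈ Ioo 0 T, DifferentiableAt ℝ (fun s => U s i) t
  momentum : ∀ t ∈ Ioo 0 T, ∀ i, M.massL i • deriv (fun s => U s i) t =
    ∑ j, ((du t i j - M.convec (U t) i j - ν * M.stiff i j) • U t j - P t j • M.gradC i j)
  continuity : ∀ t ∈ Ioo 0 T, ∀ k,
    0 = ∑ j, (M.beckerHansbo ω k j * P t j - inner ℝ (M.gradC k j) (U t j))
  zeroMean : ∀ t ∈ Ioo 0 T, ∫ x in cell b, M.fe (P t) x = 0

end PeriodicMesh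

/-- Shape regularity of a sequence of meshes: the ratio between the inradius and the diameter of
the simplices is bounded below by a positive constant. -/
def ShapeRegular {b : Module.Basis (Fin d) ℝ (Euc d)} (M : ℕ → PeriodicMesh b) : Prop :=
  ∃ σ > 0, ∀ n, ∀ s ∈ (M n).simplices, ∃ x : Euc d,
    Metric.ball x (σ * Metric.diam (convexHull ℝ (s : Set (Euc d)))) ⊆
      convexHull ℝ (s : Set (Euc d))

/-- Quasi-uniformity of a sequence of meshes: all simplices of a mesh have comparable diameters. -/
def QuasiUniform {b : Module.Basis (Fin d) ℝ (Euc d)} (M : ℕ → PeriodicMesh b) : Prop :=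
  ∃ κ > 0, ∀ n, ∀ s ∈ (M n).simplices,
    κ * (M n).meshSize ≤ Metric.diam (convexHull ℝ (s : Set (Euc d)))

/-! ### Weak solutions -/

/-- `G i j` is the weak spatial derivative `∂_j u_i ∈ L²((0,T) × Ω)` of the periodic vector
field `u`. -/
def IsWeakGradient (b : Module.Basis (Fin d) ℝ (Euc d)) (T : ℝ) (u : ℝ → Euc d → Euc d)
    (G : Fin d → Fin d → ℝ → Euc d → ℝ) : Prop :=
  (∀ i j, MemLp (fun z : ℝ × Euc d => G i j z.1 z.2) 2 (cylinder b T)) ∧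
  ∀ i j, ∀ φ : ℝ → Euc d → ℝ, ContDiff ℝ 1 (fun z : ℝ × Euc d => φ z.1 z.2) →
    (∀ t, IsPeriodic b (φ t)) →
    ∫ z, u z.1 z.2 i * fderiv ℝ (φ z.1) z.2 (EuclideanSpace.single j 1) ∂(cylinder b T) =
      - ∫ z, G i j z.1 z.2 * φ z.1 z.2 ∂(cylinder b T)

/-- The velocity test functions: periodic in space, of class `C²` on `ℝᵈ × [0,T)` (every such
function extends to a `C²` function for all times), and with compact support in `[0,T)`
with respect to time. -/
structure IsTestField (b : Module.Basis (Fin d) ℝ (Euc d)) (T : ℝ) (v : ℝ → Euc d → Euc d) :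
    Prop where
  contDiff : ContDiff ℝ 2 (fun z : ℝ × Euc d => v z.1 z.2)
  periodic : ∀ t, IsPeriodic b (v t)
  support : ∃ τ < T, ∀ t, τ ≤ t → ∀ x, v t x = 0

/-- `(u, p)` is a weak solution on `(0,T) × Ω` of the periodic incompressible Navier–Stokes
(`ν > 0`) or Euler (`ν = 0`) equations with initial velocity `u₀`. The gradient of `u`
is required to exist for `ν > 0` only; for `ν = 0` the term that contains it is absent. -/
structure IsWeakSolution (b : Module.Basis (Fin d) ℝ (Euc d)) (ν T : ℝ) (u₀ : Euc d → Euc d)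
    (u : ℝ → Euc d → Euc d) (p : ℝ → Euc d → ℝ) : Prop where
  memLp_initial : MemLp u₀ 2 (volume.restrict (cell b))
  memLp_velocity : MemLp (fun z : ℝ × Euc d => u z.1 z.2) 2 (cylinder b T)
  memLp_pressure : MemLp (fun z : ℝ × Euc d => p z.1 z.2) 2 (cylinder b T)
  momentum : ∃ G : Fin d → Fin d → ℝ → Euc d → ℝ, (0 < ν → IsWeakGradient b T u G) ∧
    ∀ v : ℝ → Euc d → Euc d, IsTestField b T v →
      (∫ z, (inner ℝ (u z.1 z.2) (deriv (fun s => v s z.2) z.1)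
          + ∑ i, ∑ j, (u z.1 z.2 i * u z.1 z.2 j - ν * G i j z.1 z.2) * pderiv (v z.1) z.2 i j
          + p z.1 z.2 * ∑ i, pderiv (v z.1) z.2 i i) ∂(cylinder b T))
        + ∫ x in cell b, inner ℝ (u₀ x) (v 0 x) = 0
  solenoidal : ∀ᵐ t ∂(volume.restrict (Ioo 0 T)), ∀ q : Euc d → ℝ, ContDiff ℝ 1 q →
    IsPeriodic b q → ∫ x in cell b, inner ℝ (u t x) (gradient q x) = 0

end PeriodicFEM

end

/-!
The proof is a Lax–Wendroff type consistency argument: the strong convergence of velocity and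
pressure is assumed, so that it only has to be shown that every term of the scheme, tested with the
nodal values of a smooth test field, converges to the corresponding term of the weak formulation.

*Geometry.* On a simplex with vertices `y`, the finite element functions are combinations of the
barycentric coordinates `lam K y`, whose gradients are bounded by the inverse of the inradius.
Integrals over the period cell are sums of integrals over representatives of the simplices up to
periods (`setIntegral_cell_eq`). On each simplex, nodal values are controlled by `L²` norms
(`nodalSq_le`), and differences of nodal values by the `L²` distance to any function of small
oscillation (`nodalOsc_le`).

*Oscillations vanish.* If `f_n` is a sequence of finite element functions that converges in `L²`,
then comparing `f_n` with a fixed member `f_m`, which is Lipschitz continuous in space, shows that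
the sum of the squared jumps of nodal values, weighted with the volumes of the simplices, tends to
zero (`tendsto_integral_nodalOsc`). This removes the Becker–Hansbo stabilization
`ω m_ij (p_j - p_i)` and the differences `u_i - u_j` in the quadrature-based convective term, where
in addition the discrete continuity equation and the antisymmetry `c_ij = - c_ji` are used
(`DiscreteContinuity.abs_convec_le`).

*Energy.* Testing the momentum equation with the velocity itself bounds the kinetic energy, the
viscous dissipation, and the dissipation of the artificial viscosity `d^u`. If `v` denotes the test
field, the contribution of `d^u` is bounded by Cauchy–Schwarz and Young by `δ` times its own
dissipation plus `δ⁻¹ ∑ d^u_ij |v_i - v_j|²`, and the latter is of the order of the mesh size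
because `d^u_ij ≤ C h^(d-1)`. The dissipation is absorbed by the derivative of the energy before
integrating in time (`abs_add_integral_le`), so that nothing has to be assumed about the dependence
of `d^u` on time.

*Limit.* The viscous term converges to `∫ u · Δv`, and a weak limit point of the gradients of the
approximations, which are bounded in `L²` by the energy estimate, is the weak gradient of `u`
(`exists_isWeakGradient`). The continuity equation holds in the limit for each test function outside
a null set of times; separability of `L²` makes the null set independent of the test function
(`solenoidal_limit`).
-/

noncomputable section

namespace PeriodicFEM

variable {d : ℕ} {b : Module.Basis (Fin d) ℝ (Euc d)}

/-! ### Periodic functions and the lattice of periods -/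

theorem IsPeriodic.add_mem {F : Type*} {f : Euc d → F} (hf : IsPeriodic b f) {g : Euc d}
    (hg : g ∈ lattice b) (x : Euc d) : f (x + g) = f x := by
  unfold lattice at hg
  induction hg using Submodule.span_induction generalizing x with
  | mem g hg => obtain ⟨k, rfl⟩ := hg; exact hf k x
  | zero => simp
  | add g g' _ _ h h' => rw [← add_assoc, h', h]
  | smul n g _ h =>
    have key : ∀ (n : ℕ) (x : Euc d), f (x + (n : ℤ) • g) = f x := by
      intro n
      induction n with
      | zero => intro x; simp
      | succ n ih => intro x; push_cast; rw [add_smul, one_smul, ← add_assoc, h, ih]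
    obtain ⟨m, rfl | rfl⟩ := n.eq_nat_or_neg
    · exact key m x
    · have := key m (x + (-(m : ℤ)) • g)
      rw [add_assoc, ← add_smul] at this
      simpa using this.symm

theorem IsPeriodic.of_forall_mem {F : Type*} {f : Euc d → F}
    (hf : ∀ g ∈ lattice b, ∀ x, f (x + g) = f x) : IsPeriodic b f :=
  fun k x => hf (b k) (Submodule.subset_span ⟨k, rfl⟩) x

theorem exists_sub_mem_lattice (x : Euc d) : ∃ y ∈ cell b, x - y ∈ lattice b :=
  ⟨ZSpan.fract b x, ZSpan.fract_mem_fundamentalDomain b x, by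
    rw [ZSpan.fract_apply, sub_sub_cancel]; exact (ZSpan.floor b x).2⟩

/-- The half-open period cell contains only one point of each class modulo periods. -/
theorem eq_of_mem_cell_of_sub_mem {x y : Euc d} (hx : x ∈ cell b) (hy : y ∈ cell b)
    (h : x - y ∈ lattice b) : x = y := by
  rw [← (ZSpan.fract_eq_self (b := b)).2 hx, ← (ZSpan.fract_eq_self (b := b)).2 hy,
    ZSpan.fract_eq_fract]
  have := (lattice b).neg_mem h
  rwa [neg_sub, sub_eq_add_neg, add_comm] at this

theorem isBounded_cell : Bornology.IsBounded (cell b) := ZSpan.fundamentalDomain_isBounded b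

theorem isAddFundamentalDomain_cell : IsAddFundamentalDomain (lattice b) (cell b) volume :=
  ZSpan.isAddFundamentalDomain b volume

instance : Countable (lattice b) :=
  inferInstanceAs (Countable (Submodule.span ℤ (Set.range b)))

instance : VAddInvariantMeasure (lattice b) (Euc d) volume :=
  inferInstanceAs (VAddInvariantMeasure (lattice b).toAddSubgroup (Euc d) volume)

instance : MeasurableConstVAdd (lattice b) (Euc d) :=
  inferInstanceAs (MeasurableConstVAdd (lattice b).toAddSubgroup (Euc d))

theorem volume_cell_lt_top : volume (cell b) < ⊤ := isBounded_cell.measure_lt_top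

instance : IsFiniteMeasure (volume.restrict (cell b)) :=
  ⟨by rw [Measure.restrict_apply_univ]; exact volume_cell_lt_top⟩

namespace PeriodicMesh

variable (M : PeriodicMesh b)

/-! ### Elements and barycentric coordinates -/

/-- The elements of the mesh, i.e. the simplices of full dimension, as a type. -/
abbrev Elem : Type := M.simplices

variable {M} in
/-- The closed simplex spanned by the vertices of `K`. -/
def body (K : M.Elem) : Set (Euc d) := convexHull ℝ (K.1 : Set (Euc d))

variable {M} in
/-- The vertices of an element as an affine basis of `ℝᵈ`. -/
def affBasis (K : M.Elem) : AffineBasis K.1 ℝ (Euc d) where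
  toFun := (↑)
  ind' := M.complex.indep K.2.1
  tot' := by
    refine ((M.complex.indep K.2.1).affineSpan_eq_top_iff_card_eq_finrank_add_one).2 ?_
    simp [K.2.2]

variable {M} in
/-- The barycentric coordinate of the vertex `y` of `K`, extended to an affine function on `ℝᵈ`. -/
def lam (K : M.Elem) (y : K.1) (x : Euc d) : ℝ := (affBasis K).coord y x

variable {M} in
/-- The constant gradient of the barycentric coordinate of the vertex `y` of `K`. -/
def grd (K : M.Elem) (y : K.1) : Euc d :=
  (InnerProductSpace.toDual ℝ (Euc d)).symm
    (LinearMap.toContinuousLinearMap ((affBasis K).coord y).linear)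

variable {M}

@[simp] theorem affBasis_apply (K : M.Elem) (y : K.1) : affBasis K y = y.1 := rfl

theorem range_affBasis (K : M.Elem) : range (affBasis K) = (K.1 : Set (Euc d)) := by
  ext x; simp

theorem mem_body_iff {K : M.Elem} {x : Euc d} : x ∈ body K ↔ ∀ y, 0 ≤ lam K y x := by
  rw [body, ← range_affBasis, AffineBasis.convexHull_eq_nonneg_coord]; rfl

theorem mem_interior_body_iff {K : M.Elem} {x : Euc d} :
    x ∈ interior (body K) ↔ ∀ y, 0 < lam K y x := by
  rw [body, ← range_affBasis, AffineBasis.interior_convexHull]; rfl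

theorem sum_lam (K : M.Elem) (x : Euc d) : ∑ y, lam K y x = 1 :=
  (affBasis K).sum_coord_apply_eq_one x

theorem sum_lam_smul (K : M.Elem) (x : Euc d) : ∑ y, lam K y x • y.1 = x :=
  (affBasis K).linear_combination_coord_eq_self x

theorem lam_sub (K : M.Elem) (y : K.1) (x z : Euc d) :
    lam K y x - lam K y z = inner ℝ (grd K y) (x - z) := by
  rw [grd, InnerProductSpace.toDual_symm_apply]
  have := ((affBasis K).coord y).linearMap_vsub x z
  rw [vsub_eq_sub, vsub_eq_sub] at this
  exact this.symm

theorem lam_self (K : M.Elem) (y : K.1) : lam K y y.1 = 1 := (affBasis K).coord_apply_eq y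

theorem lam_of_ne (K : M.Elem) {y z : K.1} (h : y ≠ z) : lam K y z.1 = 0 :=
  (affBasis K).coord_apply_ne h

theorem lam_le_one {K : M.Elem} {x : Euc d} (hx : x ∈ body K) (y : K.1) : lam K y x ≤ 1 := by
  rw [← sum_lam K x]
  exact Finset.single_le_sum (fun z _ => mem_body_iff.1 hx z) (Finset.mem_univ y)

theorem sum_grd (K : M.Elem) : ∑ y, grd K y = 0 := by
  refine ext_inner_right ℝ fun w => ?_
  rw [sum_inner, inner_zero_left]
  have h : ∀ y, inner ℝ (grd K y) w = lam K y w - lam K y 0 := fun y => by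
    rw [lam_sub, sub_zero]
  simp only [h, Finset.sum_sub_distrib, sum_lam, sub_self]

theorem sum_inner_grd_smul (K : M.Elem) (w : Euc d) :
    ∑ y, (inner ℝ (grd K y) w : ℝ) • y.1 = w := by
  have h : ∀ y, inner ℝ (grd K y) w = lam K y w - lam K y 0 := fun y => by
    rw [lam_sub, sub_zero]
  simp only [h, sub_smul, Finset.sum_sub_distrib, sum_lam_smul, sub_zero]

theorem convex_body (K : M.Elem) : Convex ℝ (body K) := convex_convexHull ℝ _

theorem isCompact_body (K : M.Elem) : IsCompact (body K) :=
  K.1.finite_toSet.isCompact_convexHull ℝ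

theorem vertex_mem_body (K : M.Elem) (y : K.1) : y.1 ∈ body K :=
  subset_convexHull ℝ _ y.2

theorem nonempty_elem_vertices (K : M.Elem) : Nonempty K.1 := by
  rw [Finset.nonempty_coe_sort, ← Finset.card_pos, K.2.2]; omega

/-- Barycentric coordinates with respect to a face and with respect to an element agree. -/
theorem IsBarycentric.sum_eq {x : Euc d} {c : Finset (Euc d) × (Euc d → ℝ)}
    (hc : M.IsBarycentric x c) {K : M.Elem} (hx : x ∈ body K) {F : Type} [AddCommGroup F]
    [Module ℝ F] (f : Euc d → F) : ∑ y ∈ c.1, c.2 y • f y = ∑ y, lam K y x • f y.1 := by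
  classical
  obtain ⟨s, w⟩ := c
  obtain ⟨hs, h0, h1, h2⟩ := hc
  dsimp only at hs h0 h1 h2 ⊢
  have hxs : x ∈ convexHull ℝ (s : Set (Euc d)) := by
    rw [Finset.mem_convexHull']; exact ⟨w, h0, h1, h2⟩
  have hxi := M.complex.inter_subset_convexHull hs K.2.1 ⟨hxs, hx⟩
  rw [← Finset.coe_inter, Finset.mem_convexHull'] at hxi
  obtain ⟨w', h0', h1', h2'⟩ := hxi
  -- extension by zero of the weights on the common face
  set e : Euc d → ℝ := fun y => if y ∈ s ∩ K.1 then w' y else 0 with he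
  have hsub : ∀ t : Finset (Euc d), s ∩ K.1 ⊆ t → ∀ {G : Type} [AddCommGroup G] [Module ℝ G]
      (f : Euc d → G), ∑ y ∈ t, e y • f y = ∑ y ∈ s ∩ K.1, w' y • f y := by
    intro t ht G _ _ f
    rw [← Finset.sum_subset ht (fun y _ hy => by simp only [he, if_neg hy, zero_smul])]
    exact Finset.sum_congr rfl fun y hy => by simp only [he, hy, if_true]
  have huniq : ∀ t ∈ M.complex.faces, s ∩ K.1 ⊆ t → ∀ v : Euc d → ℝ, ∑ y ∈ t, v y = 1 →
      ∑ y ∈ t, v y • y = x → ∀ y ∈ t, v y = e y := by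
    intro t ht hst v hv1 hv2 y hy
    have hi := M.complex.indep ht
    have e1 : ∑ y ∈ t, e y = 1 := by
      have := hsub t hst (fun _ => (1 : ℝ))
      simpa [h1'] using this
    have e2 : ∑ y ∈ t, e y • y = x := by
      have := hsub t hst (fun y => y)
      rw [this, h2']
    have := (affineIndependent_iff_eq_of_fintype_affineCombination_eq ℝ
      ((↑) : t → Euc d)).1 hi (fun y => v y) (fun y => e y)
      (by rw [← hv1]; exact Finset.sum_coe_sort t v) (by rw [← e1]; exact Finset.sum_coe_sort t e)
      (by
        rw [Finset.affineCombination_eq_linear_combination _ _ _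
            (by rw [← hv1]; exact Finset.sum_coe_sort t v),
          Finset.affineCombination_eq_linear_combination _ _ _
            (by rw [← e1]; exact Finset.sum_coe_sort t e)]
        rw [Finset.sum_coe_sort t (fun y => v y • y), Finset.sum_coe_sort t (fun y => e y • y),
          hv2, e2])
    exact congrFun this ⟨y, hy⟩
  rw [Finset.sum_congr rfl fun y hy => by rw [huniq s hs Finset.inter_subset_left w h1 h2 y hy],
    hsub s Finset.inter_subset_left f, ← hsub K.1 Finset.inter_subset_right f,
    ← Finset.sum_coe_sort]
  refine Finset.sum_congr rfl fun y _ => ?_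
  set v : Euc d → ℝ := fun z => if h : z ∈ K.1 then lam K ⟨z, h⟩ x else 0 with hv
  have hv' : ∀ z : K.1, v z = lam K z x := fun z => by simp [hv]
  rw [← hv' y, huniq K.1 K.2.1 Finset.inter_subset_right v ?_ ?_ y y.2]
  · rw [← Finset.sum_coe_sort, ← sum_lam K x]; exact Finset.sum_congr rfl fun z _ => hv' z
  · rw [← Finset.sum_coe_sort, ← sum_lam_smul K x]
    exact Finset.sum_congr rfl fun z _ => by rw [hv' z]

theorem exists_mem_body (M : PeriodicMesh b) (x : Euc d) : ∃ K : M.Elem, x ∈ body K := by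
  have hx : x ∈ M.complex.space := by rw [M.covers]; trivial
  obtain ⟨s, hs, hxs⟩ := Geometry.SimplicialComplex.mem_space_iff.1 hx
  obtain ⟨t, ht, hst, hc⟩ := M.pure s hs
  exact ⟨⟨t, ht, hc⟩, convexHull_mono (Finset.coe_subset.2 hst) hxs⟩

theorem singleton_mem_faces (K : M.Elem) (y : K.1) : {y.1} ∈ M.complex.faces :=
  M.complex.down_closed K.2.1 (by simp) (by simp)

/-! ### Nodes -/

theorem exists_node {y : Euc d} (hy : {y} ∈ M.complex.faces) :
    ∃ i : M.Node, y - i.1 ∈ lattice b := by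
  obtain ⟨z, hz, hyz⟩ := exists_sub_mem_lattice (b := b) y
  refine ⟨⟨z, ?_, hz⟩, hyz⟩
  have := M.invariant _ hy _ ((lattice b).neg_mem hyz)
  simpa using this

theorem node_eq_of_sub_mem {i j : M.Node} (h : i.1 - j.1 ∈ lattice b) : i = j :=
  Subtype.ext (eq_of_mem_cell_of_sub_mem i.2.2 j.2.2 h)

instance : Nonempty M.Node := by
  obtain ⟨K, -⟩ := M.exists_mem_body 0
  obtain ⟨y⟩ := nonempty_elem_vertices K
  exact ⟨(exists_node (singleton_mem_faces K y)).choose⟩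

open Classical in
variable (M) in
/-- The node of which `y` is a translate by a period; meaningful for vertices `y` of the mesh. -/
def node (y : Euc d) : M.Node :=
  if h : ∃ i : M.Node, y - i.1 ∈ lattice b then h.choose else Classical.arbitrary _

theorem sub_node_mem {y : Euc d} (hy : {y} ∈ M.complex.faces) : y - (M.node y).1 ∈ lattice b := by
  rw [node, dif_pos (exists_node hy)]; exact (exists_node hy).choose_spec

theorem node_eq_iff {y : Euc d} (hy : {y} ∈ M.complex.faces) (i : M.Node) :
    M.node y = i ↔ y - i.1 ∈ lattice b := by
  constructor
  · rintro rfl; exact sub_node_mem hy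
  · intro h
    apply node_eq_of_sub_mem
    have := (lattice b).sub_mem h (sub_node_mem hy)
    rwa [sub_sub_sub_cancel_left] at this

theorem _root_.PeriodicFEM.IsPeriodic.apply_node {F : Type*} {f : Euc d → F}
    (hf : IsPeriodic b f) (K : M.Elem)
    (y : K.1) : f (M.node y.1).1 = f y.1 := by
  have := hf.add_mem (sub_node_mem (singleton_mem_faces K y)) (M.node y.1).1
  rw [add_sub_cancel] at this
  exact this.symm

open Classical in
/-- On an element, the basis function of the node `i` is the sum of the barycentric coordinates
of the vertices that are translates of `i`; on very coarse meshes, there can be several of them. -/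
theorem basisFun_eq {K : M.Elem} {x : Euc d} (hx : x ∈ body K) (i : M.Node) :
    M.basisFun i x = ∑ y : K.1, if M.node y.1 = i then lam K y x else 0 := by
  have h := (M.exists_isBarycentric x).choose_spec.sum_eq hx
    (fun y => if y - i.1 ∈ lattice b then (1 : ℝ) else 0)
  simp only [smul_eq_mul, mul_ite, mul_one, mul_zero] at h
  rw [basisFun, bary, h]
  refine Finset.sum_congr rfl fun y _ => ?_
  simp only [node_eq_iff (singleton_mem_faces K y)]

/-- Nodal sums reduce, on an element, to sums over its vertices. -/
theorem sum_basisFun_smul {K : M.Elem} {x : Euc d} (hx : x ∈ body K) {F : Type*} [AddCommGroup F]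
    [Module ℝ F] (f : M.Node → F) :
    ∑ i, M.basisFun i x • f i = ∑ y, lam K y x • f (M.node y.1) := by
  classical
  simp only [basisFun_eq hx, Finset.sum_smul, ite_smul, zero_smul]
  rw [Finset.sum_comm]
  simp

theorem basisFun_nonneg (i : M.Node) (x : Euc d) : 0 ≤ M.basisFun i x := by
  classical
  obtain ⟨K, hK⟩ := M.exists_mem_body x
  rw [basisFun_eq hK]
  refine Finset.sum_nonneg fun y _ => ?_
  split_ifs
  exacts [mem_body_iff.1 hK y, le_rfl]

theorem sum_basisFun (M : PeriodicMesh b) (x : Euc d) : ∑ i, M.basisFun i x = 1 := by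
  obtain ⟨K, hK⟩ := M.exists_mem_body x
  have := sum_basisFun_smul hK (fun _ => (1 : ℝ))
  simpa only [smul_eq_mul, mul_one, sum_lam] using this

theorem basisFun_le_one (i : M.Node) (x : Euc d) : M.basisFun i x ≤ 1 := by
  rw [← M.sum_basisFun x]
  exact Finset.single_le_sum (fun j _ => basisFun_nonneg j x) (Finset.mem_univ i)

theorem periodic_basisFun (i : M.Node) : IsPeriodic b (M.basisFun i) := by
  classical
  refine IsPeriodic.of_forall_mem fun g hg x => ?_
  obtain ⟨K, hK⟩ := M.exists_mem_body (x + g)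
  obtain ⟨hs, h0, h1, h2⟩ := (M.exists_isBarycentric x).choose_spec
  set c := (M.exists_isBarycentric x).choose with hc
  have hbar : M.IsBarycentric (x + g) (c.1.map (addRightEmbedding g), fun y => c.2 (y - g)) := by
    refine ⟨M.invariant _ hs _ hg, ?_, ?_, ?_⟩
    · intro y hy
      obtain ⟨z, hz, rfl⟩ := Finset.mem_map.1 hy
      simpa using h0 z hz
    · simpa using h1
    · simp only [Finset.sum_map, addRightEmbedding_apply, add_sub_cancel_right, smul_add,
        Finset.sum_add_distrib, h2, ← Finset.sum_smul, h1, one_smul]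
  have h := hbar.sum_eq hK (fun y => if y - i.1 ∈ lattice b then (1 : ℝ) else 0)
  have h' := (M.exists_isBarycentric (x + g)).choose_spec.sum_eq hK
    (fun y => if y - i.1 ∈ lattice b then (1 : ℝ) else 0)
  rw [← h] at h'
  simp only [smul_eq_mul, mul_ite, mul_one, mul_zero, Finset.sum_map, addRightEmbedding_apply,
    add_sub_cancel_right] at h'
  rw [basisFun, bary, h', basisFun, bary]
  refine Finset.sum_congr rfl fun y _ => ?_
  have : y + g - i.1 ∈ lattice b ↔ y - i.1 ∈ lattice b := by
    rw [add_sub_right_comm]; exact (lattice b).add_mem_iff_left hg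
  simp only [this, ← hc]

end PeriodicMesh

open scoped Pointwise

/-- A function with pointwise slopes at most `C` is Lipschitz continuous with constant `C`. -/
theorem norm_sub_le_of_forall_eventually {E F : Type*} [NormedAddCommGroup E] [NormedSpace ℝ E]
    [NormedAddCommGroup F] {f : E → F} {C : ℝ}
    (h : ∀ x, ∀ᶠ z in 𝓝 x, ‖f z - f x‖ ≤ C * ‖z - x‖) (x y : E) :
    ‖f y - f x‖ ≤ C * ‖y - x‖ := by
  have hcont : Continuous f := by
    refine continuous_iff_continuousAt.2 fun x => ?_
    rw [ContinuousAt, tendsto_iff_norm_sub_tendsto_zero]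
    refine squeeze_zero' (Eventually.of_forall fun _ => norm_nonneg _) (h x) ?_
    have : Continuous fun z : E => C * ‖z - x‖ := by fun_prop
    simpa using this.tendsto x
  set p : ℝ → E := fun t => x + t • (y - x) with hp
  have hpc : Continuous p := by fun_prop
  have hps : ∀ s t, p s - p t = (s - t) • (y - x) := fun s t => by
    simp only [hp]; rw [sub_smul]; abel
  refine le_of_forall_pos_le_add fun ε hε => ?_
  have key := image_norm_le_of_liminf_right_slope_norm_lt_deriv_boundary
    (f := fun t => f (p t) - f x) (f' := fun _ => C * ‖y - x‖) (a := 0) (b := 1)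
    (B := fun t => (C * ‖y - x‖ + ε) * t) (B' := fun _ => C * ‖y - x‖ + ε)
    (by fun_prop) ?_ (by simp [hp]) (by fun_prop)
    (fun t _ => by simpa using ((hasDerivAt_id t).const_mul (C * ‖y - x‖ + ε)).hasDerivWithinAt)
    (fun _ _ _ => by linarith) (right_mem_Icc.2 zero_le_one)
  · simpa [hp] using key
  · intro t _ r hr
    refine Eventually.frequently ?_
    have h1 : ∀ᶠ z in 𝓝[>] t, ‖f (p z) - f (p t)‖ ≤ C * ‖p z - p t‖ :=
      (hpc.tendsto t).mono_left nhdsWithin_le_nhds |>.eventually (h (p t))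
    filter_upwards [h1, self_mem_nhdsWithin] with z hz htz
    have htz' : 0 < z - t := sub_pos.2 htz
    refine lt_of_le_of_lt ?_ hr
    rw [slope_def_field, div_le_iff₀ htz']
    simp only [Function.comp_apply]
    calc ‖f (p z) - f x‖ - ‖f (p t) - f x‖ ≤ ‖f (p z) - f (p t)‖ := by
          have := norm_sub_norm_le (f (p z) - f x) (f (p t) - f x)
          rwa [sub_sub_sub_cancel_right] at this
      _ ≤ C * ‖p z - p t‖ := hz
      _ = C * ‖y - x‖ * (z - t) := by
          rw [hps, norm_smul, Real.norm_of_nonneg htz'.le]; ring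

namespace PeriodicMesh

variable {M : PeriodicMesh b}

/-! ### Translates of elements -/

/-- The translate of an element by a period. -/
def shift (g : lattice b) (K : M.Elem) : M.Elem :=
  ⟨K.1.map (addRightEmbedding (g : Euc d)), M.invariant _ K.2.1 _ g.2, by
    rw [Finset.card_map]; exact K.2.2⟩

theorem shift_shift (g g' : lattice b) (K : M.Elem) : shift g (shift g' K) = shift (g' + g) K := by
  apply Subtype.ext
  ext x
  simp [shift, add_assoc]

theorem shift_zero (K : M.Elem) : shift 0 K = K := by
  apply Subtype.ext
  ext x
  simp [shift]

theorem body_shift (g : lattice b) (K : M.Elem) : body (shift g K) = g +ᵥ body K := by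
  have : ((shift g K).1 : Set (Euc d)) = (g : Euc d) +ᵥ (K.1 : Set (Euc d)) := by
    ext x
    simp only [shift, Finset.coe_map, addRightEmbedding_apply, mem_image, mem_vadd_set,
      vadd_eq_add, add_comm]
  rw [body, this, convexHull_vadd]; rfl

/-- Translations by periods act freely on the elements. -/
theorem eq_zero_of_shift_eq {g : lattice b} {K : M.Elem} (h : shift g K = K) : g = 0 := by
  have h1 : ∑ y ∈ (shift g K).1, y = ∑ y ∈ K.1, y := by rw [h]
  simp only [shift, Finset.sum_map, addRightEmbedding_apply, Finset.sum_add_distrib,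
    Finset.sum_const, add_eq_left] at h1
  rw [← Nat.cast_smul_eq_nsmul ℝ, smul_eq_zero] at h1
  rcases h1 with h1 | h1
  · have h2 := K.2.2
    rw [Nat.cast_eq_zero] at h1
    omega
  · exact Subtype.ext h1

variable (M) in
/-- The finite set of elements with a vertex in the period cell. -/
theorem finite_elem_cell : {K : M.Elem | ∃ y ∈ K.1, y ∈ cell b}.Finite := by
  refine (M.finite.preimage Subtype.val_injective.injOn).subset ?_
  intro K hK
  exact ⟨K.2.1, hK⟩

theorem exists_shift_cell (K : M.Elem) : ∃ g : lattice b, ∃ y ∈ (shift g K).1, y ∈ cell b := by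
  obtain ⟨y⟩ := nonempty_elem_vertices K
  obtain ⟨z, hz, hyz⟩ := exists_sub_mem_lattice (b := b) y.1
  refine ⟨-⟨_, hyz⟩, z, Finset.mem_map.2 ⟨y, y.2, ?_⟩, hz⟩
  simp

variable (M) in
/-- There are finitely many elements up to periods. -/
theorem exists_reps : ∃ R : Finset M.Elem,
    (∀ K, ∃ K' ∈ R, ∃ g : lattice b, K = shift g K') ∧
      ∀ K ∈ R, ∀ K' ∈ R, ∀ g : lattice b, K' = shift g K → K' = K := by
  classical
  let r : Setoid M.Elem :=
    { r := fun K K' => ∃ g : lattice b, K' = shift g K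
      iseqv :=
        { refl := fun K => ⟨0, (shift_zero K).symm⟩
          symm := by
            rintro K K' ⟨g, rfl⟩
            exact ⟨-g, by rw [shift_shift, add_neg_cancel, shift_zero]⟩
          trans := by
            rintro K K' K'' ⟨g, rfl⟩ ⟨g', rfl⟩
            exact ⟨g + g', shift_shift _ _ _⟩ } }
  refine ⟨M.finite_elem_cell.toFinset.image fun K => (Quotient.mk r K).out, ?_, ?_⟩
  · intro K
    obtain ⟨g, hg⟩ := exists_shift_cell K
    refine ⟨(Quotient.mk r (shift g K)).out, Finset.mem_image.2 ⟨_, by simpa using hg, rfl⟩, ?_⟩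
    have h1 : r (Quotient.mk r (shift g K)).out (shift g K) := Quotient.mk_out _
    have h2 : r (shift g K) K := r.symm ⟨g, rfl⟩
    exact r.trans h1 h2
  · intro K hK K' hK' g hg
    obtain ⟨L, -, rfl⟩ := Finset.mem_image.1 hK
    obtain ⟨L', -, rfl⟩ := Finset.mem_image.1 hK'
    have : r (Quotient.mk r L).out (Quotient.mk r L').out := ⟨g, hg⟩
    have h2 := Quotient.sound this
    rw [Quotient.out_eq, Quotient.out_eq] at h2
    rw [h2]

variable (M) in
/-- A choice of one element from each class of elements modulo periods. -/
def reps : Finset M.Elem := M.exists_reps.choose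

theorem exists_mem_reps (K : M.Elem) : ∃ K' ∈ M.reps, ∃ g : lattice b, K = shift g K' :=
  M.exists_reps.choose_spec.1 K

theorem eq_of_mem_reps {K K' : M.Elem} (hK : K ∈ M.reps) (hK' : K' ∈ M.reps) {g : lattice b}
    (h : K' = shift g K) : K' = K :=
  M.exists_reps.choose_spec.2 K hK K' hK' g h

instance : Countable M.Elem := by
  have : Function.Surjective (fun q : lattice b × M.reps => shift q.1 q.2.1) := fun K => by
    obtain ⟨K', hK', g, rfl⟩ := exists_mem_reps K
    exact ⟨(g, ⟨K', hK'⟩), rfl⟩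
  exact this.countable

theorem diam_shift (g : lattice b) (K : M.Elem) :
    Metric.diam (body (shift g K)) = Metric.diam (body K) := by
  rw [body_shift]
  exact diam_vadd (g : Euc d) (body K)

variable (M) in
theorem bddAbove_diam : BddAbove ((fun s : Finset (Euc d) =>
    Metric.diam (convexHull ℝ (s : Set (Euc d)))) '' M.simplices) := by
  refine ((M.reps.finite_toSet.image fun K => Metric.diam (body K)).subset ?_).bddAbove
  rintro _ ⟨s, hs, rfl⟩
  obtain ⟨K', hK', g, hg⟩ := exists_mem_reps (⟨s, hs⟩ : M.Elem)
  refine ⟨K', hK', ?_⟩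
  dsimp only
  rw [← diam_shift g, ← hg]; rfl

theorem diam_le_meshSize (K : M.Elem) : Metric.diam (body K) ≤ M.meshSize :=
  le_csSup M.bddAbove_diam ⟨K.1, K.2, rfl⟩

variable (M) in
theorem meshSize_nonneg : 0 ≤ M.meshSize := by
  obtain ⟨K, -⟩ := M.exists_mem_body 0
  exact Metric.diam_nonneg.trans (diam_le_meshSize K)

theorem norm_sub_le_diam {K : M.Elem} {x z : Euc d} (hx : x ∈ body K) (hz : z ∈ body K) :
    ‖x - z‖ ≤ Metric.diam (body K) := by
  rw [← dist_eq_norm]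
  exact Metric.dist_le_diam_of_mem (isCompact_body K).isBounded hx hz

theorem norm_sub_le_meshSize {K : M.Elem} {x z : Euc d} (hx : x ∈ body K) (hz : z ∈ body K) :
    ‖x - z‖ ≤ M.meshSize := (norm_sub_le_diam hx hz).trans (diam_le_meshSize K)

variable (M) in
theorem locallyFinite_body : LocallyFinite (body : M.Elem → Set (Euc d)) := by
  intro x
  obtain ⟨R, hR⟩ := (isBounded_cell (b := b)).exists_norm_le
  refine ⟨Metric.ball x 1, Metric.ball_mem_nhds x one_pos, ?_⟩
  have hfin : {g : lattice b | ‖(g : Euc d)‖ ≤ R + M.meshSize + ‖x‖ + 1}.Finite := by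
    refine Set.Finite.of_finite_image (f := Subtype.val) ?_ Subtype.val_injective.injOn
    refine (ZSpan.setFinite_inter b
      (Metric.isBounded_closedBall (x := (0 : Euc d)) (r := R + M.meshSize + ‖x‖ + 1))).subset ?_
    rintro _ ⟨g, hg, rfl⟩
    exact ⟨mem_closedBall_zero_iff.2 hg, g.2⟩
  refine ((hfin.prod M.finite_elem_cell).image (fun q => shift (-q.1) q.2)).subset ?_
  rintro K ⟨z, hzK, hzx⟩
  obtain ⟨g, y, hy, hyc⟩ := exists_shift_cell K
  refine ⟨(g, shift g K), ⟨?_, y, hy, hyc⟩, by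
    dsimp only; rw [shift_shift, add_neg_cancel, shift_zero]⟩
  obtain ⟨y', hy', rfl⟩ := Finset.mem_map.1 hy
  rw [addRightEmbedding_apply] at hyc
  have h1 := hR _ hyc
  have h2 := norm_sub_le_meshSize (vertex_mem_body K ⟨y', hy'⟩) hzK
  have h3 : ‖z - x‖ < 1 := mem_ball_iff_norm.1 hzx
  show ‖(g : Euc d)‖ ≤ _
  have h4 : (g : Euc d) = (y' + g) - (y' - z) - (z - x) - x := by abel
  rw [h4]
  have h5 := norm_sub_le ((y' + g) - (y' - z) - (z - x)) x
  have h6 := norm_sub_le ((y' + g) - (y' - z)) (z - x)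
  have h7 := norm_sub_le (y' + (g : Euc d)) (y' - z)
  dsimp only at h2
  linarith

theorem isClosed_body (K : M.Elem) : IsClosed (body K) := (isCompact_body K).isClosed

variable (M) in
/-- The boundaries of the countably many convex elements are null sets. -/
theorem ae_mem_interior_body : ∀ᵐ x : Euc d, ∃ K : M.Elem, x ∈ interior (body K) := by
  have : ∀ᵐ x : Euc d, ∀ K : M.Elem, x ∉ frontier (body K) :=
    ae_all_iff.2 fun K => measure_eq_zero_iff_ae_notMem.1 ((convex_body K).addHaar_frontier volume)
  filter_upwards [this] with x hx
  obtain ⟨K, hK⟩ := M.exists_mem_body x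
  refine ⟨K, ?_⟩
  by_contra h
  exact hx K (by rw [(isClosed_body K).frontier_eq]; exact ⟨hK, h⟩)

theorem eq_of_mem_interior {K K' : M.Elem} {x : Euc d} (hK : x ∈ interior (body K))
    (hK' : x ∈ interior (body K')) : K = K' := by
  classical
  have key : ∀ K K' : M.Elem, x ∈ interior (body K) → x ∈ body K' → K.1 ⊆ K'.1 := by
    intro K K' hK hK' y hy
    obtain ⟨hs, h0, h1, h2⟩ : M.IsBarycentric x (K'.1, fun z =>
        if h : z ∈ K'.1 then lam K' ⟨z, h⟩ x else 0) := by
      refine ⟨K'.2.1, ?_, ?_, ?_⟩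
      · intro z hz; simp only [dif_pos hz]; exact mem_body_iff.1 hK' _
      · rw [← Finset.sum_coe_sort]; simp only [Finset.coe_mem, dite_true]; exact sum_lam K' x
      · rw [← Finset.sum_coe_sort]; simp only [Finset.coe_mem, dite_true]; exact sum_lam_smul K' x
    have h := IsBarycentric.sum_eq ⟨hs, h0, h1, h2⟩ (interior_subset hK)
      (fun z => if z = y then (1 : ℝ) else 0)
    by_contra hyK
    have hpos := mem_interior_body_iff.1 hK ⟨y, hy⟩
    rw [Finset.sum_eq_zero (fun z hz => by
      have hzy : z ≠ y := fun e => hyK (e ▸ hz)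
      rw [if_neg hzy, smul_zero])] at h
    rw [Finset.sum_eq_single (⟨y, hy⟩ : K.1)] at h
    · simp only [if_true, smul_eq_mul, mul_one] at h
      exact hpos.ne h
    · intro z _ hz
      rw [if_neg (fun h => hz (Subtype.ext h)), smul_zero]
    · intro h; exact absurd (Finset.mem_univ _) h
  exact Subtype.ext (Finset.Subset.antisymm (key K K' hK (interior_subset hK'))
    (key K' K hK' (interior_subset hK)))

/-! ### Integrals over the period cell as sums over elements -/

variable (M) in
/-- Up to a null set, the representatives of the elements tile a fundamental domain of the lattice
of periods, which therefore can replace the period cell in integrals of periodic functions. -/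
theorem isAddFundamentalDomain_reps :
    IsAddFundamentalDomain (lattice b) (⋃ K ∈ M.reps, interior (body K)) volume where
  nullMeasurableSet :=
    (isOpen_biUnion fun _ _ => isOpen_interior).measurableSet.nullMeasurableSet
  ae_covers := by
    filter_upwards [M.ae_mem_interior_body] with x ⟨K, hK⟩
    obtain ⟨K', hK', g, rfl⟩ := exists_mem_reps K
    refine ⟨-g, mem_iUnion₂.2 ⟨K', hK', ?_⟩⟩
    rw [body_shift, interior_vadd] at hK
    rwa [← mem_vadd_set_iff_neg_vadd_mem]
  aedisjoint := by
    intro g g' hg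
    refine Disjoint.aedisjoint (disjoint_left.2 fun x hx hx' => hg ?_)
    have aux : ∀ g : lattice b, x ∈ g +ᵥ (⋃ K ∈ M.reps, interior (body K)) →
        ∃ K ∈ M.reps, x ∈ interior (body (shift g K)) := by
      intro g hx
      rw [mem_vadd_set_iff_neg_vadd_mem, mem_iUnion₂] at hx
      obtain ⟨K, hK, h⟩ := hx
      refine ⟨K, hK, ?_⟩
      rw [body_shift, interior_vadd]
      rwa [← mem_vadd_set_iff_neg_vadd_mem] at h
    obtain ⟨K, hK, h⟩ := aux g hx
    obtain ⟨K', hK', h'⟩ := aux g' hx'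
    have h1 := eq_of_mem_interior h h'
    have h2 : K' = shift (g - g') K := by
      have := congrArg (shift (-g')) h1
      rw [shift_shift, shift_shift, add_neg_cancel, shift_zero, ← sub_eq_add_neg] at this
      exact this.symm
    have h3 := eq_of_mem_reps hK hK' h2
    rw [h3] at h2
    exact sub_eq_zero.1 (eq_zero_of_shift_eq h2.symm)

theorem integrableOn_body {F : Type*} [NormedAddCommGroup F] [NormedSpace ℝ F] {f : Euc d → F}
    (hf : IsPeriodic b f) (hi : IntegrableOn f (cell b)) (K : M.Elem) (hK : K ∈ M.reps) :
    IntegrableOn f (body K) := by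
  have h := (isAddFundamentalDomain_cell.integrableOn_iff M.isAddFundamentalDomain_reps
    (f := f) (fun g x => by
      show f ((g : Euc d) + x) = f x
      rw [add_comm]; exact hf.add_mem g.2 x)).1 hi
  have h1 : IntegrableOn f (interior (body K)) := h.mono_set
    (subset_biUnion_of_mem (u := fun K : M.Elem => interior (body K)) hK)
  refine h1.congr_set_ae ?_
  exact (interior_ae_eq_of_null_frontier ((convex_body K).addHaar_frontier volume)).symm

/-- The integral of a periodic function over the period cell is the sum of its integrals over
representatives of the elements. -/
theorem setIntegral_cell_eq {F : Type*} [NormedAddCommGroup F] [NormedSpace ℝ F] {f : Euc d → F}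
    (hf : IsPeriodic b f) (hi : IntegrableOn f (cell b)) :
    ∫ x in cell b, f x = ∑ K ∈ M.reps, ∫ x in body K, f x := by
  rw [isAddFundamentalDomain_cell.setIntegral_eq M.isAddFundamentalDomain_reps (f := f)
    (fun g x => by
      show f ((g : Euc d) + x) = f x
      rw [add_comm]; exact hf.add_mem g.2 x)]
  rw [integral_biUnion_finset M.reps (fun K _ => isOpen_interior.measurableSet)
    (fun K hK K' hK' hne => disjoint_left.2 fun x hx hx' => hne (eq_of_mem_interior hx hx'))
    (fun K hK => (integrableOn_body hf hi K hK).mono_set interior_subset)]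
  refine Finset.sum_congr rfl fun K _ => setIntegral_congr_set ?_
  exact interior_ae_eq_of_null_frontier ((convex_body K).addHaar_frontier volume)

/-! ### Lipschitz continuity and gradients of finite element functions -/

theorem hasFDerivAt_lam (K : M.Elem) (y : K.1) (x : Euc d) :
    HasFDerivAt (lam K y) (innerSL ℝ (grd K y)) x := by
  have h : lam K y = fun z => lam K y x + innerSL ℝ (grd K y) (z - x) := by
    funext z
    rw [innerSL_apply_apply, ← lam_sub]; ring
  rw [h]
  simp only [map_sub]
  exact ((innerSL ℝ (grd K y)).hasFDerivAt.sub_const _).const_add _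

open Classical in
theorem hasGradientAt_basisFun {K : M.Elem} {x : Euc d} (hx : x ∈ interior (body K))
    (i : M.Node) :
    HasGradientAt (M.basisFun i) (∑ y : K.1, if M.node y.1 = i then grd K y else 0) x := by
  rw [hasGradientAt_iff_hasFDerivAt]
  have h : M.basisFun i =ᶠ[𝓝 x] fun z => ∑ y : K.1, if M.node y.1 = i then lam K y z else 0 := by
    filter_upwards [isOpen_interior.mem_nhds hx] with z hz
    exact basisFun_eq (interior_subset hz) i
  refine HasFDerivAt.congr_of_eventuallyEq ?_ h
  rw [map_sum]
  refine HasFDerivAt.fun_sum fun y _ => ?_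
  split_ifs
  · exact hasFDerivAt_lam K y x
  · rw [map_zero]; exact hasFDerivAt_const _ _

/-- Sums over the nodes that are linear in the gradients of the basis functions reduce, on an
element, to sums over its vertices. -/
theorem sum_gradient {K : M.Elem} {x : Euc d} (hx : x ∈ interior (body K)) {F : Type*}
    [AddCommGroup F] [Module ℝ F] (f : M.Node → Euc d →ₗ[ℝ] F) :
    ∑ i, f i (gradient (M.basisFun i) x) = ∑ y, f (M.node y.1) (grd K y) := by
  classical
  simp only [(hasGradientAt_basisFun hx _).gradient, map_sum, apply_ite (f _), map_zero]
  rw [Finset.sum_comm]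
  simp

variable (M) in
/-- The basis functions are Lipschitz continuous: their slopes are bounded on each of the finitely
many elements up to periods, and only finitely many elements meet near a point. -/
theorem exists_lipschitz_basisFun :
    ∃ C : ℝ, 0 ≤ C ∧ ∀ i x z, |M.basisFun i z - M.basisFun i x| ≤ C * ‖z - x‖ := by
  classical
  have hfin := M.locallyFinite_body.finite_nonempty_inter_compact
    (isBounded_cell (b := b)).isCompact_closure
  set C : ℝ := ∑ K ∈ hfin.toFinset, ∑ y : K.1, ‖grd K y‖ with hC
  have hC0 : 0 ≤ C := by positivity
  refine ⟨C, hC0, fun i x z => norm_sub_le_of_forall_eventually (f := M.basisFun i) ?_ x z⟩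
  have hcell : ∀ x ∈ cell b, ∀ᶠ z in 𝓝 x, |M.basisFun i z - M.basisFun i x| ≤ C * ‖z - x‖ := by
    intro x hx
    filter_upwards [M.locallyFinite_body.eventually_subset isClosed_body x] with z hz
    obtain ⟨K, hK⟩ := M.exists_mem_body z
    have hKx : x ∈ body K := hz hK
    rw [basisFun_eq hK, basisFun_eq hKx, ← Finset.sum_sub_distrib]
    have h1 : ∑ y : K.1, ‖grd K y‖ ≤ C :=
      Finset.single_le_sum (f := fun K : M.Elem => ∑ y : K.1, ‖grd K y‖)
        (fun K _ => by positivity)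
        (hfin.mem_toFinset.2 ⟨x, hKx, subset_closure hx⟩)
    calc _ ≤ ∑ y : K.1, ‖grd K y‖ * ‖z - x‖ := by
          refine (Finset.abs_sum_le_sum_abs _ _).trans (Finset.sum_le_sum fun y _ => ?_)
          split_ifs
          · rw [lam_sub]; exact abs_real_inner_le_norm _ _
          · rw [sub_zero, abs_zero]; positivity
      _ = (∑ y : K.1, ‖grd K y‖) * ‖z - x‖ := by rw [Finset.sum_mul]
      _ ≤ C * ‖z - x‖ := by gcongr
  intro x
  obtain ⟨x', hx', hg⟩ := exists_sub_mem_lattice (b := b) x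
  have h1 := hcell x' hx'
  have h2 : Tendsto (fun z => z - (x - x')) (𝓝 x) (𝓝 x') := by
    have : Continuous fun z : Euc d => z - (x - x') := by fun_prop
    simpa using this.tendsto x
  filter_upwards [h2.eventually h1] with z hz
  have h3 : ∀ w, M.basisFun i (w - (x - x')) = M.basisFun i w := fun w => by
    have := (periodic_basisFun i).add_mem hg (w - (x - x'))
    rw [sub_add_cancel] at this
    exact this.symm
  have h4 : M.basisFun i x' = M.basisFun i x := by rw [← h3 x]; congr 1; abel
  rw [h3, h4] at hz
  rw [show z - (x - x') - x' = z - x by abel] at hz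
  exact hz

end PeriodicMesh

/-! ### Bounded measurable functions -/

/-- Bounded measurable functions; they are integrable for every finite measure. -/
structure BddMeas {X F : Type*} [MeasurableSpace X] [NormedAddCommGroup F] (f : X → F) : Prop where
  stronglyMeasurable : StronglyMeasurable f
  bound : ∃ C, ∀ x, ‖f x‖ ≤ C

namespace BddMeas

variable {X F : Type*} [MeasurableSpace X] [NormedAddCommGroup F] {f g : X → F}

theorem integrable (hf : BddMeas f) (μ : Measure X) [IsFiniteMeasure μ] : Integrable f μ := by
  obtain ⟨C, hC⟩ := hf.bound
  exact Integrable.of_bound hf.stronglyMeasurable.aestronglyMeasurable C (Eventually.of_forall hC)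

theorem const (c : F) : BddMeas fun _ : X => c :=
  ⟨stronglyMeasurable_const, ‖c‖, fun _ => le_rfl⟩

theorem add (hf : BddMeas f) (hg : BddMeas g) : BddMeas fun x => f x + g x := by
  obtain ⟨C, hC⟩ := hf.bound
  obtain ⟨D, hD⟩ := hg.bound
  exact ⟨hf.1.add hg.1, C + D, fun x => (norm_add_le _ _).trans (add_le_add (hC x) (hD x))⟩

theorem neg (hf : BddMeas f) : BddMeas fun x => -f x := by
  obtain ⟨C, hC⟩ := hf.bound
  exact ⟨hf.1.neg, C, fun x => by rw [norm_neg]; exact hC x⟩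

theorem sub (hf : BddMeas f) (hg : BddMeas g) : BddMeas fun x => f x - g x := by
  simp only [sub_eq_add_neg]; exact hf.add hg.neg

theorem sum {ι : Type*} (s : Finset ι) {f : ι → X → F} (hf : ∀ i ∈ s, BddMeas (f i)) :
    BddMeas fun x => ∑ i ∈ s, f i x := by
  classical
  induction s using Finset.induction_on with
  | empty => simpa using const (0 : F)
  | insert i s hi ih =>
    simp only [Finset.sum_insert hi]
    exact (hf i (by simp)).add (ih fun j hj => hf j (by simp [hj]))

theorem smul [NormedSpace ℝ F] {a : X → ℝ} (ha : BddMeas a) (hf : BddMeas f) :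
    BddMeas fun x => a x • f x := by
  obtain ⟨C, hC⟩ := ha.bound
  obtain ⟨D, hD⟩ := hf.bound
  refine ⟨ha.1.smul hf.1, C * D, fun x => ?_⟩
  rw [norm_smul]
  exact mul_le_mul (hC x) (hD x) (norm_nonneg _) ((norm_nonneg _).trans (hC x))

theorem mul {f g : X → ℝ} (hf : BddMeas f) (hg : BddMeas g) : BddMeas fun x => f x * g x := by
  simpa only [smul_eq_mul] using hf.smul hg

theorem inner [InnerProductSpace ℝ F] (hf : BddMeas f) (hg : BddMeas g) :
    BddMeas fun x => inner ℝ (f x) (g x) := by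
  obtain ⟨C, hC⟩ := hf.bound
  obtain ⟨D, hD⟩ := hg.bound
  refine ⟨hf.1.inner hg.1, C * D, fun x => ?_⟩
  exact (norm_inner_le_norm _ _).trans
    (mul_le_mul (hC x) (hD x) (norm_nonneg _) ((norm_nonneg _).trans (hC x)))

theorem norm (hf : BddMeas f) : BddMeas fun x => ‖f x‖ := by
  obtain ⟨C, hC⟩ := hf.bound
  exact ⟨hf.1.norm, C, fun x => by rw [norm_norm]; exact hC x⟩

theorem pow {f : X → ℝ} (hf : BddMeas f) (n : ℕ) : BddMeas fun x => f x ^ n := by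
  obtain ⟨C, hC⟩ := hf.bound
  exact ⟨hf.1.pow n, C ^ n, fun x => by
    rw [norm_pow]; exact pow_le_pow_left₀ (norm_nonneg _) (hC x) n⟩

theorem clm {G : Type*} [NormedAddCommGroup G] [NormedSpace ℝ F] [NormedSpace ℝ G] (hf : BddMeas f)
    (L : F →L[ℝ] G) : BddMeas fun x => L (f x) := by
  obtain ⟨C, hC⟩ := hf.bound
  exact ⟨L.continuous.comp_stronglyMeasurable hf.1, ‖L‖ * C, fun x =>
    (L.le_opNorm _).trans (mul_le_mul_of_nonneg_left (hC x) (norm_nonneg _))⟩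

end BddMeas

/-! ### Continuous periodic functions -/

/-- A continuous function on space-time that is periodic in space is bounded on bounded time
intervals. -/
theorem exists_bound_of_periodic {F : Type*} [NormedAddCommGroup F] {f : ℝ → Euc d → F}
    (hf : Continuous fun z : ℝ × Euc d => f z.1 z.2) (hp : ∀ t, IsPeriodic b (f t)) (T : ℝ) :
    ∃ C, 0 ≤ C ∧ ∀ t ∈ Icc 0 T, ∀ x, ‖f t x‖ ≤ C := by
  obtain ⟨C, hC⟩ := ((isCompact_Icc (a := (0 : ℝ)) (b := T)).prod
    (isBounded_cell (b := b)).isCompact_closure).exists_bound_of_continuousOn hf.continuousOn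
  refine ⟨max C 0, le_max_right _ _, fun t ht x => ?_⟩
  obtain ⟨y, hy, hxy⟩ := exists_sub_mem_lattice (b := b) x
  have h := (hp t).add_mem hxy y
  rw [add_sub_cancel] at h
  rw [h]
  exact (hC (t, y) ⟨ht, subset_closure hy⟩).trans (le_max_left _ _)

/-- A continuous function on space-time that is periodic in space is uniformly continuous in space,
uniformly on bounded time intervals. -/
theorem exists_modulus_of_periodic {F : Type*} [NormedAddCommGroup F] {f : ℝ → Euc d → F}
    (hf : Continuous fun z : ℝ × Euc d => f z.1 z.2) (hp : ∀ t, IsPeriodic b (f t)) (T : ℝ)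
    {ε : ℝ} (hε : 0 < ε) :
    ∃ δ > 0, ∀ t ∈ Icc 0 T, ∀ x z, ‖z - x‖ ≤ δ → ‖f t z - f t x‖ ≤ ε := by
  obtain ⟨R, hR⟩ := (isBounded_cell (b := b)).exists_norm_le
  have hK : IsCompact (Icc (0 : ℝ) T ×ˢ Metric.closedBall (0 : Euc d) (R + 1)) :=
    isCompact_Icc.prod (isCompact_closedBall _ _)
  have hu := Metric.uniformContinuousOn_iff_le.1
    (hK.uniformContinuousOn_of_continuous hf.continuousOn) ε hε
  obtain ⟨δ, hδ, h⟩ := hu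
  refine ⟨min δ 1, lt_min hδ one_pos, fun t ht x z hxz => ?_⟩
  obtain ⟨y, hy, hxy⟩ := exists_sub_mem_lattice (b := b) x
  have h1 := (hp t).add_mem hxy y
  have h2 := (hp t).add_mem hxy (z - (x - y))
  rw [add_sub_cancel] at h1
  rw [sub_add_cancel] at h2
  rw [h1, h2, ← dist_eq_norm]
  have h3 : z - (x - y) = y + (z - x) := by abel
  have h4 := hR y hy
  refine h (t, z - (x - y)) ⟨ht, ?_⟩ (t, y) ⟨ht, ?_⟩ ?_
  · rw [mem_closedBall_zero_iff, h3]
    exact (norm_add_le _ _).trans (add_le_add h4 (hxz.trans (min_le_right _ _)))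
  · rw [mem_closedBall_zero_iff]; linarith
  · rw [Prod.dist_eq, dist_self, max_eq_right dist_nonneg, dist_eq_norm, h3, add_sub_cancel_left]
    exact hxz.trans (min_le_left _ _)

theorem IsPeriodic.fderiv {F : Type*} [NormedAddCommGroup F] [NormedSpace ℝ F] {f : Euc d → F}
    (hf : IsPeriodic b f) : IsPeriodic b (fderiv ℝ f) := by
  intro k x
  rw [← fderiv_comp_add_right]
  congr 1
  funext z
  exact hf k z

theorem IsPeriodic.gradient {f : Euc d → ℝ} (hf : IsPeriodic b f) :
    IsPeriodic b (gradient f) := by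
  intro k x
  simp only [_root_.gradient, hf.fderiv k x]

theorem IsPeriodic.mul {f g : Euc d → ℝ} (hf : IsPeriodic b f) (hg : IsPeriodic b g) :
    IsPeriodic b fun x => f x * g x := fun k x => by dsimp only; rw [hf k x, hg k x]

/-! ### Integration by parts over the period cell -/

theorem setIntegral_cell_add {F : Type*} [NormedAddCommGroup F] [NormedSpace ℝ F] {f : Euc d → F}
    (hf : IsPeriodic b f) (w : Euc d) : ∫ x in cell b, f (x + w) = ∫ x in cell b, f x := by
  have h1 : IsAddFundamentalDomain (lattice b) ((fun x => x + w) ⁻¹' cell b)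
      (volume : Measure (Euc d)) := by
    refine isAddFundamentalDomain_cell.preimage_of_equiv
      (measurePreserving_add_right volume w).quasiMeasurePreserving
      (e := id) Function.bijective_id ?_
    intro g x
    show (g : Euc d) + x + w = (g : Euc d) + (x + w)
    abel
  rw [isAddFundamentalDomain_cell.setIntegral_eq h1 (f := fun x => f (x + w)) ?_,
    (measurePreserving_add_right volume w).setIntegral_preimage_emb
      (measurableEmbedding_addRight w) f]
  intro g x
  show f ((g : Euc d) + x + w) = f (x + w)
  rw [add_assoc, add_comm, hf.add_mem g.2]

/-- Directional derivatives of a Lipschitz continuous periodic function have mean value zero. -/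
theorem setIntegral_cell_fderiv {f : Euc d → ℝ} (hf : IsPeriodic b f) {C : ℝ}
    (hC : ∀ x z, |f z - f x| ≤ C * ‖z - x‖) (w : Euc d) :
    ∫ x in cell b, fderiv ℝ f x w = 0 := by
  have hL : LipschitzWith C.toNNReal f := LipschitzWith.of_dist_le_mul fun x y => by
    rw [Real.dist_eq, dist_eq_norm]
    refine (hC y x).trans ?_
    gcongr
    exact Real.le_coe_toNNReal C
  have hcont := hL.continuous
  have hbd : IntegrableOn f (cell b) := by
    have : IntegrableOn f (closure (cell b)) :=
      hcont.continuousOn.integrableOn_compact isBounded_cell.isCompact_closure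
    exact this.mono_set subset_closure
  have hbd' : ∀ a : Euc d, IntegrableOn (fun x => f (x + a)) (cell b) := fun a => by
    have : IntegrableOn (fun x => f (x + a)) (closure (cell b)) :=
      (hcont.comp (continuous_add_const a)).continuousOn.integrableOn_compact
        isBounded_cell.isCompact_closure
    exact this.mono_set subset_closure
  have hlim : Tendsto (fun n : ℕ => ∫ x in cell b,
      ((n : ℝ) + 1) * (f (x + ((n : ℝ) + 1)⁻¹ • w) - f x)) atTop
      (𝓝 (∫ x in cell b, fderiv ℝ f x w)) := by
    refine tendsto_integral_of_dominated_convergence (fun _ => C * ‖w‖) ?_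
      (integrable_const _) ?_ ?_
    · intro n
      exact Continuous.aestronglyMeasurable (by fun_prop)
    · intro n
      refine Eventually.of_forall fun x => ?_
      have h1 := hC x (x + ((n : ℝ) + 1)⁻¹ • w)
      have hn : (0 : ℝ) < n + 1 := by positivity
      rw [add_sub_cancel_left, norm_smul, Real.norm_of_nonneg (by positivity)] at h1
      rw [norm_mul, Real.norm_of_nonneg hn.le, Real.norm_eq_abs]
      calc _ ≤ ((n : ℝ) + 1) * (C * (((n : ℝ) + 1)⁻¹ * ‖w‖)) := by gcongr
        _ = C * ‖w‖ := by field_simp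
    · refine ae_restrict_of_ae ?_
      filter_upwards [hL.ae_differentiableAt] with x hx
      refine hx.hasFDerivAt.lim w (c := fun n : ℕ => (n : ℝ) + 1) ?_
      exact tendsto_norm_atTop_atTop.comp
        (tendsto_atTop_add_const_right _ _ tendsto_natCast_atTop_atTop)
  have h0 : ∀ n : ℕ, ∫ x in cell b, ((n : ℝ) + 1) * (f (x + ((n : ℝ) + 1)⁻¹ • w) - f x) = 0 := by
    intro n
    rw [integral_const_mul, integral_sub (hbd' _) hbd, setIntegral_cell_add hf, sub_self, mul_zero]
  simp only [h0] at hlim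
  exact (tendsto_nhds_unique tendsto_const_nhds hlim).symm

/-- Integration by parts for bounded Lipschitz continuous periodic functions. -/
theorem setIntegral_cell_mul_fderiv {f g : Euc d → ℝ} (hf : IsPeriodic b f) (hg : IsPeriodic b g)
    {C D A B : ℝ} (hC : ∀ x z, |f z - f x| ≤ C * ‖z - x‖) (hD : ∀ x z, |g z - g x| ≤ D * ‖z - x‖)
    (hA : ∀ x, |f x| ≤ A) (hB : ∀ x, |g x| ≤ B)  (w : Euc d) :
    ∫ x in cell b, f x * fderiv ℝ g x w = - ∫ x in cell b, g x * fderiv ℝ f x w := by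
  have lip : ∀ {f : Euc d → ℝ} {C : ℝ}, (∀ x z, |f z - f x| ≤ C * ‖z - x‖) →
      LipschitzWith C.toNNReal f := fun {f C} hC => LipschitzWith.of_dist_le_mul fun x y => by
    rw [Real.dist_eq, dist_eq_norm]
    refine (hC y x).trans ?_
    gcongr
    exact Real.le_coe_toNNReal C
  have bm : ∀ {f g : Euc d → ℝ} {C D A: ℝ}, (∀ x z, |f z - f x| ≤ C * ‖z - x‖) →
      (∀ x z, |g z - g x| ≤ D * ‖z - x‖) → (∀ x, |f x| ≤ A) →
      BddMeas fun x => f x * fderiv ℝ g x w := by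
    intro f g C D A hC hD hA
    refine BddMeas.mul ⟨(lip hC).continuous.stronglyMeasurable, A, hA⟩ ⟨?_, D.toNNReal * ‖w‖, ?_⟩
    · exact (measurable_fderiv_apply_const ℝ g w).stronglyMeasurable
    · intro x
      exact ((fderiv ℝ g x).le_opNorm w).trans (mul_le_mul_of_nonneg_right
        (norm_fderiv_le_of_lipschitz ℝ (lip hD)) (norm_nonneg _))
  have h1 := setIntegral_cell_fderiv (hf.mul hg) (C := A * D + B * C) (fun x z => by
    have : f z * g z - f x * g x = f z * (g z - g x) + g x * (f z - f x) := by ring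
    rw [this]
    refine (abs_add_le _ _).trans ?_
    rw [abs_mul, abs_mul, add_mul, mul_assoc, mul_assoc]
    have hA0 := (abs_nonneg _).trans (hA z)
    have hB0 := (abs_nonneg _).trans (hB x)
    gcongr
    exacts [hA z, hD x z, hB x, hC x z]) w
  rw [eq_neg_iff_add_eq_zero, ← integral_add ((bm hC hD hA).integrable _)
    ((bm hD hC hB).integrable _), ← h1]
  refine integral_congr_ae (ae_restrict_of_ae ?_)
  filter_upwards [(lip hC).ae_differentiableAt, (lip hD).ae_differentiableAt] with x hx hx'
  rw [fderiv_fun_mul hx hx']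
  simp

namespace PeriodicMesh

variable {M : PeriodicMesh b}

/-! ### Finite element functions -/

theorem continuous_basisFun (i : M.Node) : Continuous (M.basisFun i) := by
  obtain ⟨C, hC0, hC⟩ := M.exists_lipschitz_basisFun
  refine continuous_iff_continuousAt.2 fun x => ?_
  rw [ContinuousAt, tendsto_iff_norm_sub_tendsto_zero]
  refine squeeze_zero (fun _ => norm_nonneg _) (hC i x) ?_
  have : Continuous fun z : Euc d => C * ‖z - x‖ := by fun_prop
  simpa using this.tendsto x

theorem bddMeas_basisFun (i : M.Node) : BddMeas (M.basisFun i) :=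
  ⟨(continuous_basisFun i).stronglyMeasurable, 1, fun x => by
    rw [Real.norm_of_nonneg (basisFun_nonneg i x)]; exact basisFun_le_one i x⟩

theorem lipschitzWith_basisFun (i : M.Node) : ∃ C, LipschitzWith C (M.basisFun i) := by
  obtain ⟨C, hC0, hC⟩ := M.exists_lipschitz_basisFun
  refine ⟨C.toNNReal, LipschitzWith.of_dist_le_mul fun x y => ?_⟩
  rw [Real.dist_eq, dist_eq_norm, Real.coe_toNNReal _ hC0]
  exact hC i y x

theorem bddMeas_gradient (i : M.Node) : BddMeas (gradient (M.basisFun i)) := by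
  obtain ⟨C, hC⟩ := lipschitzWith_basisFun i
  refine ⟨?_, C, fun x => ?_⟩
  · exact ((InnerProductSpace.toDual ℝ (Euc d)).symm.continuous.measurable.comp
      (measurable_fderiv ℝ (M.basisFun i))).stronglyMeasurable
  · rw [gradient, LinearIsometryEquiv.norm_map]
    exact norm_fderiv_le_of_lipschitz ℝ hC

theorem inner_gradient_basisFun (i : M.Node) (x w : Euc d) :
    inner ℝ (gradient (M.basisFun i) x) w = fderiv ℝ (M.basisFun i) x w := by
  rw [gradient, InnerProductSpace.toDual_symm_apply]

theorem fe_eq {F : Type*} [AddCommGroup F] [Module ℝ F] (c : M.Node → F) {K : M.Elem} {x : Euc d}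
    (hx : x ∈ body K) : M.fe c x = ∑ y, lam K y x • c (M.node y.1) := sum_basisFun_smul hx c

theorem periodic_fe {F : Type*} [AddCommGroup F] [Module ℝ F] (c : M.Node → F) :
    IsPeriodic b (M.fe c) := fun k x => by
  simp only [fe, periodic_basisFun _ k x]

theorem bddMeas_fe {F : Type*} [NormedAddCommGroup F] [NormedSpace ℝ F] (c : M.Node → F) :
    BddMeas (M.fe c) :=
  BddMeas.sum _ fun i _ => (bddMeas_basisFun i).smul (BddMeas.const _)

theorem integrableOn_cell {F : Type*} [NormedAddCommGroup F] {f : Euc d → F} (hf : BddMeas f) :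
    IntegrableOn f (cell b) := hf.integrable _

/-! ### Estimates on a single element -/

theorem volume_body_lt_top (K : M.Elem) : volume (body K) < ⊤ := (isCompact_body K).measure_lt_top

instance (K : M.Elem) : IsFiniteMeasure (volume.restrict (body K)) :=
  ⟨by rw [Measure.restrict_apply_univ]; exact volume_body_lt_top K⟩

/-- Extrapolation from the midpoint: the value of an affine function at a vertex of an element is
controlled by its mean square over the element. -/
theorem volume_mul_norm_sq_le {F : Type*} [NormedAddCommGroup F] [NormedSpace ℝ F] (K : M.Elem)
    (f : K.1 → F) (y : K.1) :
    volume.real (body K) * ‖f y‖ ^ 2 ≤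
      (8 * 2 ^ d + 2) * ∫ x in body K, ‖∑ z, lam K z x • f z‖ ^ 2 := by
  set g : Euc d → F := fun x => ∑ z, lam K z x • f z with hg
  have hlam : ∀ z, Continuous (lam K z) := fun z => by
    rw [continuous_iff_continuousAt]; exact fun x => (hasFDerivAt_lam K z x).continuousAt
  have hgc : Continuous g := by fun_prop
  have hmid : ∀ x z, lam K z ((1 / 2 : ℝ) • (x + y.1)) = (1 / 2) * (lam K z x + lam K z y.1) := by
    intro x z
    have h1 := lam_sub K z ((1 / 2 : ℝ) • (x + y.1)) x
    have h2 := lam_sub K z ((1 / 2 : ℝ) • (x + y.1)) y.1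
    have h3 : (1 / 2 : ℝ) • (x + y.1) - x = - ((1 / 2 : ℝ) • (x + y.1) - y.1) := by
      have : x + y.1 = (1 / 2 : ℝ) • (x + y.1) + (1 / 2 : ℝ) • (x + y.1) := by
        rw [← add_smul]; norm_num
      rw [neg_sub, sub_eq_sub_iff_add_eq_add, add_comm y.1 x]
      exact this.symm
    rw [h3, inner_neg_right] at h1
    linarith
  have hgy : g y.1 = f y := by
    simp only [hg]
    rw [Finset.sum_eq_single y]
    · rw [lam_self, one_smul]
    · intro z _ hz; rw [lam_of_ne K hz, zero_smul]
    · intro h; exact absurd (Finset.mem_univ _) h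
  have hgm : ∀ x, f y = (2 : ℝ) • g ((1 / 2 : ℝ) • (x + y.1)) - g x := by
    intro x
    rw [← hgy]
    simp only [hg, hmid, Finset.smul_sum, smul_smul, ← Finset.sum_sub_distrib, ← sub_smul]
    refine Finset.sum_congr rfl fun z _ => ?_
    congr 1; ring
  have hpt : ∀ x, ‖f y‖ ^ 2 ≤ 8 * ‖g ((1 / 2 : ℝ) • (x + y.1))‖ ^ 2 + 2 * ‖g x‖ ^ 2 := by
    intro x
    have h1 : ‖f y‖ ≤ 2 * ‖g ((1 / 2 : ℝ) • (x + y.1))‖ + ‖g x‖ := by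
      conv_lhs => rw [hgm x]
      refine (norm_sub_le _ _).trans ?_
      rw [norm_smul, Real.norm_ofNat]
    have h2 := norm_nonneg (f y)
    nlinarith [sq_nonneg (2 * ‖g ((1 / 2 : ℝ) • (x + y.1))‖ - ‖g x‖)]
  have hcomp : IsCompact (body K) := isCompact_body K
  have hi1 : IntegrableOn (fun x => ‖g x‖ ^ 2) (body K) :=
    (by fun_prop : Continuous fun x => ‖g x‖ ^ 2).continuousOn.integrableOn_compact hcomp
  have hi2 : IntegrableOn (fun x => ‖g ((1 / 2 : ℝ) • (x + y.1))‖ ^ 2) (body K) :=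
    (by fun_prop : Continuous fun x =>
      ‖g ((1 / 2 : ℝ) • (x + y.1))‖ ^ 2).continuousOn.integrableOn_compact
      hcomp
  have hm : MeasurableSet (body K) := (isClosed_body K).measurableSet
  have hscale : ∫ x in body K, ‖g ((1 / 2 : ℝ) • (x + y.1))‖ ^ 2 ≤
      2 ^ d * ∫ x in body K, ‖g x‖ ^ 2 := by
    set G : Euc d → ℝ := (body K).indicator fun x => ‖g x‖ ^ 2 with hG
    have hGi : Integrable G := hi1.integrable_indicator hm
    have e1 : ∫ x, G ((1 / 2 : ℝ) • (x + y.1)) = 2 ^ d * ∫ x in body K, ‖g x‖ ^ 2 := by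
      rw [integral_add_right_eq_self (μ := volume) (fun x => G ((1 / 2 : ℝ) • x)) y.1,
        Measure.integral_comp_smul, hG, integral_indicator hm]
      simp
    rw [← e1, ← integral_indicator hm]
    refine integral_mono_of_nonneg (Eventually.of_forall fun x => indicator_nonneg
      (fun _ _ => by positivity) x) ?_ (Eventually.of_forall fun x => ?_)
    · exact ((hGi.comp_smul (by norm_num : (1 / 2 : ℝ) ≠ 0)).comp_add_right y.1)
    · by_cases hx : x ∈ body K
      · have hx' : (1 / 2 : ℝ) • (x + y.1) ∈ body K := by
          rw [smul_add]
          exact (convex_body K) hx (vertex_mem_body K y) (by norm_num) (by norm_num) (by norm_num)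
        simp only [hG, indicator_of_mem hx, indicator_of_mem hx', le_rfl]
      · rw [indicator_of_notMem hx]
        exact indicator_nonneg (fun _ _ => by positivity) _
  calc volume.real (body K) * ‖f y‖ ^ 2 = ∫ x in body K, ‖f y‖ ^ 2 := by
        rw [setIntegral_const, smul_eq_mul]
    _ ≤ ∫ x in body K, (8 * ‖g ((1 / 2 : ℝ) • (x + y.1))‖ ^ 2 + 2 * ‖g x‖ ^ 2) :=
        integral_mono (integrable_const _) ((hi2.const_mul 8).add (hi1.const_mul 2)) hpt
    _ = 8 * (∫ x in body K, ‖g ((1 / 2 : ℝ) • (x + y.1))‖ ^ 2) + 2 * ∫ x in body K, ‖g x‖ ^ 2 := by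
        rw [integral_add (hi2.const_mul 8) (hi1.const_mul 2), integral_const_mul,
          integral_const_mul]
    _ ≤ _ := by linarith

/-- The gradient of a barycentric coordinate is at most the inverse of the inradius, since the
coordinate varies between `0` and `1` along a diameter of the inscribed ball. -/
theorem norm_grd_mul_le_one {K : M.Elem} {x : Euc d} {r : ℝ}
    (h : Metric.ball x r ⊆ body K) (y : K.1) : ‖grd K y‖ * r ≤ 1 := by
  rcases le_or_gt r 0 with hr | hr
  · exact (mul_nonpos_of_nonneg_of_nonpos (norm_nonneg _) hr).trans zero_le_one
  rcases eq_or_ne (grd K y) 0 with h0 | h0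
  · rw [h0, norm_zero, zero_mul]; exact zero_le_one
  have hn : 0 < ‖grd K y‖ := norm_pos_iff.2 h0
  set e : Euc d := (r / 2 * ‖grd K y‖⁻¹) • grd K y with he
  have hen : ‖e‖ = r / 2 := by
    rw [he, norm_smul, Real.norm_of_nonneg (by positivity)]; field_simp
  have hp : x + e ∈ body K := h (by rw [mem_ball_iff_norm, add_sub_cancel_left, hen]; linarith)
  have hm : x - e ∈ body K := h (by
    rw [mem_ball_iff_norm, sub_sub_cancel_left, norm_neg, hen]; linarith)
  have h1 := lam_sub K y (x + e) (x - e)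
  have h2 : x + e - (x - e) = (r * ‖grd K y‖⁻¹) • grd K y := by
    rw [add_sub_sub_cancel, he, ← add_smul]; congr 1; ring
  rw [h2, inner_smul_right, real_inner_self_eq_norm_sq] at h1
  have h3 : r * ‖grd K y‖⁻¹ * ‖grd K y‖ ^ 2 = ‖grd K y‖ * r := by field_simp
  rw [h3] at h1
  linarith [lam_le_one hp y, mem_body_iff.1 hm y]

/-- The mesh is shape regular with constant `σ`: every element contains a ball whose radius is
`σ` times the diameter of the element. -/
def IsRegular (M : PeriodicMesh b) (σ : ℝ) : Prop :=
  ∀ K : M.Elem, ∃ x, Metric.ball x (σ * Metric.diam (body K)) ⊆ body K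

theorem IsRegular.norm_grd_mul_diam_le {σ : ℝ} (hσ : 0 < σ) (hM : M.IsRegular σ) (K : M.Elem)
    (y : K.1) : ‖grd K y‖ * Metric.diam (body K) ≤ σ⁻¹ := by
  obtain ⟨x, hx⟩ := hM K
  have := norm_grd_mul_le_one hx y
  rw [← mul_assoc, mul_comm _ σ, mul_assoc] at this
  rwa [le_inv_mul_iff₀ hσ |>.symm, mul_one] at this

theorem IsRegular.le_volume (hd : 0 < d) {σ : ℝ} (hσ : 0 < σ) (hM : M.IsRegular σ) (K : M.Elem) :
    σ ^ d * volume.real (Metric.ball (0 : Euc d) 1) * Metric.diam (body K) ^ d ≤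
      volume.real (body K) := by
  obtain ⟨x, hx⟩ := hM K
  have h1 : volume.real (Metric.ball x (σ * Metric.diam (body K))) ≤ volume.real (body K) :=
    measureReal_mono hx (volume_body_lt_top K).ne
  have : Nontrivial (Euc d) := by
    rw [← Module.finrank_pos_iff (R := ℝ), finrank_euclideanSpace_fin]; exact hd
  have hr : 0 ≤ σ * Metric.diam (body K) := mul_nonneg hσ.le Metric.diam_nonneg
  rw [measureReal_def, Measure.addHaar_ball volume x hr, ENNReal.toReal_mul,
    ENNReal.toReal_ofReal (pow_nonneg hr _), ← measureReal_def, finrank_euclideanSpace_fin,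
    mul_pow] at h1
  linarith

variable (M) in
theorem sum_volume_reps : ∑ K ∈ M.reps, volume.real (body K) = volume.real (cell b) := by
  have := setIntegral_cell_eq (M := M) (f := fun _ => (1 : ℝ)) (fun _ _ => rfl)
    (integrable_const _)
  simpa using this.symm

/-- Estimate of integrals over the period cell by bounds on the elements. -/
theorem norm_setIntegral_cell_le {F : Type*} [NormedAddCommGroup F] [NormedSpace ℝ F]
    {f : Euc d → F} (hf : IsPeriodic b f) (hi : IntegrableOn f (cell b)) {B : M.Elem → ℝ}
    (hB : ∀ K, ∀ x ∈ interior (body K), ‖f x‖ ≤ B K) :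
    ‖∫ x in cell b, f x‖ ≤ ∑ K ∈ M.reps, volume.real (body K) * B K := by
  rw [setIntegral_cell_eq (M := M) hf hi]
  refine (norm_sum_le _ _).trans (Finset.sum_le_sum fun K _ => ?_)
  have hae : interior (body K) =ᵐ[volume] body K :=
    interior_ae_eq_of_null_frontier ((convex_body K).addHaar_frontier volume)
  rw [← setIntegral_congr_set hae, ← measureReal_congr hae, mul_comm]
  exact norm_setIntegral_le_of_norm_le_const
    ((measure_mono interior_subset).trans_lt (volume_body_lt_top K)) (hB K)

/-- The sum of the squares of the nodal values over all elements and their vertices, weighted with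
the volumes of the elements. -/
def nodalSq {F : Type*} [NormedAddCommGroup F] (f : M.Node → F) : ℝ :=
  ∑ K ∈ M.reps, volume.real (body K) * ∑ y : K.1, ‖f (M.node y.1)‖ ^ 2

/-- The oscillation of the nodal values: the squared differences of the values at the vertices of
the same element, weighted with the volumes of the elements. -/
def nodalOsc {F : Type*} [NormedAddCommGroup F] (f : M.Node → F) : ℝ :=
  ∑ K ∈ M.reps, volume.real (body K) *
    ∑ y : K.1, ∑ z : K.1, ‖f (M.node y.1) - f (M.node z.1)‖ ^ 2

theorem card_vertices (K : M.Elem) : Fintype.card K.1 = d + 1 := by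
  rw [Fintype.card_coe]; exact K.2.2

/-- Norm equivalence: the nodal values are controlled by the `L²` norm, uniformly in the mesh. -/
theorem nodalSq_le {F : Type*} [NormedAddCommGroup F] [NormedSpace ℝ F] (f : M.Node → F) :
    nodalSq f ≤ (d + 1) * (8 * 2 ^ d + 2) * ∫ x in cell b, ‖M.fe f x‖ ^ 2 := by
  rw [setIntegral_cell_eq (M := M) (f := fun x => ‖M.fe f x‖ ^ 2)
    (fun k x => by dsimp only; rw [periodic_fe f k x])
    (integrableOn_cell ((bddMeas_fe f).norm.pow 2)), nodalSq, Finset.mul_sum]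
  refine Finset.sum_le_sum fun K _ => ?_
  rw [Finset.mul_sum]
  have h : ∀ y : K.1, volume.real (body K) * ‖f (M.node y.1)‖ ^ 2 ≤
      (8 * 2 ^ d + 2) * ∫ x in body K, ‖M.fe f x‖ ^ 2 := fun y => by
    rw [setIntegral_congr_fun (isClosed_body K).measurableSet
      (fun x hx => by dsimp only; rw [fe_eq f hx] : EqOn (fun x => ‖M.fe f x‖ ^ 2)
        (fun x => ‖∑ z, lam K z x • f (M.node z.1)‖ ^ 2) (body K))]
    exact volume_mul_norm_sq_le K (fun z => f (M.node z.1)) y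
  refine (Finset.sum_le_card_nsmul _ _ _ fun y _ => h y).trans_eq ?_
  rw [Finset.card_univ, card_vertices, nsmul_eq_mul]
  push_cast; ring

/-- The oscillation of the nodal values is controlled by the `L²` distance to any function that
varies little on the elements. -/
theorem nodalOsc_le {F : Type*} [NormedAddCommGroup F] [NormedSpace ℝ F] (f : M.Node → F)
    {g : Euc d → F} (hg : BddMeas g) (hgp : IsPeriodic b g) {ε : ℝ}
    (hε : ∀ K : M.Elem, ∀ x ∈ body K, ∀ z ∈ body K, ‖g x - g z‖ ≤ ε) :
    nodalOsc f ≤ 8 * (d + 1) ^ 2 * (8 * 2 ^ d + 2) *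
      ((∫ x in cell b, ‖M.fe f x - g x‖ ^ 2) + ε ^ 2 * volume.real (cell b)) := by
  have hbm := ((bddMeas_fe f).sub hg).norm.pow 2
  rw [setIntegral_cell_eq (M := M) (f := fun x => ‖M.fe f x - g x‖ ^ 2)
    (fun k x => by dsimp only; rw [periodic_fe f k x, hgp k x])
    (integrableOn_cell hbm), nodalOsc, ← M.sum_volume_reps, Finset.mul_sum,
    ← Finset.sum_add_distrib, Finset.mul_sum]
  refine Finset.sum_le_sum fun K _ => ?_
  obtain ⟨y₀⟩ := nonempty_elem_vertices K
  set c := g y₀.1 with hc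
  set I := (∫ x in body K, ‖M.fe f x - g x‖ ^ 2) + ε ^ 2 * volume.real (body K) with hI
  have h1 : ∀ y : K.1, volume.real (body K) * ‖f (M.node y.1) - c‖ ^ 2 ≤
      (8 * 2 ^ d + 2) * (2 * I) := fun y => by
    refine (volume_mul_norm_sq_le K (fun z => f (M.node z.1) - c) y).trans ?_
    gcongr
    have h2 : ∀ x ∈ body K, ‖∑ z, lam K z x • (f (M.node z.1) - c)‖ ^ 2 ≤
        2 * ‖M.fe f x - g x‖ ^ 2 + 2 * ε ^ 2 := by
      intro x hx
      have h3 : ∑ z, lam K z x • (f (M.node z.1) - c) = (M.fe f x - g x) + (g x - c) := by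
        simp only [smul_sub, Finset.sum_sub_distrib, ← Finset.sum_smul, sum_lam, one_smul,
          fe_eq f hx, sub_add_sub_cancel]
      have h4 := hε K x hx y₀.1 (vertex_mem_body K y₀)
      have h5 := norm_add_le (M.fe f x - g x) (g x - c)
      rw [h3]
      have h6 := norm_nonneg (M.fe f x - g x)
      have h7 := norm_nonneg (g x - c)
      have h8 := norm_nonneg (M.fe f x - g x + (g x - c))
      nlinarith [sq_nonneg (‖M.fe f x - g x‖ - ‖g x - c‖)]
    have hi := hbm.integrable (volume.restrict (body K))
    calc _ ≤ ∫ x in body K, (2 * ‖M.fe f x - g x‖ ^ 2 + 2 * ε ^ 2) := by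
          refine integral_mono_of_nonneg (Eventually.of_forall fun _ => by positivity)
            ((hi.const_mul 2).add (integrable_const _)) ?_
          exact (ae_restrict_iff' (isClosed_body K).measurableSet).2 (Eventually.of_forall h2)
      _ = 2 * I := by
          rw [integral_add (hi.const_mul 2) (integrable_const _), integral_const_mul,
            setIntegral_const, hI, smul_eq_mul]; ring
  have h9 : ∀ y z : K.1, volume.real (body K) * ‖f (M.node y.1) - f (M.node z.1)‖ ^ 2 ≤
      8 * (8 * 2 ^ d + 2) * I := fun y z => by
    have h10 : ‖f (M.node y.1) - f (M.node z.1)‖ ^ 2 ≤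
        2 * ‖f (M.node y.1) - c‖ ^ 2 + 2 * ‖f (M.node z.1) - c‖ ^ 2 := by
      have h5 := norm_sub_le (f (M.node y.1) - c) (f (M.node z.1) - c)
      rw [sub_sub_sub_cancel_right] at h5
      have h6 := norm_nonneg (f (M.node y.1) - f (M.node z.1))
      nlinarith [sq_nonneg (‖f (M.node y.1) - c‖ - ‖f (M.node z.1) - c‖)]
    have h11 := mul_le_mul_of_nonneg_left h10 (measureReal_nonneg (μ := volume) (s := body K))
    nlinarith [h1 y, h1 z]
  rw [Finset.mul_sum]
  refine (Finset.sum_le_card_nsmul _ _ ((d + 1) * (8 * (8 * 2 ^ d + 2) * I)) fun y _ => ?_).trans_eq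
    ?_
  · rw [Finset.mul_sum]
    refine (Finset.sum_le_card_nsmul _ _ _ fun z _ => h9 y z).trans_eq ?_
    rw [Finset.card_univ, card_vertices, nsmul_eq_mul]; push_cast; ring
  · rw [Finset.card_univ, card_vertices, nsmul_eq_mul]; push_cast; ring

/-! ### The coefficient matrices of the scheme -/

theorem inner_gradC (i j : M.Node) (w : Euc d) :
    inner ℝ (M.gradC i j) w =
      ∫ x in cell b, M.basisFun i x * inner ℝ (gradient (M.basisFun j) x) w := by
  rw [real_inner_comm, gradC, ← integral_inner
    (((bddMeas_basisFun i).smul (bddMeas_gradient j)).integrable _)]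
  simp only [inner_smul_right, real_inner_comm]

/-- The discrete gradient is antisymmetric, by integration by parts on the torus. -/
theorem gradC_antisymm (i j : M.Node) : M.gradC i j = - M.gradC j i := by
  refine ext_inner_right ℝ fun w => ?_
  obtain ⟨C, -, hC⟩ := M.exists_lipschitz_basisFun
  have h1 : ∀ i x, |M.basisFun i x| ≤ 1 := fun i x => by
    rw [abs_of_nonneg (basisFun_nonneg i x)]; exact basisFun_le_one i x
  rw [inner_neg_left, inner_gradC, inner_gradC]
  simp only [inner_gradient_basisFun]
  exact setIntegral_cell_mul_fderiv (periodic_basisFun i) (periodic_basisFun j) (hC i) (hC j)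
    (h1 i) (h1 j) w

theorem massC_comm (i j : M.Node) : M.massC i j = M.massC j i := by
  simp only [massC, mul_comm]

theorem massC_nonneg (i j : M.Node) : 0 ≤ M.massC i j :=
  integral_nonneg fun x => mul_nonneg (basisFun_nonneg i x) (basisFun_nonneg j x)

theorem massL_nonneg (i : M.Node) : 0 ≤ M.massL i :=
  integral_nonneg fun x => basisFun_nonneg i x

theorem sum_inner_gradC (a : M.Node → M.Node → Euc d) :
    ∑ j, ∑ i, inner ℝ (M.gradC j i) (a j i) = ∫ x in cell b, ∑ j, ∑ i,
      M.basisFun j x * inner ℝ (gradient (M.basisFun i) x) (a j i) := by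
  have h : ∀ i j, BddMeas fun x => M.basisFun j x *
      inner ℝ (gradient (M.basisFun i) x) (a j i) := fun i j =>
    (bddMeas_basisFun j).mul ((bddMeas_gradient i).inner (BddMeas.const _))
  simp only [inner_gradC]
  rw [integral_finsetSum _ fun j _ => (BddMeas.sum _ fun i _ => h i j).integrable _]
  refine Finset.sum_congr rfl fun j _ => ?_
  rw [integral_finsetSum _ fun i _ => (h i j).integrable _]

theorem sum_massC (a : M.Node → M.Node → ℝ) :
    ∑ j, ∑ i, M.massC j i * a j i = ∫ x in cell b, ∑ j, ∑ i,
      M.basisFun j x * (M.basisFun i x * a j i) := by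
  have h : ∀ i j, BddMeas fun x => M.basisFun j x * (M.basisFun i x * a j i) := fun i j =>
    (bddMeas_basisFun j).mul ((bddMeas_basisFun i).mul (BddMeas.const _))
  rw [integral_finsetSum _ fun j _ => (BddMeas.sum _ fun i _ => h i j).integrable _]
  refine Finset.sum_congr rfl fun j _ => ?_
  rw [integral_finsetSum _ fun i _ => (h i j).integrable _]
  refine Finset.sum_congr rfl fun i _ => ?_
  rw [massC, ← integral_mul_const]
  simp only [mul_assoc]

theorem sum_massL (a : M.Node → ℝ) :
    ∑ i, M.massL i * a i = ∫ x in cell b, ∑ i, M.basisFun i x * a i := by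
  rw [integral_finsetSum _ fun i _ => ((bddMeas_basisFun i).mul (BddMeas.const _)).integrable _]
  exact Finset.sum_congr rfl fun i _ => by rw [massL, ← integral_mul_const]

/-- The row sums of the discrete gradient vanish, since the basis functions add up to `1`. -/
theorem sum_gradC (j : M.Node) : ∑ i, M.gradC j i = 0 := by
  refine ext_inner_right ℝ fun w => ?_
  rw [sum_inner, inner_zero_left]
  simp only [inner_gradC]
  rw [← integral_finsetSum _ fun i _ => ((bddMeas_basisFun j).mul
    ((bddMeas_gradient i).inner (BddMeas.const w))).integrable _]
  refine integral_eq_zero_of_ae (ae_restrict_of_ae ?_)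
  filter_upwards [M.ae_mem_interior_body] with x ⟨K, hK⟩
  rw [← Finset.mul_sum, ← sum_inner]
  have := sum_gradient hK (F := Euc d) (fun _ => LinearMap.id)
  simp only [LinearMap.id_apply, sum_grd] at this
  rw [this, inner_zero_left, mul_zero]; rfl

/-- Comparison of a bilinear form with coefficients `c_ji` and an integral over the cell, by
estimates on the elements. -/
theorem abs_sum_inner_gradC_sub_le (a : M.Node → M.Node → Euc d) {g : Euc d → ℝ}
    (hg : BddMeas g) (hgp : IsPeriodic b g) {B : M.Elem → ℝ}
    (hB : ∀ K, ∀ x ∈ interior (body K), |∑ z, lam K z x *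
      ∑ y, inner ℝ (grd K y) (a (M.node z.1) (M.node y.1)) - g x| ≤ B K) :
    |∑ j, ∑ i, inner ℝ (M.gradC j i) (a j i) - ∫ x in cell b, g x| ≤
      ∑ K ∈ M.reps, volume.real (body K) * B K := by
  have h : BddMeas fun x => ∑ j, ∑ i, M.basisFun j x *
      inner ℝ (gradient (M.basisFun i) x) (a j i) :=
    BddMeas.sum _ fun j _ => BddMeas.sum _ fun i _ =>
    (bddMeas_basisFun j).mul ((bddMeas_gradient i).inner (BddMeas.const _))
  rw [sum_inner_gradC, ← integral_sub (h.integrable _) (hg.integrable _)]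
  refine norm_setIntegral_cell_le (F := ℝ) (fun k x => ?_) (integrableOn_cell (h.sub hg))
    fun K x hx => ?_
  · simp only [periodic_basisFun _ k x, (periodic_basisFun _).gradient k x, hgp k x]
  · have e1 : ∀ j, ∑ i, M.basisFun j x * inner ℝ (gradient (M.basisFun i) x) (a j i) =
        M.basisFun j x • ∑ y, inner ℝ (grd K y) (a j (M.node y.1)) := by
      intro j
      rw [← Finset.mul_sum, smul_eq_mul]
      congr 1
      have := sum_gradient hx (F := ℝ) (fun i => (innerₗ (Euc d) (a j i)))
      simp only [innerₗ_apply_apply] at this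
      simpa only [real_inner_comm] using this
    simp only [e1]
    rw [sum_basisFun_smul (interior_subset hx)]
    exact hB K x hx

theorem abs_sum_massC_le (a : M.Node → M.Node → ℝ) {B : M.Elem → ℝ}
    (hB : ∀ K, ∀ x ∈ interior (body K), |∑ z, lam K z x *
      ∑ y, lam K y x * a (M.node z.1) (M.node y.1)| ≤ B K) :
    |∑ j, ∑ i, M.massC j i * a j i| ≤ ∑ K ∈ M.reps, volume.real (body K) * B K := by
  rw [sum_massC]
  refine norm_setIntegral_cell_le (F := ℝ) (fun k x => ?_) (integrableOn_cell ?_) fun K x hx => ?_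
  · simp only [periodic_basisFun _ k x]
  · exact BddMeas.sum _ fun j _ => BddMeas.sum _ fun i _ =>
      (bddMeas_basisFun j).mul ((bddMeas_basisFun i).mul (BddMeas.const _))
  · have e1 : ∀ j, ∑ i, M.basisFun j x * (M.basisFun i x * a j i) =
        M.basisFun j x • ∑ y, lam K y x • a j (M.node y.1) := fun j => by
      rw [← Finset.mul_sum, ← sum_basisFun_smul (interior_subset hx)]; rfl
    simp only [e1]
    rw [sum_basisFun_smul (interior_subset hx)]
    simpa only [smul_eq_mul, Real.norm_eq_abs] using hB K x hx

theorem abs_sum_massL_sub_le (a : M.Node → ℝ) {g : Euc d → ℝ}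
    (hg : BddMeas g) (hgp : IsPeriodic b g) {B : M.Elem → ℝ}
    (hB : ∀ K, ∀ x ∈ interior (body K), |∑ z, lam K z x * a (M.node z.1) - g x| ≤ B K) :
    |∑ i, M.massL i * a i - ∫ x in cell b, g x| ≤
      ∑ K ∈ M.reps, volume.real (body K) * B K := by
  have h : BddMeas fun x => ∑ i, M.basisFun i x * a i := BddMeas.sum _ fun i _ =>
    (bddMeas_basisFun i).mul (BddMeas.const _)
  rw [sum_massL, ← integral_sub (h.integrable _) (hg.integrable _)]
  refine norm_setIntegral_cell_le (F := ℝ) (fun k x => ?_) (integrableOn_cell (h.sub hg))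
    fun K x hx => ?_
  · simp only [periodic_basisFun _ k x, hgp k x]
  · simp only [← smul_eq_mul, sum_basisFun_smul (interior_subset hx)]
    simpa only [smul_eq_mul, Real.norm_eq_abs] using hB K x hx

/-! ### Bounds for test functions and their interpolants -/

/-- Quantitative smoothness of a periodic test function relative to a mesh: bounds `V` and `L` for
the function and its derivative, and a bound `ε` for the relative error of the first order Taylor
expansion within the elements. -/
structure TestBounds {F : Type*} [NormedAddCommGroup F] [NormedSpace ℝ F] (M : PeriodicMesh b)
    (v : Euc d → F) (V L ε : ℝ) : Prop where
  contDiff : ContDiff ℝ 1 v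
  periodic : IsPeriodic b v
  eps_nonneg : 0 ≤ ε
  bound : ∀ x, ‖v x‖ ≤ V
  deriv_bound : ∀ x, ‖fderiv ℝ v x‖ ≤ L
  taylor : ∀ K : M.Elem, ∀ x ∈ body K, ∀ z ∈ body K,
    ‖v z - v x - fderiv ℝ v x (z - x)‖ ≤ ε * ‖z - x‖

namespace TestBounds

variable {F : Type*} [NormedAddCommGroup F] [NormedSpace ℝ F] {v : Euc d → F} {V L ε : ℝ}

theorem nonneg_V (h : TestBounds M v V L ε) : 0 ≤ V := (norm_nonneg _).trans (h.bound 0)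

theorem nonneg_L (h : TestBounds M v V L ε) : 0 ≤ L := (norm_nonneg _).trans (h.deriv_bound 0)

theorem norm_sub_le (h : TestBounds M v V L ε) (x z : Euc d) : ‖v z - v x‖ ≤ L * ‖z - x‖ :=
  convex_univ.norm_image_sub_le_of_norm_fderiv_le
    (fun _ _ => h.contDiff.differentiable one_ne_zero _)
    (fun x _ => h.deriv_bound x) (mem_univ _) (mem_univ _)

theorem bddMeas_fderiv (h : TestBounds M v V L ε) : BddMeas (fderiv ℝ v) :=
  ⟨(h.contDiff.continuous_fderiv one_ne_zero).stronglyMeasurable, L, h.deriv_bound⟩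

/-- The gradient of the interpolant approximates the gradient. -/
theorem norm_interp_sub_le (h : TestBounds M v V L ε) {σ : ℝ} (hσ : 0 < σ) (hM : M.IsRegular σ)
    {K : M.Elem} {x : Euc d} (hx : x ∈ body K) (w : Euc d) :
    ‖∑ y, (inner ℝ (grd K y) w : ℝ) • v y.1 - fderiv ℝ v x w‖ ≤ (d + 1) * σ⁻¹ * ε * ‖w‖ := by
  have e0 : ∑ y, (inner ℝ (grd K y) w : ℝ) = 0 := by
    rw [← sum_inner, sum_grd, inner_zero_left]
  have e1 : ∑ y, (inner ℝ (grd K y) w : ℝ) • v y.1 - fderiv ℝ v x w =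
      ∑ y, (inner ℝ (grd K y) w : ℝ) • (v y.1 - v x - fderiv ℝ v x (y.1 - x)) := by
    simp only [map_sub, smul_sub, Finset.sum_sub_distrib, ← Finset.sum_smul, e0, zero_smul,
      sub_zero]
    congr 1
    conv_lhs => rw [← sum_inner_grd_smul K w]
    rw [map_sum]
    simp only [map_smul]
  rw [e1]
  refine (norm_sum_le_of_le _ (fun y _ => (?_ : _ ≤ σ⁻¹ * ε * ‖w‖))).trans_eq ?_
  · rw [norm_smul]
    calc _ ≤ (‖grd K y‖ * ‖w‖) * (ε * Metric.diam (body K)) := by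
          refine mul_le_mul (abs_real_inner_le_norm _ _) ?_ (norm_nonneg _) (by positivity)
          refine (h.taylor K x hx y.1 (vertex_mem_body K y)).trans ?_
          exact mul_le_mul_of_nonneg_left (norm_sub_le_diam (vertex_mem_body K y) hx) h.eps_nonneg
      _ = (‖grd K y‖ * Metric.diam (body K)) * (ε * ‖w‖) := by ring
      _ ≤ σ⁻¹ * (ε * ‖w‖) := mul_le_mul_of_nonneg_right (hM.norm_grd_mul_diam_le hσ K y)
          (mul_nonneg h.eps_nonneg (norm_nonneg _))
      _ = σ⁻¹ * ε * ‖w‖ := by ring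
  · rw [Finset.sum_const, Finset.card_univ, card_vertices, nsmul_eq_mul]; push_cast; ring

end TestBounds

/-! ### Sums over elements -/

theorem nodalSq_nonneg {F : Type*} [NormedAddCommGroup F] (f : M.Node → F) : 0 ≤ nodalSq f :=
  Finset.sum_nonneg fun _ _ => by positivity

theorem nodalOsc_nonneg {F : Type*} [NormedAddCommGroup F] (f : M.Node → F) : 0 ≤ nodalOsc f :=
  Finset.sum_nonneg fun _ _ => by positivity

theorem sum_norm_le {F : Type*} [NormedAddCommGroup F] (f : M.Node → F) :
    ∑ K ∈ M.reps, volume.real (body K) * ∑ y : K.1, ‖f (M.node y.1)‖ ≤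
      (d + 1) * volume.real (cell b) + nodalSq f := by
  rw [← M.sum_volume_reps, nodalSq, Finset.mul_sum, ← Finset.sum_add_distrib]
  refine Finset.sum_le_sum fun K _ => ?_
  rw [mul_comm ((d : ℝ) + 1), ← mul_add]
  refine mul_le_mul_of_nonneg_left ?_ measureReal_nonneg
  calc ∑ y : K.1, ‖f (M.node y.1)‖ ≤ ∑ y : K.1, (1 + ‖f (M.node y.1)‖ ^ 2) :=
        Finset.sum_le_sum fun y _ => by nlinarith [sq_nonneg (‖f (M.node y.1)‖ - 1)]
    _ = _ := by
      rw [Finset.sum_add_distrib, Finset.sum_const, Finset.card_univ, card_vertices, nsmul_eq_mul]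
      push_cast; ring

theorem sum_reps_const_mul (c : ℝ) (f : M.Elem → ℝ) :
    ∑ K ∈ M.reps, volume.real (body K) * (c * f K) =
      c * ∑ K ∈ M.reps, volume.real (body K) * f K := by
  rw [Finset.mul_sum]
  exact Finset.sum_congr rfl fun K _ => mul_left_comm _ _ _

theorem mul_le_young {δ : ℝ} (hδ : 0 < δ) (x y : ℝ) : x * y ≤ δ * x ^ 2 + δ⁻¹ * y ^ 2 := by
  have h2 : 0 ≤ (δ * x - y / 2) ^ 2 * δ⁻¹ := by positivity
  have h3 : (δ * x - y / 2) ^ 2 * δ⁻¹ = δ * x ^ 2 - x * y + δ⁻¹ * y ^ 2 / 4 := by field_simp; ring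
  have h4 : 0 ≤ δ⁻¹ * y ^ 2 := by positivity
  linarith

theorem sum_norm_mul_osc_le {F G : Type*} [NormedAddCommGroup F] [NormedAddCommGroup G]
    (f : M.Node → F) (g : M.Node → G) {δ : ℝ} (hδ : 0 < δ) :
    ∑ K ∈ M.reps, volume.real (body K) * ∑ z : K.1, ∑ y : K.1,
      ‖f (M.node z.1)‖ * ‖g (M.node y.1) - g (M.node z.1)‖ ≤
      (d + 1) * δ * nodalSq f + δ⁻¹ * nodalOsc g := by
  rw [nodalSq, nodalOsc, Finset.mul_sum, Finset.mul_sum, ← Finset.sum_add_distrib]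
  refine Finset.sum_le_sum fun K _ => ?_
  rw [mul_left_comm, mul_left_comm δ⁻¹, ← mul_add]
  refine mul_le_mul_of_nonneg_left ?_ measureReal_nonneg
  calc _ ≤ ∑ z : K.1, ∑ y : K.1, (δ * ‖f (M.node z.1)‖ ^ 2 +
          δ⁻¹ * ‖g (M.node y.1) - g (M.node z.1)‖ ^ 2) :=
        Finset.sum_le_sum fun z _ => Finset.sum_le_sum fun y _ => mul_le_young hδ _ _
    _ = _ := by
      simp only [Finset.sum_add_distrib, Finset.sum_const, Finset.card_univ, card_vertices,
        nsmul_eq_mul, ← Finset.mul_sum]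
      rw [Finset.sum_comm (s := (Finset.univ : Finset K.1))]
      push_cast; ring

theorem sum_osc_le {G : Type*} [NormedAddCommGroup G] (g : M.Node → G) {δ : ℝ} (hδ : 0 < δ) :
    ∑ K ∈ M.reps, volume.real (body K) * ∑ z : K.1, ∑ y : K.1,
      ‖g (M.node y.1) - g (M.node z.1)‖ ≤
      (d + 1) ^ 2 * δ * volume.real (cell b) + δ⁻¹ * nodalOsc g := by
  have := sum_norm_mul_osc_le (fun _ : M.Node => (1 : ℝ)) g hδ
  simp only [norm_one, one_mul] at this
  refine this.trans_eq ?_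
  congr 1
  simp only [nodalSq, norm_one, one_pow, Finset.sum_const, Finset.card_univ, card_vertices,
    nsmul_eq_mul, ← M.sum_volume_reps, ← Finset.sum_mul]
  push_cast; ring

end PeriodicMesh

/-- The divergence of a vector field. -/
def divergence (v : Euc d → Euc d) (x : Euc d) : ℝ := ∑ k, pderiv v x k k

theorem inner_fderiv_eq (v : Euc d → Euc d) (x w : Euc d) :
    inner ℝ w (fderiv ℝ v x w) = ∑ i, ∑ j, w i * w j * pderiv v x i j := by
  have hw : w = ∑ j, w j • EuclideanSpace.single j (1 : ℝ) := by
    ext i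
    simp [Pi.single_apply]
  have h : ∀ i, fderiv ℝ v x w i = ∑ j, w j * pderiv v x i j := fun i => by
    conv_lhs => rw [hw]
    simp [pderiv]
  rw [PiLp.inner_apply]
  refine Finset.sum_congr rfl fun i _ => ?_
  rw [h i]
  simp only [mul_assoc, ← Finset.mul_sum]
  simp [mul_comm]

namespace PeriodicMesh

variable {M : PeriodicMesh b} {V L ε σ : ℝ}

theorem fe_nodal_sum {F : Type*} [AddCommGroup F] [Module ℝ F] (c : M.Node → F) {K : M.Elem}
    {x : Euc d} (hx : x ∈ interior (body K)) : ∑ z, lam K z x • c (M.node z.1) = M.fe c x :=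
  (fe_eq c (interior_subset hx)).symm

theorem lam_nonneg {K : M.Elem} {x : Euc d} (hx : x ∈ interior (body K)) (z : K.1) :
    0 ≤ lam K z x := (mem_interior_body_iff.1 hx z).le

theorem abs_sum_lam_mul_le {K : M.Elem} {x : Euc d} (hx : x ∈ interior (body K)) {f g : K.1 → ℝ}
    (h : ∀ z, |f z| ≤ g z) : |∑ z, lam K z x * f z| ≤ ∑ z, g z := by
  refine Finset.abs_sum_le_sum_abs _ _ |>.trans (Finset.sum_le_sum fun z _ => ?_)
  rw [abs_mul, abs_of_nonneg (lam_nonneg hx z)]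
  exact (mul_le_of_le_one_left (abs_nonneg _) (lam_le_one (interior_subset hx) z)).trans (h z)

/-! ### Consistency of the scheme -/

/-- Consistency of mass lumping. -/
theorem abs_massL_sub_le {F : Type*} [NormedAddCommGroup F] [InnerProductSpace ℝ F]
    (u : M.Node → F) {w : Euc d → F} (hw : BddMeas w) (hwp : IsPeriodic b w) {η : ℝ}
    (hη : ∀ K : M.Elem, ∀ x ∈ body K, ∀ z ∈ body K, ‖w z - w x‖ ≤ η) :
    |∑ i, M.massL i * inner ℝ (u i) (w i.1) - ∫ x in cell b, inner ℝ (M.fe u x) (w x)| ≤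
      η * ((d + 1) * volume.real (cell b) + nodalSq u) := by
  have hη0 : 0 ≤ η := by
    obtain ⟨K, hK⟩ := M.exists_mem_body 0
    exact (norm_nonneg _).trans (hη K 0 hK 0 hK)
  refine (abs_sum_massL_sub_le _ ((bddMeas_fe u).inner hw) (fun k x => ?_)
    (B := fun K => η * ∑ y : K.1, ‖u (M.node y.1)‖) ?_).trans ?_
  · rw [periodic_fe u k x, hwp k x]
  · intro K x hx
    have e1 : ∑ z, lam K z x * inner ℝ (u (M.node z.1)) (w (M.node z.1).1) -
        inner ℝ (M.fe u x) (w x) =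
        ∑ z, lam K z x * inner ℝ (u (M.node z.1)) (w z.1 - w x) := by
      rw [← fe_nodal_sum u hx, sum_inner]
      simp only [inner_smul_left, inner_sub_right, mul_sub, Finset.sum_sub_distrib,
        hwp.apply_node K, RCLike.conj_to_real]
    rw [e1, Finset.mul_sum]
    refine abs_sum_lam_mul_le hx fun z => (abs_real_inner_le_norm _ _).trans ?_
    rw [mul_comm]
    exact mul_le_mul_of_nonneg_right (hη K x (interior_subset hx) z.1 (vertex_mem_body K z))
      (norm_nonneg _)
  · rw [sum_reps_const_mul]
    exact mul_le_mul_of_nonneg_left (sum_norm_le u) hη0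

/-- Consistency of the discrete divergence. -/
theorem abs_pressure_le (hσ : 0 < σ) (hM : M.IsRegular σ) {v : Euc d → Euc d}
    (hv : TestBounds M v V L ε) (p : M.Node → ℝ) :
    |∑ i, ∑ j, p j * inner ℝ (M.gradC i j) (v i.1) +
        ∫ x in cell b, M.fe p x * divergence v x| ≤
      d * (d + 1) * σ⁻¹ * ε * ((d + 1) * volume.real (cell b) + nodalSq p) := by
  have hdivB : BddMeas (divergence v) := BddMeas.sum _ fun k _ =>
    (hv.bddMeas_fderiv.clm ((EuclideanSpace.proj (𝕜 := ℝ) k).comp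
      (ContinuousLinearMap.apply ℝ (Euc d) (EuclideanSpace.single k (1 : ℝ)))))
  have hdivp : IsPeriodic b (divergence v) := fun k x => by
    simp only [divergence, pderiv, hv.periodic.fderiv k x]
  have e0 : ∑ i, ∑ j, p j * inner ℝ (M.gradC i j) (v i.1) +
        ∫ x in cell b, M.fe p x * divergence v x =
      - (∑ j, ∑ i, inner ℝ (M.gradC j i) (p j • v i.1) -
        ∫ x in cell b, M.fe p x * divergence v x) := by
    have : ∀ i j, p j * inner ℝ (M.gradC i j) (v i.1) =
        - inner ℝ (M.gradC j i) (p j • v i.1) := fun i j => by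
      rw [gradC_antisymm i j, inner_neg_left, inner_smul_right, mul_neg]
    simp only [this, Finset.sum_neg_distrib]
    rw [Finset.sum_comm]
    ring
  rw [e0, abs_neg]
  refine (abs_sum_inner_gradC_sub_le _ ((bddMeas_fe p).mul hdivB)
    ((periodic_fe p).mul hdivp)
    (B := fun K => d * (d + 1) * σ⁻¹ * ε * ∑ y : K.1, ‖p (M.node y.1)‖) ?_).trans ?_
  · intro K x hx
    set D : ℝ := ∑ y, inner ℝ (grd K y) (v y.1) with hD
    have e1 : D =
        ∑ k, (∑ y, (inner ℝ (grd K y) (EuclideanSpace.single k (1 : ℝ)) : ℝ) • v y.1) k := by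
      simp only [hD, EuclideanSpace.inner_single_right, WithLp.ofLp_sum, WithLp.ofLp_smul,
        Finset.sum_apply, Pi.smul_apply, smul_eq_mul, RCLike.conj_to_real, one_mul]
      rw [Finset.sum_comm]
      refine Finset.sum_congr rfl fun y _ => ?_
      rw [PiLp.inner_apply]
      simp [mul_comm]
    have e2 : |D - divergence v x| ≤ d * (d + 1) * σ⁻¹ * ε := by
      rw [e1, divergence, ← Finset.sum_sub_distrib]
      refine (Finset.abs_sum_le_sum_abs _ _).trans ?_
      refine (Finset.sum_le_card_nsmul _ _ ((d + 1) * σ⁻¹ * ε) fun k _ => ?_).trans_eq ?_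
      · have h1 := hv.norm_interp_sub_le hσ hM (interior_subset hx)
          (EuclideanSpace.single k (1 : ℝ))
        rw [PiLp.norm_single, norm_one, mul_one] at h1
        exact (PiLp.norm_apply_le (_ - fderiv ℝ v x (EuclideanSpace.single k (1 : ℝ))) k).trans h1
      · rw [Finset.card_univ, Fintype.card_fin, nsmul_eq_mul]; ring
    have e3 : ∑ z, lam K z x * ∑ y, inner ℝ (grd K y) (p (M.node z.1) • v (M.node y.1).1) -
        M.fe p x * divergence v x =
        ∑ z, lam K z x * (p (M.node z.1) * (D - divergence v x)) := by
      rw [← fe_nodal_sum p hx, Finset.sum_mul, ← Finset.sum_sub_distrib]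
      refine Finset.sum_congr rfl fun z _ => ?_
      simp only [inner_smul_right, hv.periodic.apply_node K, ← Finset.mul_sum, ← hD, smul_eq_mul]
      ring
    rw [e3, Finset.mul_sum]
    refine abs_sum_lam_mul_le hx fun z => ?_
    rw [abs_mul, mul_comm]
    exact mul_le_mul_of_nonneg_right e2 (abs_nonneg _)
  · rw [sum_reps_const_mul]
    have := hv.eps_nonneg
    exact mul_le_mul_of_nonneg_left (sum_norm_le p) (by positivity)

/-- The Becker–Hansbo form of the discrete continuity equation. -/
theorem sum_beckerHansbo (ω : ℝ) (p : M.Node → ℝ) (k : M.Node) :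
    ∑ j, M.beckerHansbo ω k j * p j = ∑ j, M.massC k j * (ω * (p j - p k)) := by
  classical
  rw [← Finset.add_sum_erase _ _ (Finset.mem_univ k),
    ← Finset.add_sum_erase _ (fun j => M.massC k j * (ω * (p j - p k))) (Finset.mem_univ k)]
  have h1 : M.beckerHansbo ω k k = - ∑ j ∈ Finset.univ.erase k, ω * M.massC k j := by
    simp [beckerHansbo]
  rw [h1, sub_self, mul_zero, mul_zero, zero_add, neg_mul, Finset.sum_mul, ← sub_eq_neg_add,
    ← Finset.sum_sub_distrib]
  refine Finset.sum_congr rfl fun j hj => ?_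
  rw [beckerHansbo, if_pos (Finset.ne_of_mem_erase hj)]
  ring

/-- The discrete continuity equation
`∑_j c_kj · u_j = ∑_j ω m_kj (p_j - p_k)` with Becker–Hansbo stabilization. -/
def DiscreteContinuity (M : PeriodicMesh b) (ω : ℝ) (u : M.Node → Euc d) (p : M.Node → ℝ) : Prop :=
  ∀ k, ∑ j, inner ℝ (M.gradC k j) (u j) = ∑ j, M.massC k j * (ω * (p j - p k))

/-- Consistency of the continuity equation. -/
theorem DiscreteContinuity.abs_integral_le {ω : ℝ} (hω : 0 ≤ ω) {u : M.Node → Euc d}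
    {p : M.Node → ℝ} (hc : DiscreteContinuity M ω u p) (hσ : 0 < σ) (hM : M.IsRegular σ)
    {q : Euc d → ℝ} (hq : TestBounds M q V L ε) {δ : ℝ} (hδ : 0 < δ) :
    |∫ x in cell b, fderiv ℝ q x (M.fe u x)| ≤
      (d + 1) * σ⁻¹ * ε * ((d + 1) * volume.real (cell b) + nodalSq u) +
      ω * V * ((d + 1) ^ 2 * δ * volume.real (cell b) + δ⁻¹ * nodalOsc p) := by
  have hq0 := hq.eps_nonneg
  have hV0 := hq.nonneg_V
  have hbm : BddMeas fun x => fderiv ℝ q x (M.fe u x) := by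
    obtain ⟨C, hC⟩ := (bddMeas_fe u).bound
    refine ⟨?_, L * C, fun x => ((fderiv ℝ q x).le_opNorm _).trans
      (mul_le_mul (hq.deriv_bound x) (hC x) (norm_nonneg _) hq.nonneg_L)⟩
    exact (isBoundedBilinearMap_apply (𝕜 := ℝ)
      (E := Euc d) (F := ℝ)).continuous.comp_stronglyMeasurable
      (hq.bddMeas_fderiv.1.prodMk (bddMeas_fe u).1)
  have h1 := abs_sum_inner_gradC_sub_le (M := M) (fun j i => q i.1 • u j) hbm
    (fun k x => by dsimp only; rw [periodic_fe u k x, hq.periodic.fderiv k x])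
    (B := fun K => (d + 1) * σ⁻¹ * ε * ∑ y : K.1, ‖u (M.node y.1)‖) (fun K x hx => by
      have e3 : ∑ z, lam K z x * ∑ y, inner ℝ (grd K y) (q (M.node y.1).1 • u (M.node z.1)) -
          fderiv ℝ q x (M.fe u x) =
          ∑ z, lam K z x * (∑ y, (inner ℝ (grd K y) (u (M.node z.1)) : ℝ) • q y.1 -
            fderiv ℝ q x (u (M.node z.1))) := by
        rw [← fe_nodal_sum u hx, map_sum]
        simp only [inner_smul_right, hq.periodic.apply_node K, map_smul, mul_sub,
          Finset.sum_sub_distrib, smul_eq_mul, mul_comm (q _)]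
      rw [e3, Finset.mul_sum]
      exact abs_sum_lam_mul_le hx fun z =>
        hq.norm_interp_sub_le hσ hM (interior_subset hx) (u (M.node z.1)))
  have h2 : ∑ j, ∑ i, inner ℝ (M.gradC j i) (q i.1 • u j) =
      - ∑ k, ∑ j, M.massC k j * (ω * q k.1 * (p j - p k)) := by
    rw [Finset.sum_comm, ← Finset.sum_neg_distrib]
    refine Finset.sum_congr rfl fun k _ => ?_
    have e1 : ∀ j, inner ℝ (M.gradC j k) (q k.1 • u j) =
        - (q k.1 * inner ℝ (M.gradC k j) (u j)) := fun j => by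
      rw [gradC_antisymm j k, inner_neg_left, inner_smul_right]
    simp only [e1, Finset.sum_neg_distrib, ← Finset.mul_sum]
    rw [hc k, Finset.mul_sum]
    congr 1
    exact Finset.sum_congr rfl fun j _ => by ring
  have h3 : |∑ k, ∑ j, M.massC k j * (ω * q k.1 * (p j - p k))| ≤
      ω * V * ((d + 1) ^ 2 * δ * volume.real (cell b) + δ⁻¹ * nodalOsc p) := by
    refine (abs_sum_massC_le _ (B := fun K => ω * V * ∑ z : K.1, ∑ y : K.1,
      ‖p (M.node y.1) - p (M.node z.1)‖) fun K x hx => ?_).trans ?_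
    · rw [Finset.mul_sum]
      refine abs_sum_lam_mul_le hx fun z => ?_
      rw [Finset.mul_sum]
      refine abs_sum_lam_mul_le hx fun y => ?_
      rw [abs_mul, abs_mul, abs_of_nonneg hω]
      have := hq.bound (M.node z.1).1
      exact mul_le_mul_of_nonneg_right (mul_le_mul_of_nonneg_left this hω) (abs_nonneg _)
    · rw [sum_reps_const_mul]
      exact mul_le_mul_of_nonneg_left (sum_osc_le p hδ) (by positivity)
  have h4 := sum_norm_le u
  have h5 : ∑ K ∈ M.reps, volume.real (body K) *
      ((d + 1) * σ⁻¹ * ε * ∑ y : K.1, ‖u (M.node y.1)‖) ≤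
      (d + 1) * σ⁻¹ * ε * ((d + 1) * volume.real (cell b) + nodalSq u) := by
    rw [sum_reps_const_mul]
    exact mul_le_mul_of_nonneg_left h4 (by positivity)
  rw [h2] at h1
  rw [abs_le] at h1 h3 ⊢
  constructor <;> linarith [h1.1, h1.2, h3.1, h3.2]

/-- Consistency of the convective term. -/
theorem DiscreteContinuity.abs_convec_le {ω : ℝ} (hω : 0 ≤ ω) {u : M.Node → Euc d}
    {p : M.Node → ℝ} (hc : DiscreteContinuity M ω u p) (hσ : 0 < σ) (hM : M.IsRegular σ)
    {v : Euc d → Euc d} (hv : TestBounds M v V L ε) {δ : ℝ} (hδ : 0 < δ) :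
    |∑ i, ∑ j, M.convec u i j * inner ℝ (u j) (v i.1) +
        ∫ x in cell b, inner ℝ (M.fe u x) (fderiv ℝ v x (M.fe u x))| ≤
      (d + 1) * σ⁻¹ * ε * nodalSq u +
        (σ⁻¹ + 1) * L * ((d + 1) * δ * nodalSq u + δ⁻¹ * nodalOsc u) +
        ω * V * ((d + 1) * δ * nodalSq u + δ⁻¹ * nodalOsc p) := by
  have hε0 := hv.eps_nonneg
  have hV0 := hv.nonneg_V
  have hL0 := hv.nonneg_L
  have hbm : BddMeas fun x => inner ℝ (M.fe u x) (fderiv ℝ v x (M.fe u x)) := by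
    refine (bddMeas_fe u).inner ?_
    obtain ⟨C, hC⟩ := (bddMeas_fe u).bound
    refine ⟨?_, L * C, fun x => ((fderiv ℝ v x).le_opNorm _).trans
      (mul_le_mul (hv.deriv_bound x) (hC x) (norm_nonneg _) hv.nonneg_L)⟩
    exact (isBoundedBilinearMap_apply (𝕜 := ℝ)
      (E := Euc d) (F := Euc d)).continuous.comp_stronglyMeasurable
      (hv.bddMeas_fderiv.1.prodMk (bddMeas_fe u).1)
  -- By antisymmetry of `c_ij`, the convective term is a form in the differences `v_i - v_j`, which
  -- converges to the integral, plus a remainder that the discrete continuity equation expresses by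
  -- pressure differences.
  set a : M.Node → M.Node → Euc d := fun j i =>
    (inner ℝ (u j) (v i.1 - v j.1) : ℝ) • ((1 / 2 : ℝ) • (u j + u i)) with ha
  have h1 := abs_sum_inner_gradC_sub_le a hbm
    (fun k x => by dsimp only; rw [periodic_fe u k x, hv.periodic.fderiv k x])
    (B := fun K => (d + 1) * σ⁻¹ * ε * (∑ z : K.1, ‖u (M.node z.1)‖ ^ 2) +
      (σ⁻¹ + 1) * L * ∑ z : K.1, ∑ y : K.1,
        ‖u (M.node z.1)‖ * ‖u (M.node y.1) - u (M.node z.1)‖) (fun K x hx => by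
      have hxK := interior_subset hx
      set U : K.1 → Euc d := fun z => u (M.node z.1) with hU
      set A := fderiv ℝ v x with hA
      have hUh : M.fe u x = ∑ z, lam K z x • U z := fe_eq u hxK
      -- the mean of the quadratic form over the vertices, with the error of averaging
      have e1 : inner ℝ (M.fe u x) (A (M.fe u x)) =
          ∑ z, lam K z x * (inner ℝ (U z) (A (U z)) -
            ∑ y, lam K y x * inner ℝ (U z) (A (U z - U y))) := by
        have : ∀ z, ∑ y, lam K y x * inner ℝ (U z) (A (U z - U y)) =
            inner ℝ (U z) (A (U z)) - inner ℝ (U z) (A (M.fe u x)) := fun z => by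
          simp only [map_sub, inner_sub_right, mul_sub, Finset.sum_sub_distrib, ← Finset.sum_mul,
            sum_lam, one_mul, hUh, map_sum, map_smul, inner_sum, inner_smul_right]
        simp only [this, sub_sub_cancel]
        conv_lhs => rw [hUh, sum_inner]
        simp only [inner_smul_left, RCLike.conj_to_real, ← hUh]
      have e2 : ∀ z, ∑ y, inner ℝ (grd K y) (a (M.node z.1) (M.node y.1)) =
          inner ℝ (U z) (∑ y, (inner ℝ (grd K y) (U z) : ℝ) • v y.1) +
            ∑ y, (1 / 2) * (inner ℝ (grd K y) (U y - U z) * inner ℝ (U z) (v y.1 - v z.1)) := by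
        intro z
        have e0 : ∑ y, (inner ℝ (grd K y) (U z) : ℝ) * inner ℝ (U z) (v z.1) = 0 := by
          rw [← Finset.sum_mul, ← sum_inner, sum_grd, inner_zero_left, zero_mul]
        rw [inner_sum, ← sub_zero (∑ y, inner ℝ (U z) _), ← e0, ← Finset.sum_sub_distrib,
          ← Finset.sum_add_distrib]
        refine Finset.sum_congr rfl fun y _ => ?_
        simp only [ha, hv.periodic.apply_node K, inner_smul_right, inner_add_right,
          inner_sub_right, hU]
        ring
      have e3 : ∑ z, lam K z x * ∑ y, inner ℝ (grd K y) (a (M.node z.1) (M.node y.1)) -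
          inner ℝ (M.fe u x) (A (M.fe u x)) =
          ∑ z, lam K z x * (inner ℝ (U z) (∑ y, (inner ℝ (grd K y) (U z) : ℝ) • v y.1 - A (U z)) +
            ∑ y, (1 / 2) * (inner ℝ (grd K y) (U y - U z) * inner ℝ (U z) (v y.1 - v z.1)) +
            ∑ y, lam K y x * inner ℝ (U z) (A (U z - U y))) := by
        rw [e1, ← Finset.sum_sub_distrib]
        refine Finset.sum_congr rfl fun z _ => ?_
        rw [e2, inner_sub_right]; ring
      rw [e3, Finset.mul_sum, Finset.mul_sum, ← Finset.sum_add_distrib]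
      refine abs_sum_lam_mul_le hx fun z => ?_
      have b1 : |inner ℝ (U z) (∑ y, (inner ℝ (grd K y) (U z) : ℝ) • v y.1 - A (U z))| ≤
          (d + 1) * σ⁻¹ * ε * ‖U z‖ ^ 2 := by
        refine (abs_real_inner_le_norm _ _).trans ?_
        have := mul_le_mul_of_nonneg_left (hv.norm_interp_sub_le hσ hM hxK (U z))
          (norm_nonneg (U z))
        refine this.trans_eq ?_
        ring
      have b2 : |∑ y, (1 / 2) * (inner ℝ (grd K y) (U y - U z) * inner ℝ (U z) (v y.1 - v z.1))| ≤
          σ⁻¹ * L * ∑ y, ‖U z‖ * ‖U y - U z‖ := by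
        rw [Finset.mul_sum]
        refine (Finset.abs_sum_le_sum_abs _ _).trans (Finset.sum_le_sum fun y _ => ?_)
        rw [abs_mul, abs_mul]
        have c1 := abs_real_inner_le_norm (grd K y) (U y - U z)
        have c2 := abs_real_inner_le_norm (U z) (v y.1 - v z.1)
        have c3 : ‖v y.1 - v z.1‖ ≤ L * Metric.diam (body K) := (hv.norm_sub_le _ _).trans
          (mul_le_mul_of_nonneg_left
            (norm_sub_le_diam (vertex_mem_body K y) (vertex_mem_body K z)) hL0)
        have c4 : |(1 / 2 : ℝ)| ≤ 1 := by rw [abs_of_pos] <;> norm_num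
        calc |(1 / 2 : ℝ)| * (|inner ℝ (grd K y) (U y - U z)| * |inner ℝ (U z) (v y.1 - v z.1)|)
            ≤ 1 * ((‖grd K y‖ * ‖U y - U z‖) * (‖U z‖ * (L * Metric.diam (body K)))) := by
              gcongr
              exact c2.trans (mul_le_mul_of_nonneg_left c3 (norm_nonneg _))
          _ = (‖grd K y‖ * Metric.diam (body K)) * (L * (‖U z‖ * ‖U y - U z‖)) := by ring
          _ ≤ σ⁻¹ * (L * (‖U z‖ * ‖U y - U z‖)) :=
              mul_le_mul_of_nonneg_right (hM.norm_grd_mul_diam_le hσ K y) (by positivity)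
          _ = _ := by ring
      have b3 : |∑ y, lam K y x * inner ℝ (U z) (A (U z - U y))| ≤
          L * ∑ y, ‖U z‖ * ‖U y - U z‖ := by
        rw [Finset.mul_sum]
        refine abs_sum_lam_mul_le hx fun y => (abs_real_inner_le_norm _ _).trans ?_
        rw [mul_left_comm, norm_sub_rev (U y)]
        exact mul_le_mul_of_nonneg_left (((A.le_opNorm _)).trans
          (mul_le_mul_of_nonneg_right (hv.deriv_bound x) (norm_nonneg _))) (norm_nonneg _)
      refine (abs_add_le _ _).trans ((add_le_add ((abs_add_le _ _).trans (add_le_add b1 b2))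
        b3).trans_eq ?_)
      ring)
  have h2 : ∑ i, ∑ j, M.convec u i j * inner ℝ (u j) (v i.1) =
      - ∑ j, ∑ i, inner ℝ (M.gradC j i) (a j i) -
        ∑ j, ∑ i, M.massC j i * ((1 / 2) * ω * inner ℝ (u j) (v j.1) * (p i - p j)) := by
    rw [Finset.sum_comm, ← Finset.sum_neg_distrib, ← Finset.sum_sub_distrib]
    refine Finset.sum_congr rfl fun j _ => ?_
    have e4 : ∑ i, M.massC j i * ((1 / 2) * ω * inner ℝ (u j) (v j.1) * (p i - p j)) =
        (1 / 2) * inner ℝ (u j) (v j.1) * ∑ i, inner ℝ (M.gradC j i) (u i) := by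
      rw [hc j, Finset.mul_sum]
      exact Finset.sum_congr rfl fun i _ => by ring
    have e5 : ∑ i, inner ℝ (M.gradC j i) (u j) = 0 := by
      rw [← sum_inner, sum_gradC, inner_zero_left]
    have e6 : (1 / 2) * inner ℝ (u j) (v j.1) * ∑ i, inner ℝ (M.gradC j i) (u i) =
        (1 / 2) * inner ℝ (u j) (v j.1) * ∑ i, inner ℝ (M.gradC j i) (u i) +
        (1 / 2) * inner ℝ (u j) (v j.1) * ∑ i, inner ℝ (M.gradC j i) (u j) := by
      rw [e5, mul_zero, add_zero]
    rw [e4, e6, Finset.mul_sum, Finset.mul_sum, ← Finset.sum_add_distrib, ← Finset.sum_neg_distrib,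
      ← Finset.sum_sub_distrib]
    refine Finset.sum_congr rfl fun i _ => ?_
    simp only [convec, ha, gradC_antisymm i j, inner_neg_right, inner_smul_right,
      inner_add_right, inner_sub_right, real_inner_comm (M.gradC j i)]
    ring
  have h3 : |∑ j, ∑ i, M.massC j i * ((1 / 2) * ω * inner ℝ (u j) (v j.1) * (p i - p j))| ≤
      ω * V * ((d + 1) * δ * nodalSq u + δ⁻¹ * nodalOsc p) := by
    refine (abs_sum_massC_le _ (B := fun K => ω * V * ∑ z : K.1, ∑ y : K.1,
      ‖u (M.node z.1)‖ * ‖p (M.node y.1) - p (M.node z.1)‖) fun K x hx => ?_).trans ?_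
    · rw [Finset.mul_sum]
      refine abs_sum_lam_mul_le hx fun z => ?_
      rw [Finset.mul_sum]
      refine abs_sum_lam_mul_le hx fun y => ?_
      rw [abs_mul, abs_mul, abs_mul, abs_of_nonneg hω]
      have c1 := (abs_real_inner_le_norm (u (M.node z.1)) (v (M.node z.1).1)).trans
        (mul_le_mul_of_nonneg_left (hv.bound (M.node z.1).1) (norm_nonneg _))
      have c4 : |(1 / 2 : ℝ)| ≤ 1 := by rw [abs_of_pos] <;> norm_num
      calc _ ≤ 1 * ω * (‖u (M.node z.1)‖ * V) * |p (M.node y.1) - p (M.node z.1)| := by gcongr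
        _ = _ := by rw [Real.norm_eq_abs]; ring
    · rw [sum_reps_const_mul]
      exact mul_le_mul_of_nonneg_left (sum_norm_mul_osc_le u p hδ) (by positivity)
  have h4 : ∑ K ∈ M.reps, volume.real (body K) *
      ((d + 1) * σ⁻¹ * ε * (∑ z : K.1, ‖u (M.node z.1)‖ ^ 2) +
      (σ⁻¹ + 1) * L * ∑ z : K.1, ∑ y : K.1,
        ‖u (M.node z.1)‖ * ‖u (M.node y.1) - u (M.node z.1)‖) ≤
      (d + 1) * σ⁻¹ * ε * nodalSq u +
        (σ⁻¹ + 1) * L * ((d + 1) * δ * nodalSq u + δ⁻¹ * nodalOsc u) := by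
    simp only [mul_add (volume.real _), Finset.sum_add_distrib]
    rw [sum_reps_const_mul, sum_reps_const_mul]
    exact add_le_add le_rfl (mul_le_mul_of_nonneg_left (sum_norm_mul_osc_le u u hδ)
      (by positivity))
  rw [h2]
  rw [abs_le] at h1 h3 ⊢
  constructor <;> linarith [h1.1, h1.2, h3.1, h3.2]

/-! ### The viscous term -/

/-- The partial derivative `∂_k` of the finite element function with nodal values `c`, which exists
almost everywhere. -/
def feD {F : Type*} [AddCommGroup F] [Module ℝ F] (c : M.Node → F) (k : Fin d) (x : Euc d) : F :=
  ∑ j, fderiv ℝ (M.basisFun j) x (EuclideanSpace.single k 1) • c j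

theorem bddMeas_fderiv_basisFun (i : M.Node) (w : Euc d) :
    BddMeas fun x => fderiv ℝ (M.basisFun i) x w := by
  simp only [← inner_gradient_basisFun]
  exact (bddMeas_gradient i).inner (BddMeas.const w)

theorem bddMeas_feD {F : Type*} [NormedAddCommGroup F] [NormedSpace ℝ F] (c : M.Node → F)
    (k : Fin d) : BddMeas (feD c k) :=
  BddMeas.sum _ fun i _ => (bddMeas_fderiv_basisFun i _).smul (BddMeas.const _)

theorem feD_eq (c : M.Node → Euc d) (k : Fin d) {K : M.Elem} {x : Euc d}
    (hx : x ∈ interior (body K)) :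
    feD c k x = ∑ y, (inner ℝ (grd K y) (EuclideanSpace.single k (1 : ℝ)) : ℝ) •
      c (M.node y.1) := by
  have := sum_gradient hx (F := Euc d)
    (fun i => (innerₗ (Euc d) (EuclideanSpace.single k (1 : ℝ))).smulRight (c i))
  simp only [LinearMap.smulRight_apply, innerₗ_apply_apply] at this
  simp only [feD, ← inner_gradient_basisFun]
  simpa only [real_inner_comm] using this

theorem sum_stiff (u w : M.Node → Euc d) :
    ∑ i, ∑ j, M.stiff i j * inner ℝ (u j) (w i) =
      ∑ k, ∫ x in cell b, inner ℝ (feD u k x) (feD w k x) := by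
  have e1 : ∀ i j x, inner ℝ (gradient (M.basisFun i) x) (gradient (M.basisFun j) x) =
      ∑ k, fderiv ℝ (M.basisFun i) x (EuclideanSpace.single k 1) *
        fderiv ℝ (M.basisFun j) x (EuclideanSpace.single k 1) := fun i j x => by
    rw [PiLp.inner_apply]
    simp only [← inner_gradient_basisFun, EuclideanSpace.inner_single_right]
    simp [mul_comm]
  have hb : ∀ i j k, BddMeas fun x => fderiv ℝ (M.basisFun i) x (EuclideanSpace.single k 1) *
      fderiv ℝ (M.basisFun j) x (EuclideanSpace.single k 1) * inner ℝ (u j) (w i) :=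
    fun i j k => ((bddMeas_fderiv_basisFun i _).mul (bddMeas_fderiv_basisFun j _)).mul
      (BddMeas.const _)
  have e2 : ∀ i j, M.stiff i j * inner ℝ (u j) (w i) = ∑ k, ∫ x in cell b,
      fderiv ℝ (M.basisFun i) x (EuclideanSpace.single k 1) *
        fderiv ℝ (M.basisFun j) x (EuclideanSpace.single k 1) * inner ℝ (u j) (w i) := by
    intro i j
    rw [stiff, ← integral_mul_const, ← integral_finsetSum _ fun k _ => (hb i j k).integrable _]
    simp only [e1, Finset.sum_mul]
  have e3 : ∀ k x, inner ℝ (feD u k x) (feD w k x) = ∑ i, ∑ j,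
      fderiv ℝ (M.basisFun i) x (EuclideanSpace.single k 1) *
        fderiv ℝ (M.basisFun j) x (EuclideanSpace.single k 1) * inner ℝ (u j) (w i) := by
    intro k x
    simp only [feD, sum_inner, inner_sum, inner_smul_left, inner_smul_right, RCLike.conj_to_real]
    refine Finset.sum_congr rfl fun i _ => ?_
    rw [Finset.mul_sum]
    exact Finset.sum_congr rfl fun j _ => by ring
  simp only [e3, e2]
  have e4 : ∀ k, ∫ x in cell b, ∑ i, ∑ j,
      fderiv ℝ (M.basisFun i) x (EuclideanSpace.single k 1) *
        fderiv ℝ (M.basisFun j) x (EuclideanSpace.single k 1) * inner ℝ (u j) (w i) =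
      ∑ i, ∑ j, ∫ x in cell b, fderiv ℝ (M.basisFun i) x (EuclideanSpace.single k 1) *
        fderiv ℝ (M.basisFun j) x (EuclideanSpace.single k 1) * inner ℝ (u j) (w i) := by
    intro k
    rw [integral_finsetSum _ fun i _ => (BddMeas.sum _ fun j _ => hb i j k).integrable _]
    exact Finset.sum_congr rfl fun i _ => integral_finsetSum _ fun j _ => (hb i j k).integrable _
  simp only [e4]
  rw [Finset.sum_comm_cycle]

/-- The square of the `L²` norm of the gradient of a finite element function. -/
def gradSq (u : M.Node → Euc d) : ℝ := ∑ i, ∑ j, M.stiff i j * inner ℝ (u j) (u i)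

theorem gradSq_eq (u : M.Node → Euc d) : gradSq u = ∑ k, ∫ x in cell b, ‖feD u k x‖ ^ 2 := by
  rw [gradSq, sum_stiff]
  simp only [real_inner_self_eq_norm_sq]

theorem gradSq_nonneg (u : M.Node → Euc d) : 0 ≤ gradSq u := by
  rw [gradSq_eq]
  exact Finset.sum_nonneg fun _ _ => integral_nonneg fun _ => by positivity

/-- Consistency of the viscous term. -/
theorem abs_stiff_sub_le (hσ : 0 < σ) (hM : M.IsRegular σ) {v : Euc d → Euc d}
    (hv : TestBounds M v V L ε) (u : M.Node → Euc d) :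
    |∑ i, ∑ j, M.stiff i j * inner ℝ (u j) (v i.1) -
        ∑ k, ∫ x in cell b, inner ℝ (feD u k x) (fderiv ℝ v x (EuclideanSpace.single k 1))| ≤
      (d + 1) * σ⁻¹ * ε * (d * volume.real (cell b) + gradSq u) := by
  have hε0 := hv.eps_nonneg
  have hb : ∀ k, BddMeas fun x => inner ℝ (feD u k x)
      (fderiv ℝ v x (EuclideanSpace.single k 1)) := fun k => (bddMeas_feD u k).inner
    (hv.bddMeas_fderiv.clm (ContinuousLinearMap.apply ℝ (Euc d) (EuclideanSpace.single k (1 : ℝ))))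
  rw [sum_stiff u (fun i => v i.1), ← Finset.sum_sub_distrib, gradSq_eq]
  have key : ∀ k : Fin d,
      |(∫ x in cell b, inner ℝ (feD u k x) (feD (fun i : M.Node => v i.1) k x)) -
      ∫ x in cell b, inner ℝ (feD u k x) (fderiv ℝ v x (EuclideanSpace.single k 1))| ≤
      (d + 1) * σ⁻¹ * ε * (volume.real (cell b) + ∫ x in cell b, ‖feD u k x‖ ^ 2) := by
    intro k
    rw [← integral_sub (((bddMeas_feD u k).inner (bddMeas_feD _ k)).integrable _)
      ((hb k).integrable _)]
    have hi := ((bddMeas_feD u k).norm.pow 2).integrable (volume.restrict (cell b))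
    have e1 : (d + 1) * σ⁻¹ * ε * (volume.real (cell b) + ∫ x in cell b, ‖feD u k x‖ ^ 2) =
        ∫ x in cell b, (d + 1) * σ⁻¹ * ε * (1 + ‖feD u k x‖ ^ 2) := by
      rw [integral_const_mul, integral_add (integrable_const _) hi]
      simp
    rw [e1]
    refine norm_integral_le_of_norm_le (G := ℝ) (((integrable_const _).add hi).const_mul _)
      (ae_restrict_of_ae ?_)
    filter_upwards [M.ae_mem_interior_body] with x ⟨K, hK⟩
    rw [← inner_sub_right, feD_eq (fun i : M.Node => v i.1) k hK]
    simp only [hv.periodic.apply_node K]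
    have h1 := hv.norm_interp_sub_le hσ hM (interior_subset hK) (EuclideanSpace.single k (1 : ℝ))
    rw [PiLp.norm_single, norm_one, mul_one] at h1
    refine (norm_inner_le_norm _ _).trans ?_
    have h2 : ‖feD u k x‖ ≤ 1 + ‖feD u k x‖ ^ 2 := by nlinarith [sq_nonneg (‖feD u k x‖ - 1)]
    rw [mul_comm]
    exact mul_le_mul h1 h2 (norm_nonneg _) (by positivity)
  refine (Finset.abs_sum_le_sum_abs _ _).trans ((Finset.sum_le_sum fun k _ => key k).trans_eq ?_)
  rw [← Finset.mul_sum, Finset.sum_add_distrib, Finset.sum_const, Finset.card_univ,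
    Fintype.card_fin, nsmul_eq_mul]

/-- Integration by parts of a finite element function against a smooth periodic function. -/
theorem integral_feD_inner (u : M.Node → Euc d) (k : Fin d) {φ : Euc d → Euc d}
    (hφ : ContDiff ℝ 1 φ) (hp : IsPeriodic b φ) :
    ∫ x in cell b, inner ℝ (feD u k x) (φ x) =
      - ∫ x in cell b, inner ℝ (M.fe u x) (fderiv ℝ φ x (EuclideanSpace.single k 1)) := by
  set e : Euc d := EuclideanSpace.single k 1 with he
  obtain ⟨A, hA0, hA⟩ := exists_bound_of_periodic (b := b) (f := fun _ : ℝ => φ)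
    (hφ.continuous.comp continuous_snd) (fun _ => hp) 0
  have hφ' := hφ.continuous_fderiv one_ne_zero
  obtain ⟨B, hB0, hB⟩ := exists_bound_of_periodic (b := b) (f := fun _ : ℝ => fderiv ℝ φ)
    (hφ'.comp continuous_snd) (fun _ => hp.fderiv) 0
  replace hA := hA 0 (by simp)
  replace hB := hB 0 (by simp)
  have hdiff : Differentiable ℝ φ := hφ.differentiable one_ne_zero
  have hφB : BddMeas φ := ⟨hφ.continuous.stronglyMeasurable, A, hA⟩
  have hφB' : BddMeas fun x => fderiv ℝ φ x e :=
    (⟨hφ'.stronglyMeasurable, B, hB⟩ : BddMeas (fderiv ℝ φ)).clm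
      (ContinuousLinearMap.apply ℝ (Euc d) e)
  have hLip : ∀ x z, ‖φ z - φ x‖ ≤ B * ‖z - x‖ := fun x z =>
    convex_univ.norm_image_sub_le_of_norm_fderiv_le (fun x _ => hdiff x)
      (fun x _ => hB x) (mem_univ _) (mem_univ _)
  obtain ⟨C, -, hC⟩ := M.exists_lipschitz_basisFun
  have key : ∀ j, ∫ x in cell b, fderiv ℝ (M.basisFun j) x e * inner ℝ (u j) (φ x) =
      - ∫ x in cell b, M.basisFun j x * inner ℝ (u j) (fderiv ℝ φ x e) := by
    intro j
    have h1 : ∀ x, fderiv ℝ (fun x => inner ℝ (u j) (φ x)) x e =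
        inner ℝ (u j) (fderiv ℝ φ x e) := by
      intro x
      have := ((innerSL ℝ (u j)).hasFDerivAt (x := φ x)).comp x (hdiff x).hasFDerivAt
      rw [show (fun x => inner ℝ (u j) (φ x)) = (innerSL ℝ (u j)) ∘ φ from rfl, this.fderiv]
      rfl
    have h2 := setIntegral_cell_mul_fderiv (f := fun x => inner ℝ (u j) (φ x)) (g := M.basisFun j)
      (fun k x => by dsimp only; rw [hp k x]) (periodic_basisFun j)
      (C := ‖u j‖ * B) (D := C) (A := ‖u j‖ * A) (B := 1)
      (fun x z => by
        rw [← inner_sub_right, mul_assoc]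
        exact (abs_real_inner_le_norm _ _).trans
          (mul_le_mul_of_nonneg_left (hLip x z) (norm_nonneg _)))
      (hC j)
      (fun x => (abs_real_inner_le_norm _ _).trans
        (mul_le_mul_of_nonneg_left (hA x) (norm_nonneg _)))
      (fun x => by rw [abs_of_nonneg (basisFun_nonneg j x)]; exact basisFun_le_one j x) e
    simp only [h1] at h2
    rw [← h2]
    simp only [mul_comm]
  have e1 : ∀ x, inner ℝ (feD u k x) (φ x) =
      ∑ j, fderiv ℝ (M.basisFun j) x e * inner ℝ (u j) (φ x) := fun x => by
    simp only [feD, sum_inner, inner_smul_left, RCLike.conj_to_real, he]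
  have e2 : ∀ x, inner ℝ (M.fe u x) (fderiv ℝ φ x e) =
      ∑ j, M.basisFun j x * inner ℝ (u j) (fderiv ℝ φ x e) := fun x => by
    simp only [fe, sum_inner, inner_smul_left, RCLike.conj_to_real]
  simp only [e1, e2]
  rw [integral_finsetSum _ fun j _ => ((bddMeas_fderiv_basisFun j e).mul
      ((BddMeas.const _).inner hφB)).integrable _,
    integral_finsetSum _ fun j _ => ((bddMeas_basisFun j).mul
      ((BddMeas.const _).inner hφB')).integrable _, ← Finset.sum_neg_distrib]
  exact Finset.sum_congr rfl fun j _ => key j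

/-! ### Graph Laplacians -/

section GraphLaplacian

variable {D : M.Node → M.Node → ℝ}

theorem IsGraphLaplacian.sum_eq (hD : M.IsGraphLaplacian D) (u v : M.Node → Euc d) :
    ∑ i, ∑ j, D i j * inner ℝ (u j) (v i) =
      - ((1 / 2) * ∑ i, ∑ j, D i j * inner ℝ (u i - u j) (v i - v j)) := by
  have h1 : ∑ i, ∑ j, D i j * inner ℝ (u i) (v i) = 0 :=
    Finset.sum_eq_zero fun i _ => by rw [← Finset.sum_mul, hD.rowSum, zero_mul]
  have h2 : ∑ i, ∑ j, D i j * inner ℝ (u j) (v j) = 0 := by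
    rw [Finset.sum_comm, ← h1]
    exact Finset.sum_congr rfl fun i _ => Finset.sum_congr rfl fun j _ => by rw [hD.symm j i]
  have h3 : ∑ i, ∑ j, D i j * inner ℝ (u i) (v j) = ∑ i, ∑ j, D i j * inner ℝ (u j) (v i) := by
    rw [Finset.sum_comm]
    exact Finset.sum_congr rfl fun i _ => Finset.sum_congr rfl fun j _ => by rw [hD.symm j i]
  have h4 : ∑ i, ∑ j, D i j * inner ℝ (u i - u j) (v i - v j) =
      (∑ i, ∑ j, D i j * inner ℝ (u i) (v i) + ∑ i, ∑ j, D i j * inner ℝ (u j) (v j)) -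
      (∑ i, ∑ j, D i j * inner ℝ (u i) (v j) + ∑ i, ∑ j, D i j * inner ℝ (u j) (v i)) := by
    simp only [← Finset.sum_add_distrib, ← Finset.sum_sub_distrib]
    refine Finset.sum_congr rfl fun i _ => Finset.sum_congr rfl fun j _ => ?_
    simp only [inner_sub_left, inner_sub_right]; ring
  rw [h4, h1, h2, h3]; ring

/-- The quadratic form of a graph Laplacian, up to the factor `-2`. -/
def lapSq (D : M.Node → M.Node → ℝ) (u : M.Node → Euc d) : ℝ :=
  ∑ i, ∑ j, D i j * ‖u i - u j‖ ^ 2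

theorem IsGraphLaplacian.mul_norm_sq_nonneg (hD : M.IsGraphLaplacian D) (u : M.Node → Euc d)
    (i j : M.Node) : 0 ≤ D i j * ‖u i - u j‖ ^ 2 := by
  rcases eq_or_ne j i with rfl | h
  · simp
  · exact mul_nonneg (hD.nonneg i j h) (by positivity)

theorem IsGraphLaplacian.lapSq_nonneg (hD : M.IsGraphLaplacian D) (u : M.Node → Euc d) :
    0 ≤ lapSq D u :=
  Finset.sum_nonneg fun i _ => Finset.sum_nonneg fun j _ => hD.mul_norm_sq_nonneg u i j

/-- The artificial viscosity, by Young's inequality, is at most a small multiple of its dissipation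
plus a large multiple of its quadratic form at the test function. -/
theorem IsGraphLaplacian.abs_sum_le (hD : M.IsGraphLaplacian D) (u v : M.Node → Euc d) {δ : ℝ}
    (hδ : 0 < δ) :
    |∑ i, ∑ j, D i j * inner ℝ (u j) (v i)| ≤
      (1 / 2) * (δ * lapSq D u + δ⁻¹ * lapSq D v) := by
  rw [hD.sum_eq, abs_neg, abs_mul, abs_of_pos (by norm_num : (0 : ℝ) < 1 / 2)]
  refine mul_le_mul_of_nonneg_left ?_ (by norm_num)
  rw [lapSq, lapSq, Finset.mul_sum, Finset.mul_sum, ← Finset.sum_add_distrib]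
  refine (Finset.abs_sum_le_sum_abs _ _).trans (Finset.sum_le_sum fun i _ => ?_)
  rw [Finset.mul_sum, Finset.mul_sum, ← Finset.sum_add_distrib]
  refine (Finset.abs_sum_le_sum_abs _ _).trans (Finset.sum_le_sum fun j _ => ?_)
  rcases eq_or_ne j i with rfl | h
  · simp
  · have h0 := hD.nonneg i j h
    rw [abs_mul, abs_of_nonneg h0]
    have h1 := (abs_real_inner_le_norm (u i - u j) (v i - v j)).trans
      (mul_le_young hδ ‖u i - u j‖ ‖v i - v j‖)
    calc _ ≤ D i j * (δ * ‖u i - u j‖ ^ 2 + δ⁻¹ * ‖v i - v j‖ ^ 2) :=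
          mul_le_mul_of_nonneg_left h1 h0
      _ = _ := by ring

theorem node_add {y : Euc d} (hy : {y} ∈ M.complex.faces) {g : Euc d} (hg : g ∈ lattice b) :
    M.node (y + g) = M.node y := by
  have h : {y + g} ∈ M.complex.faces := by simpa using M.invariant _ hy g hg
  rw [node_eq_iff h, add_sub_right_comm]
  exact (lattice b).add_mem (sub_node_mem hy) hg

/-- Neighboring nodes are vertices of a common element. -/
theorem Neighbor.exists_elem {i j : M.Node} (h : M.Neighbor i j) :
    ∃ K ∈ M.reps, ∃ y z : K.1, M.node y.1 = i ∧ M.node z.1 = j := by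
  classical
  obtain ⟨x, hi, hj⟩ := h
  obtain ⟨K, hK⟩ := M.exists_mem_body x
  obtain ⟨K', hK', g, rfl⟩ := exists_mem_reps K
  have key : ∀ i : M.Node, M.basisFun i x ≠ 0 → ∃ y : K'.1, M.node y.1 = i := by
    intro i hi
    rw [basisFun_eq hK] at hi
    obtain ⟨y, -, hy⟩ := Finset.exists_ne_zero_of_sum_ne_zero hi
    have hyi : M.node y.1 = i := by
      by_contra h; exact hy (if_neg h)
    obtain ⟨y', hy', e⟩ := Finset.mem_map.1 y.2
    refine ⟨⟨y', hy'⟩, ?_⟩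
    rw [← hyi, ← e]
    exact (node_add (singleton_mem_faces K' ⟨y', hy'⟩) g.2).symm
  obtain ⟨y, hy⟩ := key i hi
  obtain ⟨z, hz⟩ := key j hj
  exact ⟨K', hK', y, z, hy, hz⟩

/-- Consistency of the artificial viscosity: the quadratic form of the graph Laplacian, evaluated
for a smooth function, is of the order of the mesh size. -/
theorem IsGraphLaplacian.lapSq_le (hD : M.IsGraphLaplacian D) {C κ : ℝ} (hC0 : 0 ≤ C)
    (hC : ∀ i j, j ≠ i → D i j ≤ C * M.meshSize ^ (d - 1))
    (hκ : ∀ K : M.Elem, M.meshSize ^ (d - 1) * Metric.diam (body K) ^ 2 ≤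
      κ * M.meshSize * volume.real (body K))
    {v : Euc d → Euc d} (hv : TestBounds M v V L ε) :
    lapSq D (fun i => v i.1) ≤
      (d + 1) ^ 2 * C * L ^ 2 * κ * volume.real (cell b) * M.meshSize := by
  classical
  set B : M.Elem → ℝ := fun K => C * L ^ 2 * (M.meshSize ^ (d - 1) * Metric.diam (body K) ^ 2)
    with hB
  have hh := M.meshSize_nonneg
  have hB0 : ∀ K, 0 ≤ B K := fun K => by positivity
  have h1 : ∀ i j, D i j * ‖v i.1 - v j.1‖ ^ 2 ≤ ∑ K ∈ M.reps, ∑ y : K.1, ∑ z : K.1,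
      if M.node y.1 = i then (if M.node z.1 = j then B K else 0) else 0 := by
    intro i j
    have hnn : ∀ K : M.Elem, ∀ y z : K.1,
        0 ≤ if M.node y.1 = i then (if M.node z.1 = j then B K else 0) else 0 := fun K y z => by
      split_ifs
      exacts [hB0 K, le_rfl, le_rfl]
    have hsum : 0 ≤ ∑ K ∈ M.reps, ∑ y : K.1, ∑ z : K.1,
        if M.node y.1 = i then (if M.node z.1 = j then B K else 0) else 0 :=
      Finset.sum_nonneg fun K _ => Finset.sum_nonneg fun y _ => Finset.sum_nonneg fun z _ =>
        hnn K y z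
    by_cases hn : M.Neighbor i j
    swap
    · rw [hD.sparse i j hn, zero_mul]; exact hsum
    rcases eq_or_ne j i with rfl | hji
    · simpa using hsum
    obtain ⟨K, hK, y, z, hy, hz⟩ := hn.exists_elem
    have h2 : D i j * ‖v i.1 - v j.1‖ ^ 2 ≤ B K := by
      have h3 : ‖v i.1 - v j.1‖ ≤ L * Metric.diam (body K) := by
        rw [← hy, ← hz, hv.periodic.apply_node K, hv.periodic.apply_node K]
        exact (hv.norm_sub_le _ _).trans (mul_le_mul_of_nonneg_left
          (norm_sub_le_diam (vertex_mem_body K y) (vertex_mem_body K z)) hv.nonneg_L)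
      calc _ ≤ (C * M.meshSize ^ (d - 1)) * (L * Metric.diam (body K)) ^ 2 :=
            mul_le_mul (hC i j hji) (pow_le_pow_left₀ (norm_nonneg _) h3 2) (by positivity)
              (by positivity)
        _ = B K := by simp only [hB]; ring
    refine h2.trans ?_
    calc B K = if M.node y.1 = i then (if M.node z.1 = j then B K else 0) else 0 := by
          rw [if_pos hy, if_pos hz]
      _ ≤ ∑ z : K.1, if M.node y.1 = i then (if M.node z.1 = j then B K else 0) else 0 :=
          Finset.single_le_sum (f := fun z : K.1 =>
            if M.node y.1 = i then (if M.node z.1 = j then B K else 0) else 0)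
            (fun z _ => hnn K y z) (Finset.mem_univ z)
      _ ≤ ∑ y : K.1, ∑ z : K.1,
            if M.node y.1 = i then (if M.node z.1 = j then B K else 0) else 0 :=
          Finset.single_le_sum (f := fun y : K.1 => ∑ z : K.1,
            if M.node y.1 = i then (if M.node z.1 = j then B K else 0) else 0)
            (fun y _ => Finset.sum_nonneg fun z _ => hnn K y z) (Finset.mem_univ y)
      _ ≤ _ :=
          Finset.single_le_sum (f := fun K : M.Elem => ∑ y : K.1, ∑ z : K.1,
            if M.node y.1 = i then (if M.node z.1 = j then B K else 0) else 0)
            (fun K _ => Finset.sum_nonneg fun y _ => Finset.sum_nonneg fun z _ => hnn K y z) hK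
  calc lapSq D (fun i => v i.1) ≤ ∑ i, ∑ j, ∑ K ∈ M.reps, ∑ y : K.1, ∑ z : K.1,
        (if M.node y.1 = i then (if M.node z.1 = j then B K else 0) else 0) :=
        Finset.sum_le_sum fun i _ => Finset.sum_le_sum fun j _ => h1 i j
    _ = ∑ K ∈ M.reps, ∑ y : K.1, ∑ z : K.1, ∑ i, ∑ j,
        (if M.node y.1 = i then (if M.node z.1 = j then B K else 0) else 0) := by
        rw [Finset.sum_comm_cycle]
        refine Finset.sum_congr rfl fun K _ => ?_
        rw [Finset.sum_comm_cycle]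
        refine Finset.sum_congr rfl fun y _ => ?_
        rw [Finset.sum_comm_cycle]
    _ = ∑ K ∈ M.reps, (d + 1) ^ 2 * B K := by
        refine Finset.sum_congr rfl fun K _ => ?_
        simp [-Finset.univ_eq_attach, K.2.2]; ring
    _ ≤ ∑ K ∈ M.reps, (d + 1) ^ 2 * (C * L ^ 2 * (κ * M.meshSize * volume.real (body K))) := by
        refine Finset.sum_le_sum fun K _ => ?_
        have := hκ K
        simp only [hB]
        gcongr
    _ = _ := by
        rw [← M.sum_volume_reps, Finset.mul_sum, Finset.sum_mul]
        exact Finset.sum_congr rfl fun K _ => by ring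

end GraphLaplacian

/-! ### The energy inequality -/

/-- The convective term does not contribute to the energy: `ã_ij = ½ (u_i + u_j) · c_ij` is
antisymmetric. -/
theorem sum_convec_eq_zero (u : M.Node → Euc d) :
    ∑ i, ∑ j, M.convec u i j * inner ℝ (u j) (u i) = 0 := by
  have h : ∑ i, ∑ j, M.convec u i j * inner ℝ (u j) (u i) =
      - ∑ i, ∑ j, M.convec u i j * inner ℝ (u j) (u i) := by
    conv_lhs => rw [Finset.sum_comm]
    simp only [← Finset.sum_neg_distrib]
    refine Finset.sum_congr rfl fun i _ => Finset.sum_congr rfl fun j _ => ?_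
    simp only [convec]
    rw [gradC_antisymm j i, inner_neg_right, add_comm (u i), real_inner_comm (u i)]
    ring
  linarith

/-- The pressure term dissipates energy, by an amount equal to the pressure stabilization. -/
theorem DiscreteContinuity.sum_pressure_nonneg {ω : ℝ} (hω : 0 ≤ ω) {u : M.Node → Euc d}
    {p : M.Node → ℝ} (hc : DiscreteContinuity M ω u p) :
    0 ≤ ∑ i, ∑ j, p j * inner ℝ (M.gradC i j) (u i) := by
  have h1 : ∑ i, ∑ j, p j * inner ℝ (M.gradC i j) (u i) =
      - ∑ j, ∑ i, M.massC j i * (ω * (p j * (p i - p j))) := by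
    rw [Finset.sum_comm, ← Finset.sum_neg_distrib]
    refine Finset.sum_congr rfl fun j _ => ?_
    have e1 : ∀ i, p j * inner ℝ (M.gradC i j) (u i) = - (p j * inner ℝ (M.gradC j i) (u i)) :=
      fun i => by rw [gradC_antisymm i j, inner_neg_left, mul_neg]
    simp only [e1, Finset.sum_neg_distrib, ← Finset.mul_sum]
    rw [hc j, Finset.mul_sum]
    congr 1
    exact Finset.sum_congr rfl fun i _ => by ring
  have h2 : ∑ j, ∑ i, M.massC j i * (ω * (p j * (p i - p j))) =
      ∑ j, ∑ i, M.massC j i * (ω * (p i * (p j - p i))) := by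
    rw [Finset.sum_comm]
    exact Finset.sum_congr rfl fun i _ => Finset.sum_congr rfl fun j _ => by rw [massC_comm j i]
  have h3 : ∑ j, ∑ i, M.massC j i * (ω * (p j * (p i - p j))) +
      ∑ j, ∑ i, M.massC j i * (ω * (p i * (p j - p i))) ≤ 0 := by
    rw [← Finset.sum_add_distrib]
    refine Finset.sum_nonpos fun j _ => ?_
    rw [← Finset.sum_add_distrib]
    refine Finset.sum_nonpos fun i _ => ?_
    have := mul_nonneg (massC_nonneg j i) (mul_nonneg hω (sq_nonneg (p i - p j)))
    linarith [show M.massC j i * (ω * (p j * (p i - p j))) +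
      M.massC j i * (ω * (p i * (p j - p i))) =
      - (M.massC j i * (ω * (p i - p j) ^ 2)) by ring]
  linarith

/-- The momentum equation of the scheme at a fixed time, tested with nodal values `v`. -/
theorem sum_momentum {ν : ℝ} {D : M.Node → M.Node → ℝ} {u u' : M.Node → Euc d} {p : M.Node → ℝ}
    (hm : ∀ i, M.massL i • u' i =
      ∑ j, ((D i j - M.convec u i j - ν * M.stiff i j) • u j - p j • M.gradC i j))
    (v : M.Node → Euc d) :
    ∑ i, M.massL i * inner ℝ (u' i) (v i) =
      ∑ i, ∑ j, D i j * inner ℝ (u j) (v i) - ∑ i, ∑ j, M.convec u i j * inner ℝ (u j) (v i) -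
        ν * ∑ i, ∑ j, M.stiff i j * inner ℝ (u j) (v i) -
        ∑ i, ∑ j, p j * inner ℝ (M.gradC i j) (v i) := by
  simp only [Finset.mul_sum, ← Finset.sum_sub_distrib]
  refine Finset.sum_congr rfl fun i _ => ?_
  rw [← real_inner_smul_left, hm i, sum_inner]
  refine Finset.sum_congr rfl fun j _ => ?_
  rw [inner_sub_left, real_inner_smul_left, real_inner_smul_left]; ring

/-- The energy balance at a fixed time. The left-hand side is the time derivative of the energy. -/
theorem energy_le {ν ω : ℝ} (hω : 0 ≤ ω) {D : M.Node → M.Node → ℝ} (hD : M.IsGraphLaplacian D)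
    {u u' : M.Node → Euc d} {p : M.Node → ℝ} (hc : DiscreteContinuity M ω u p)
    (hm : ∀ i, M.massL i • u' i =
      ∑ j, ((D i j - M.convec u i j - ν * M.stiff i j) • u j - p j • M.gradC i j)) :
    ∑ i, M.massL i * inner ℝ (u' i) (u i) ≤ - (ν * gradSq u) - (1 / 2) * lapSq D u := by
  rw [sum_momentum hm, hD.sum_eq, sum_convec_eq_zero]
  have := hc.sum_pressure_nonneg hω
  simp only [real_inner_self_eq_norm_sq]
  rw [gradSq, lapSq]
  linarith

/-! ### The semi-discrete solution in time -/

section Continuity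

variable {c : ℝ → M.Node → Euc d} {p : ℝ → M.Node → ℝ}

theorem continuous_nodalSq {F : Type*} [NormedAddCommGroup F] {c : ℝ → M.Node → F}
    (hc : ∀ i, Continuous fun t => c t i) : Continuous fun t => nodalSq (c t) := by
  unfold nodalSq; fun_prop

theorem continuous_nodalOsc {F : Type*} [NormedAddCommGroup F] {c : ℝ → M.Node → F}
    (hc : ∀ i, Continuous fun t => c t i) : Continuous fun t => nodalOsc (c t) := by
  unfold nodalOsc; fun_prop

theorem continuous_gradSq (hc : ∀ i, Continuous fun t => c t i) :
    Continuous fun t => gradSq (c t) := by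
  unfold gradSq; fun_prop

end Continuity

/-- The kinetic energy with lumped masses. -/
def energy (u : M.Node → Euc d) : ℝ := (1 / 2) * ∑ i, M.massL i * ‖u i‖ ^ 2

theorem energy_nonneg (u : M.Node → Euc d) : 0 ≤ energy u :=
  mul_nonneg (by norm_num)
    (Finset.sum_nonneg fun i _ => mul_nonneg (massL_nonneg i) (by positivity))

theorem energy_le_nodalSq (u : M.Node → Euc d) : energy u ≤ nodalSq u := by
  have h := abs_sum_massL_sub_le (M := M) (fun i => ‖u i‖ ^ 2) (g := fun _ => 0)
    (BddMeas.const 0) (fun _ _ => rfl) (B := fun K => ∑ y : K.1, ‖u (M.node y.1)‖ ^ 2)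
    (fun K x hx => by
      rw [sub_zero]
      exact abs_sum_lam_mul_le hx fun z => (abs_of_nonneg (by positivity)).le)
  rw [integral_zero, sub_zero] at h
  have h2 := le_abs_self (∑ i, M.massL i * ‖u i‖ ^ 2)
  have h3 := energy_nonneg u
  rw [energy] at h3 ⊢
  rw [nodalSq]
  linarith

/-- The weak form of the scheme at a fixed time without the artificial viscosity, tested with the
nodal values `v` whose time derivative is `v'`. -/
def schemeForm (ν : ℝ) (u : M.Node → Euc d) (p : M.Node → ℝ) (v v' : M.Node → Euc d) : ℝ :=
  ∑ i, M.massL i * inner ℝ (u i) (v' i) - ∑ i, ∑ j, M.convec u i j * inner ℝ (u j) (v i) -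
    ν * ∑ i, ∑ j, M.stiff i j * inner ℝ (u j) (v i) -
    ∑ i, ∑ j, p j * inner ℝ (M.gradC i j) (v i)

namespace IsSemiDiscreteSolution

variable {ν ω T : ℝ} {du : ℝ → M.Node → M.Node → ℝ} {U : ℝ → M.Node → Euc d}
  {P : ℝ → M.Node → ℝ}

theorem discreteContinuity (h : M.IsSemiDiscreteSolution ν ω T du U P) {t : ℝ}
    (ht : t ∈ Ioo 0 T) : DiscreteContinuity M ω (U t) (P t) := by
  intro k
  rw [← sum_beckerHansbo]
  have := h.continuity t ht k
  rw [Finset.sum_sub_distrib] at this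
  linarith

theorem hasDerivAt_sum (h : M.IsSemiDiscreteSolution ν ω T du U P) {t : ℝ} (ht : t ∈ Ioo 0 T)
    {v : ℝ → M.Node → Euc d} {v' : M.Node → Euc d}
    (hv : ∀ i, HasDerivAt (fun s => v s i) (v' i) t) :
    HasDerivAt (fun s => ∑ i, M.massL i * inner ℝ (U s i) (v s i))
      (∑ i, M.massL i * inner ℝ (deriv (fun s => U s i) t) (v t i) +
        ∑ i, M.massL i * inner ℝ (U t i) (v' i)) t := by
  rw [← Finset.sum_add_distrib]
  refine HasDerivAt.fun_sum fun i _ => ?_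
  rw [← mul_add, add_comm]
  exact ((h.differentiableAt_velocity i t ht).hasDerivAt.inner ℝ (hv i)).const_mul _

theorem hasDerivAt_energy (h : M.IsSemiDiscreteSolution ν ω T du U P) {t : ℝ}
    (ht : t ∈ Ioo 0 T) :
    HasDerivAt (fun s => energy (U s))
      (∑ i, M.massL i * inner ℝ (deriv (fun s => U s i) t) (U t i)) t := by
  have h1 := (h.hasDerivAt_sum ht (v := U)
    (fun i => (h.differentiableAt_velocity i t ht).hasDerivAt)).const_mul (1 / 2 : ℝ)
  have h2 : (fun s => energy (U s)) = fun s =>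
      (1 / 2 : ℝ) * ∑ i, M.massL i * inner ℝ (U s i) (U s i) := by
    funext s; simp only [energy, real_inner_self_eq_norm_sq]
  rw [h2]
  refine h1.congr_deriv ?_
  simp only [real_inner_comm (deriv _ t)]
  ring

theorem deriv_energy_le (h : M.IsSemiDiscreteSolution ν ω T du U P) (hω : 0 ≤ ω) {t : ℝ}
    (ht : t ∈ Ioo 0 T) :
    ∑ i, M.massL i * inner ℝ (deriv (fun s => U s i) t) (U t i) ≤
      - (ν * gradSq (U t)) - (1 / 2) * lapSq (du t) (U t) :=
  energy_le hω (h.laplacian t ht) (h.discreteContinuity ht) (h.momentum t ht)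

/-- The viscous dissipation is controlled by the initial energy. -/
theorem integral_gradSq_le (h : M.IsSemiDiscreteSolution ν ω T du U P) (hω : 0 ≤ ω) (hT : 0 ≤ T)
    (hU : ∀ i, Continuous fun t => U t i) :
    ∫ t in 0..T, ν * gradSq (U t) ≤ energy (U 0) := by
  have hE : Continuous fun t => energy (U t) := by unfold energy; fun_prop
  have hg : Continuous fun t => -(ν * gradSq (U t)) :=
    ((continuous_gradSq hU).const_mul ν).neg
  have h1 := intervalIntegral.sub_le_integral_of_hasDeriv_right_of_le hT hE.continuousOn
    (fun t ht => (h.hasDerivAt_energy ht).hasDerivWithinAt)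
    (hg.continuousOn.integrableOn_Icc) (fun t ht => by
      have h2 := h.deriv_energy_le hω ht
      have h3 := (h.laplacian t ht).lapSq_nonneg (U t)
      linarith : ∀ t ∈ Ioo 0 T, _ ≤ -(ν * gradSq (U t)))
  rw [intervalIntegral.integral_neg] at h1
  have h4 := energy_nonneg (U T)
  linarith

/-- The weak form of the scheme, integrated in time. The artificial viscosity is absorbed into the
energy dissipation, so that no measurability of its coefficients in time is needed. -/
theorem abs_add_integral_le (h : M.IsSemiDiscreteSolution ν ω T du U P) (hν : 0 ≤ ν) (hω : 0 ≤ ω)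
    (hT : 0 ≤ T) (hU : ∀ i, Continuous fun t => U t i) (hP : ∀ i, Continuous fun t => P t i)
    {v v' : ℝ → M.Node → Euc d} (hv : ∀ i t, HasDerivAt (fun s => v s i) (v' t i) t)
    (hv' : ∀ i, Continuous fun t => v' t i) (hvT : ∀ i, v T i = 0) {B δ : ℝ} (hδ : 0 < δ)
    (hB : ∀ t ∈ Ioo 0 T, lapSq (du t) (v t) ≤ B) :
    |∑ i, M.massL i * inner ℝ (U 0 i) (v 0 i) +
      ∫ t in 0..T, schemeForm ν (U t) (P t) (v t) (v' t)| ≤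
        δ * energy (U 0) + (1 / 2) * δ⁻¹ * B * T := by
  set W : ℝ → ℝ := fun t => ∑ i, M.massL i * inner ℝ (U t i) (v t i) with hW
  set F : ℝ → ℝ := fun t => schemeForm ν (U t) (P t) (v t) (v' t) with hF
  have hvc : ∀ i, Continuous fun t => v t i := fun i =>
    continuous_iff_continuousAt.2 fun t => (hv i t).continuousAt
  have hWc : Continuous W := by fun_prop
  have hFc : Continuous F := by
    simp only [hF, schemeForm, convec]
    fun_prop
  have hE : Continuous fun t => energy (U t) := by unfold energy; fun_prop
  have hWT : W T = 0 := by
    simp only [hW, hvT, inner_zero_right, mul_zero, Finset.sum_const_zero]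
  have hET := energy_nonneg (U T)
  have hint : ∀ s : ℝ, ∫ t in 0..T, (s * F t + (1 / 2) * δ⁻¹ * B) =
      s * (∫ t in 0..T, F t) + (1 / 2) * δ⁻¹ * B * T := fun s => by
    rw [intervalIntegral.integral_add ((hFc.const_mul s).intervalIntegrable _ _)
      intervalIntegrable_const, intervalIntegral.integral_const_mul,
      intervalIntegral.integral_const]
    simp only [smul_eq_mul]; ring
  -- The sign `s` yields the two halves of the absolute value. The dissipation of the artificial
  -- viscosity, which may not be measurable in time, is absorbed by the derivative of the energy.
  have key : ∀ s : ℝ, (s = 1 ∨ s = -1) →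
      (s * W T + δ * energy (U T)) - (s * W 0 + δ * energy (U 0)) ≤
        s * (∫ t in 0..T, F t) + (1 / 2) * δ⁻¹ * B * T := by
    intro s hs
    rw [← hint]
    refine intervalIntegral.sub_le_integral_of_hasDeriv_right_of_le
      (g := fun t => s * W t + δ * energy (U t)) hT
      ((hWc.const_mul s).add (hE.const_mul δ)).continuousOn
      (fun t ht => (((h.hasDerivAt_sum ht (fun i => hv i t)).const_mul s).add
        ((h.hasDerivAt_energy ht).const_mul δ)).hasDerivWithinAt)
      ((hFc.const_mul s).add continuous_const).continuousOn.integrableOn_Icc fun t ht => ?_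
    have h1 := h.deriv_energy_le hω ht
    have h2 := (h.laplacian t ht).abs_sum_le (U t) (v t) hδ
    have h3 := sum_momentum (h.momentum t ht) (v t)
    have h4 := hB t ht
    have h5 := mul_nonneg hν (gradSq_nonneg (U t))
    have h6 : δ⁻¹ * lapSq (du t) (v t) ≤ δ⁻¹ * B :=
      mul_le_mul_of_nonneg_left h4 (inv_pos.2 hδ).le
    have h7 := mul_le_mul_of_nonneg_left h1 hδ.le
    have h8 := mul_nonneg hδ.le h5
    rw [h3]
    simp only [hF, schemeForm]
    rw [abs_le] at h2
    rcases hs with rfl | rfl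
    · nlinarith [h2.1, h2.2]
    · nlinarith [h2.1, h2.2]
  have k1 := key 1 (Or.inl rfl)
  have k2 := key (-1) (Or.inr rfl)
  rw [hWT] at k1 k2
  have h9 := mul_nonneg hδ.le hET
  show |W 0 + ∫ t in 0..T, F t| ≤ _
  rw [abs_le]
  constructor <;> linarith

end IsSemiDiscreteSolution

end PeriodicMesh

/-! ### Convergence of quadratic expressions in `L²` -/

section LTwo

variable {X : Type*} [MeasurableSpace X] {μ : Measure X}

/-- A real sequence tends to zero if it is bounded by small multiples of a constant and large
multiples of a null sequence. -/
theorem tendsto_zero_of_young {x e : ℕ → ℝ} {B : ℝ} (he : Tendsto e atTop (𝓝 0))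
    (h : ∀ δ > 0, ∃ C, ∀ᶠ n in atTop, |x n| ≤ δ * B + C * e n) : Tendsto x atTop (𝓝 0) := by
  rw [Metric.tendsto_atTop']
  intro η hη
  have hB : 0 < |B| + 1 := by positivity
  obtain ⟨C, hC⟩ := h (η / 2 / (|B| + 1)) (by positivity)
  have h1 : Tendsto (fun n => C * e n) atTop (𝓝 0) := by simpa using he.const_mul C
  have h2 := h1.eventually (gt_mem_nhds (half_pos hη))
  obtain ⟨N, hN⟩ := eventually_atTop.1 (hC.and h2)
  refine ⟨N, fun n hn => ?_⟩
  obtain ⟨h3, h4⟩ := hN n hn.le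
  rw [Real.dist_eq, sub_zero]
  have h5 : η / 2 / (|B| + 1) * B ≤ η / 2 := by
    rw [div_mul_eq_mul_div, div_le_iff₀ hB]
    exact mul_le_mul_of_nonneg_left ((le_abs_self B).trans (by linarith)) (half_pos hη).le
  linarith

variable {F : Type*} [NormedAddCommGroup F]

theorem BddMeas.memLp {f : X → F} (hf : BddMeas f) [IsFiniteMeasure μ] (p : ENNReal) :
    MemLp f p μ := by
  obtain ⟨C, hC⟩ := hf.bound
  exact MemLp.of_bound hf.1.aestronglyMeasurable C (Eventually.of_forall hC)

theorem MemLp.integrable_norm_sq {f : X → F} (hf : MemLp f 2 μ) :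
    Integrable (fun x => ‖f x‖ ^ 2) μ := (memLp_two_iff_integrable_sq_norm hf.1).1 hf

theorem integral_norm_sq_eq {f : X → F} (hf : MemLp f 2 μ) :
    ∫ x, ‖f x‖ ^ 2 ∂μ = (eLpNorm f 2 μ).toReal ^ 2 := by
  have h0 : 0 ≤ ∫ x, ‖f x‖ ^ 2 ∂μ := integral_nonneg fun _ => by positivity
  rw [hf.eLpNorm_eq_integral_rpow_norm two_ne_zero ENNReal.ofNat_ne_top,
    ENNReal.toReal_ofReal (by positivity)]
  simp only [ENNReal.toReal_ofNat, Real.rpow_two]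
  rw [← Real.rpow_natCast, ← Real.rpow_mul h0]
  norm_num

theorem tendsto_integral_norm_sq {f : ℕ → X → F} (hf : ∀ n, MemLp (f n) 2 μ)
    (h : Tendsto (fun n => eLpNorm (f n) 2 μ) atTop (𝓝 0)) :
    Tendsto (fun n => ∫ x, ‖f n x‖ ^ 2 ∂μ) atTop (𝓝 0) := by
  simp only [fun n => integral_norm_sq_eq (hf n)]
  have h1 := (ENNReal.tendsto_toReal ENNReal.zero_ne_top).comp h
  simpa using h1.pow 2

theorem integral_norm_sq_le_two_mul {f g : X → F} (hf : MemLp f 2 μ) (hg : MemLp g 2 μ) :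
    ∫ x, ‖f x‖ ^ 2 ∂μ ≤ 2 * (∫ x, ‖f x - g x‖ ^ 2 ∂μ) + 2 * ∫ x, ‖g x‖ ^ 2 ∂μ := by
  have h1 : Integrable (fun x => ‖f x - g x‖ ^ 2) μ := MemLp.integrable_norm_sq (hf.sub hg)
  have h2 := MemLp.integrable_norm_sq hg
  rw [← integral_const_mul, ← integral_const_mul, ← integral_add (h1.const_mul 2) (h2.const_mul 2)]
  refine integral_mono (MemLp.integrable_norm_sq hf) ((h1.const_mul 2).add (h2.const_mul 2))
    fun x => ?_
  have h3 := norm_add_le (f x - g x) (g x)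
  rw [sub_add_cancel] at h3
  have h4 := norm_nonneg (f x)
  show ‖f x‖ ^ 2 ≤ 2 * ‖f x - g x‖ ^ 2 + 2 * ‖g x‖ ^ 2
  nlinarith [sq_nonneg (‖f x - g x‖ - ‖g x‖)]

theorem exists_bound_integral_norm_sq {f : ℕ → X → F} {g : X → F} (hf : ∀ n, MemLp (f n) 2 μ)
    (hg : MemLp g 2 μ) (h : Tendsto (fun n => ∫ x, ‖f n x - g x‖ ^ 2 ∂μ) atTop (𝓝 0)) :
    ∃ C, 0 ≤ C ∧ ∀ n, ∫ x, ‖f n x‖ ^ 2 ∂μ ≤ C := by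
  obtain ⟨C, hC⟩ := h.bddAbove_range
  refine ⟨2 * C + 2 * ∫ x, ‖g x‖ ^ 2 ∂μ, ?_, fun n => ?_⟩
  · exact (integral_nonneg fun _ => by positivity : 0 ≤ ∫ x, ‖f 0 x‖ ^ 2 ∂μ).trans
      ((integral_norm_sq_le_two_mul (hf 0) hg).trans
        (by linarith [hC ⟨0, rfl⟩] ))
  · have h1 := integral_norm_sq_le_two_mul (hf n) hg
    have h2 : ∫ x, ‖f n x - g x‖ ^ 2 ∂μ ≤ C := hC ⟨n, rfl⟩
    linarith

theorem MemLp.exists_ae_bound {w : X → F} (hw : MemLp w ⊤ μ) : ∃ W, ∀ᵐ x ∂μ, ‖w x‖ ≤ W := by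
  refine ⟨(eLpNorm w ⊤ μ).toReal, ?_⟩
  filter_upwards [ae_le_eLpNormEssSup (f := w) (μ := μ)] with x hx
  rw [← toReal_enorm]
  exact ENNReal.toReal_mono hw.2.ne (by rwa [eLpNorm_exponent_top])

variable [InnerProductSpace ℝ F]

theorem integrable_inner_of_memLp_top [IsFiniteMeasure μ] {f w : X → F}
    (hf : MemLp f 2 μ) (hw : MemLp w ⊤ μ) :
    Integrable (fun x => inner ℝ (f x) (w x)) μ := by
  obtain ⟨W, hW⟩ := MemLp.exists_ae_bound hw
  refine Integrable.mono' ((hf.integrable one_le_two).norm.const_mul W)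
    (hf.1.inner hw.1) ?_
  filter_upwards [hW] with x hWx
  refine (norm_inner_le_norm _ _).trans ?_
  rw [mul_comm]
  exact mul_le_mul_of_nonneg_right hWx (norm_nonneg _)

theorem tendsto_integral_inner [IsFiniteMeasure μ] {f : ℕ → X → F} {g w : X → F}
    (hf : ∀ n, MemLp (f n) 2 μ)
    (hg : MemLp g 2 μ) (h : Tendsto (fun n => ∫ x, ‖f n x - g x‖ ^ 2 ∂μ) atTop (𝓝 0))
    (hw : MemLp w ⊤ μ) :
    Tendsto (fun n => ∫ x, inner ℝ (f n x) (w x) ∂μ) atTop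
      (𝓝 (∫ x, inner ℝ (g x) (w x) ∂μ)) := by
  obtain ⟨W, hW⟩ := MemLp.exists_ae_bound hw
  rw [← tendsto_sub_nhds_zero_iff]
  refine tendsto_zero_of_young (B := W * μ.real univ) h fun δ hδ => ⟨W * δ⁻¹,
    Eventually.of_forall fun n => ?_⟩
  have hi : Integrable (fun x => ‖f n x - g x‖ ^ 2) μ :=
    MemLp.integrable_norm_sq ((hf n).sub hg)
  rw [← integral_sub (integrable_inner_of_memLp_top (hf n) hw)
    (integrable_inner_of_memLp_top hg hw)]
  have h1 : δ * (W * μ.real univ) + W * δ⁻¹ * ∫ x, ‖f n x - g x‖ ^ 2 ∂μ =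
      ∫ x, (W * δ + W * δ⁻¹ * ‖f n x - g x‖ ^ 2) ∂μ := by
    rw [integral_add (integrable_const _) (hi.const_mul _), integral_const_mul (W * δ⁻¹),
      integral_const, smul_eq_mul]
    ring
  rw [h1]
  refine norm_integral_le_of_norm_le (G := ℝ) ((integrable_const _).add (hi.const_mul _))
    ?_
  filter_upwards [hW] with x hWx
  rw [← inner_sub_left]
  refine (norm_inner_le_norm _ _).trans ?_
  have hW0 := (norm_nonneg _).trans hWx
  have h2 := PeriodicMesh.mul_le_young hδ 1 ‖f n x - g x‖
  calc _ ≤ ‖f n x - g x‖ * W := mul_le_mul_of_nonneg_left hWx (norm_nonneg _)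
    _ ≤ W * (δ * 1 ^ 2 + δ⁻¹ * ‖f n x - g x‖ ^ 2) := by nlinarith
    _ = _ := by ring

theorem integrable_inner_clm {f : X → F} {A : X → F →L[ℝ] F} (hf : MemLp f 2 μ)
    (hA : MemLp A ⊤ μ) : Integrable (fun x => inner ℝ (f x) (A x (f x))) μ := by
  obtain ⟨L, hL⟩ := MemLp.exists_ae_bound hA
  have hm : AEStronglyMeasurable (fun x => A x (f x)) μ :=
    (isBoundedBilinearMap_apply (𝕜 := ℝ) (E := F) (F := F)).continuous.comp_aestronglyMeasurable
      (hA.1.prodMk hf.1)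
  refine Integrable.mono' ((MemLp.integrable_norm_sq hf).const_mul L) (hf.1.inner hm)
    ?_
  filter_upwards [hL] with x hLx
  refine (norm_inner_le_norm _ _).trans ?_
  have := mul_le_mul_of_nonneg_left (((A x).le_opNorm (f x)).trans
    (mul_le_mul_of_nonneg_right hLx (norm_nonneg _))) (norm_nonneg (f x))
  exact this.trans_eq (by ring)

theorem tendsto_integral_inner_clm {f : ℕ → X → F} {g : X → F} {A : X → F →L[ℝ] F}
    (hf : ∀ n, MemLp (f n) 2 μ) (hg : MemLp g 2 μ)
    (h : Tendsto (fun n => ∫ x, ‖f n x - g x‖ ^ 2 ∂μ) atTop (𝓝 0)) (hA : MemLp A ⊤ μ) :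
    Tendsto (fun n => ∫ x, inner ℝ (f n x) (A x (f n x)) ∂μ) atTop
      (𝓝 (∫ x, inner ℝ (g x) (A x (g x)) ∂μ)) := by
  obtain ⟨L, hL⟩ := MemLp.exists_ae_bound hA
  rw [← tendsto_sub_nhds_zero_iff]
  refine tendsto_zero_of_young (B := 2 * L * ∫ x, ‖g x‖ ^ 2 ∂μ) h fun δ hδ =>
    ⟨L * (1 + 2 * δ⁻¹), Eventually.of_forall fun n => ?_⟩
  have hi : Integrable (fun x => ‖f n x - g x‖ ^ 2) μ :=
    MemLp.integrable_norm_sq ((hf n).sub hg)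
  have hi' := MemLp.integrable_norm_sq hg
  rw [← integral_sub (integrable_inner_clm (hf n) hA) (integrable_inner_clm hg hA)]
  have h1 : δ * (2 * L * ∫ x, ‖g x‖ ^ 2 ∂μ) + L * (1 + 2 * δ⁻¹) * ∫ x, ‖f n x - g x‖ ^ 2 ∂μ =
      ∫ x, (2 * L * δ * ‖g x‖ ^ 2 + L * (1 + 2 * δ⁻¹) * ‖f n x - g x‖ ^ 2) ∂μ := by
    rw [integral_add (hi'.const_mul _) (hi.const_mul _), integral_const_mul, integral_const_mul]
    ring
  rw [h1]
  refine norm_integral_le_of_norm_le (G := ℝ) ((hi'.const_mul _).add (hi.const_mul _))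
    ?_
  filter_upwards [hL] with x hLx
  have hL0 := (norm_nonneg _).trans hLx
  set a := f n x - g x with ha
  have e1 : inner ℝ (f n x) (A x (f n x)) - inner ℝ (g x) (A x (g x)) =
      inner ℝ a (A x a) + inner ℝ a (A x (g x)) + inner ℝ (g x) (A x a) := by
    have : f n x = a + g x := by rw [ha, sub_add_cancel]
    rw [this]
    simp only [map_add, inner_add_left, inner_add_right]; ring
  have b : ∀ y z : F, ‖inner ℝ y (A x z)‖ ≤ L * (‖y‖ * ‖z‖) := fun y z => by
    refine (norm_inner_le_norm _ _).trans ?_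
    have := mul_le_mul_of_nonneg_left (((A x).le_opNorm z).trans
      (mul_le_mul_of_nonneg_right hLx (norm_nonneg z))) (norm_nonneg y)
    exact this.trans_eq (by ring)
  rw [e1]
  refine (norm_add₃_le).trans ?_
  have b1 := b a a
  have b2 := b a (g x)
  have b3 := b (g x) a
  have h2 := PeriodicMesh.mul_le_young hδ ‖g x‖ ‖a‖
  have h3 := mul_le_mul_of_nonneg_left h2 hL0
  show _ ≤ 2 * L * δ * ‖g x‖ ^ 2 + L * (1 + 2 * δ⁻¹) * ‖a‖ ^ 2
  nlinarith

end LTwo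

/-- A bounded sequence in a Hilbert space has a weak limit point, which is compatible with all
functionals along which the sequence converges. -/
theorem exists_weak_limit {H : Type*} [NormedAddCommGroup H] [InnerProductSpace ℝ H]
    [CompleteSpace H] {g : ℕ → H} {R : ℝ} (hg : ∀ n, ‖g n‖ ≤ R) :
    ∃ G : H, ∀ (φ : H) (a : ℝ), Tendsto (fun n => inner ℝ (g n) φ) atTop (𝓝 a) →
      inner ℝ G φ = a := by
  set ℓ : ℕ → WeakDual ℝ H := fun n =>
    StrongDual.toWeakDual (InnerProductSpace.toDual ℝ H (g n)) with hℓ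
  have hmem : ∀ n, ℓ n ∈ WeakDual.toStrongDual ⁻¹' Metric.closedBall (0 : StrongDual ℝ H) R := by
    intro n
    simp [hℓ, hg n]
  obtain ⟨y, -, hy⟩ := (WeakDual.isCompact_closedBall (𝕜 := ℝ) (0 : StrongDual ℝ H) R)
    (f := map ℓ atTop) (le_principal_iff.2 (mem_map.2 (Eventually.of_forall hmem)))
  refine ⟨(InnerProductSpace.toDual ℝ H).symm (WeakDual.toStrongDual y), fun φ a ha => ?_⟩
  rw [InnerProductSpace.toDual_symm_apply]
  have h1 : MapClusterPt (y φ) atTop (fun n => ℓ n φ) :=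
    MapClusterPt.continuousAt_comp (f := fun z : WeakDual ℝ H => z φ)
      (WeakDual.eval_continuous φ).continuousAt hy
  have h2 : Tendsto (fun n => ℓ n φ) atTop (𝓝 a) := ha
  have h3 : (𝓝 (y φ) ⊓ 𝓝 a).NeBot := h1.neBot.mono (inf_le_inf_left _ h2)
  exact eq_of_nhds_neBot h3

/-! ### Consistency of the scheme at a fixed time -/

/-- The componentwise Laplacian of a vector field. -/
def lap (v : Euc d → Euc d) (x : Euc d) : Euc d :=
  ∑ k, fderiv ℝ (fun y => fderiv ℝ v y (EuclideanSpace.single k 1)) x (EuclideanSpace.single k 1)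

/-- The integrand of the weak form of the momentum equation, after integration by parts of the
viscous term, with test function `v` and its time derivative `w`. -/
def weakForm (ν : ℝ) (u : Euc d → Euc d) (p : Euc d → ℝ) (v w : Euc d → Euc d) (x : Euc d) : ℝ :=
  inner ℝ (u x) (w x) + inner ℝ (u x) (fderiv ℝ v x (u x)) + ν * inner ℝ (u x) (lap v x) +
    p x * divergence v x

theorem ContDiff.fderiv_apply_const {F : Type*} [NormedAddCommGroup F] [NormedSpace ℝ F]
    {v : Euc d → F} (hv : ContDiff ℝ 2 v) (e : Euc d) :
    ContDiff ℝ 1 fun x => fderiv ℝ v x e :=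
  (hv.fderiv_right (m := 1) (by norm_num)).clm_apply contDiff_const

theorem IsPeriodic.fderiv_apply {F : Type*} [NormedAddCommGroup F] [NormedSpace ℝ F]
    {v : Euc d → F} (hv : IsPeriodic b v) (e : Euc d) :
    IsPeriodic b fun x => _root_.fderiv ℝ v x e := fun k x => by simp only [hv.fderiv k x]

theorem bddMeas_of_periodic {F : Type*} [NormedAddCommGroup F] {f : Euc d → F}
    (hf : Continuous f) (hp : IsPeriodic b f) : BddMeas f := by
  obtain ⟨C, -, hC⟩ := exists_bound_of_periodic (b := b) (f := fun _ : ℝ => f)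
    (hf.comp continuous_snd) (fun _ => hp) 0
  exact ⟨hf.stronglyMeasurable, C, hC 0 (by simp)⟩

namespace PeriodicMesh

variable {M : PeriodicMesh b} {V L ε σ : ℝ}

/-- The viscous term with both derivatives moved to the test function. -/
theorem sum_integral_feD (u : M.Node → Euc d) {v : Euc d → Euc d} (hv : ContDiff ℝ 2 v)
    (hp : IsPeriodic b v) :
    ∑ k, ∫ x in cell b, inner ℝ (feD u k x) (fderiv ℝ v x (EuclideanSpace.single k 1)) =
      - ∫ x in cell b, inner ℝ (M.fe u x) (lap v x) := by
  simp only [lap, inner_sum]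
  rw [integral_finsetSum, ← Finset.sum_neg_distrib]
  · exact Finset.sum_congr rfl fun k _ =>
      integral_feD_inner u k (ContDiff.fderiv_apply_const hv _) (hp.fderiv_apply _)
  · intro k _
    exact ((bddMeas_fe u).inner (bddMeas_of_periodic (b := b)
      (((ContDiff.fderiv_apply_const hv _).continuous_fderiv one_ne_zero).clm_apply
        continuous_const) ((hp.fderiv_apply _).fderiv_apply _))).integrable _

theorem bddMeas_inner_clm {X F : Type*} [MeasurableSpace X] [NormedAddCommGroup F]
    [InnerProductSpace ℝ F] {f : X → F} {A : X → F →L[ℝ] F} (hf : BddMeas f) (hA : BddMeas A) :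
    BddMeas fun x => inner ℝ (f x) (A x (f x)) := by
  refine hf.inner ?_
  obtain ⟨C, hC⟩ := hf.bound
  obtain ⟨L, hL⟩ := hA.bound
  exact ⟨(isBoundedBilinearMap_apply (𝕜 := ℝ) (E := F) (F := F)).continuous.comp_stronglyMeasurable
    (hA.1.prodMk hf.1), L * C, fun x => ((A x).le_opNorm _).trans
      (mul_le_mul (hL x) (hC x) (norm_nonneg _) ((norm_nonneg _).trans (hL x)))⟩

/-- Consistency of the scheme: on smooth test functions, the discrete weak form agrees with the
weak form of the equations up to multiples of the approximation error `δ` of the test functions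
and of the oscillations of velocity and pressure. -/
theorem exists_consistency_const (b : Module.Basis (Fin d) ℝ (Euc d)) {ν ω : ℝ} (hν : 0 ≤ ν)
    (hω : 0 ≤ ω) (hσ : 0 < σ) {V L : ℝ} (hV : 0 ≤ V) (hL : 0 ≤ L) :
    ∃ C, 0 ≤ C ∧ ∀ (M : PeriodicMesh b), M.IsRegular σ → ∀ (u : M.Node → Euc d) (p : M.Node → ℝ),
      DiscreteContinuity M ω u p → ∀ (v w : Euc d → Euc d) (δ : ℝ), 0 < δ → ContDiff ℝ 2 v →
      TestBounds M v V L δ → BddMeas w → IsPeriodic b w →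
      (∀ K : M.Elem, ∀ x ∈ body K, ∀ z ∈ body K, ‖w z - w x‖ ≤ δ) →
      |schemeForm ν u p (fun i => v i.1) (fun i => w i.1) -
        ∫ x in cell b, weakForm ν (M.fe u) (M.fe p) v w x| ≤
        C * (δ * (1 + nodalSq u + nodalSq p + ν * gradSq u) +
          δ⁻¹ * (nodalOsc u + nodalOsc p)) := by
  set vol := volume.real (cell b) with hvol
  have hvol0 : 0 ≤ vol := measureReal_nonneg
  refine ⟨((d + 1) * vol + 1) + (d + 1) * σ⁻¹ + (σ⁻¹ + 1) * L * (d + 1) + ω * V * (d + 1) +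
    (d + 1) * σ⁻¹ * (ν * (d * vol) + 1) + d * (d + 1) * σ⁻¹ * ((d + 1) * vol + 1) +
    (σ⁻¹ + 1) * L + ω * V, by positivity, ?_⟩
  intro M hM u p hc v w δ hδ hv2 hv hw hwp hη
  have h1 := abs_massL_sub_le u hw hwp hη
  have h2 := hc.abs_convec_le hω hσ hM hv hδ
  have h3 := abs_stiff_sub_le hσ hM hv u
  have h4 := abs_pressure_le hσ hM hv p
  rw [sum_integral_feD u hv2 hv.periodic] at h3
  have hb1 : Integrable (fun x => inner ℝ (M.fe u x) (w x)) (volume.restrict (cell b)) :=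
    ((bddMeas_fe u).inner hw).integrable _
  have hb2 : Integrable (fun x => inner ℝ (M.fe u x) (fderiv ℝ v x (M.fe u x)))
      (volume.restrict (cell b)) :=
    (bddMeas_inner_clm (bddMeas_fe u) hv.bddMeas_fderiv).integrable _
  have hb3 : Integrable (fun x => ν * inner ℝ (M.fe u x) (lap v x))
      (volume.restrict (cell b)) := by
    refine Integrable.const_mul (((bddMeas_fe u).inner ?_).integrable _) _
    exact BddMeas.sum _ fun k _ => bddMeas_of_periodic (b := b)
      (((ContDiff.fderiv_apply_const hv2 _).continuous_fderiv one_ne_zero).clm_apply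
        continuous_const) ((hv.periodic.fderiv_apply _).fderiv_apply _)
  have hb4 : Integrable (fun x => M.fe p x * divergence v x) (volume.restrict (cell b)) := by
    refine ((bddMeas_fe p).mul ?_).integrable _
    exact BddMeas.sum _ fun k _ => (hv.bddMeas_fderiv.clm ((EuclideanSpace.proj (𝕜 := ℝ) k).comp
        (ContinuousLinearMap.apply ℝ (Euc d) (EuclideanSpace.single k (1 : ℝ)))))
  have e1 : ∫ x in cell b, weakForm ν (M.fe u) (M.fe p) v w x =
      (∫ x in cell b, inner ℝ (M.fe u x) (w x)) +
      (∫ x in cell b, inner ℝ (M.fe u x) (fderiv ℝ v x (M.fe u x))) +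
      ν * (∫ x in cell b, inner ℝ (M.fe u x) (lap v x)) +
      ∫ x in cell b, M.fe p x * divergence v x := by
    simp only [weakForm]
    have h12 : Integrable (fun x => inner ℝ (M.fe u x) (w x) +
        inner ℝ (M.fe u x) (fderiv ℝ v x (M.fe u x))) (volume.restrict (cell b)) := hb1.add hb2
    rw [integral_add (h12.add hb3 : Integrable (fun x => _ + _) _) hb4, integral_add h12 hb3,
      integral_add hb1 hb2, integral_const_mul]
  rw [e1, schemeForm]
  have hNu := nodalSq_nonneg u
  have hNp := nodalSq_nonneg p
  have hOu := nodalOsc_nonneg u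
  have hOp := nodalOsc_nonneg p
  have hG := mul_nonneg hν (gradSq_nonneg u)
  set I1 := ∫ x in cell b, inner ℝ (M.fe u x) (w x)
  set I2 := ∫ x in cell b, inner ℝ (M.fe u x) (fderiv ℝ v x (M.fe u x))
  set I3 := ∫ x in cell b, inner ℝ (M.fe u x) (lap v x)
  set I4 := ∫ x in cell b, M.fe p x * divergence v x
  set S1 := ∑ i, M.massL i * inner ℝ (u i) (w i.1)
  set S2 := ∑ i, ∑ j, M.convec u i j * inner ℝ (u j) (v i.1)
  set S3 := ∑ i, ∑ j, M.stiff i j * inner ℝ (u j) (v i.1)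
  set S4 := ∑ i, ∑ j, p j * inner ℝ (M.gradC i j) (v i.1)
  set N := 1 + nodalSq u + nodalSq p + ν * gradSq u with hN
  set O := nodalOsc u + nodalOsc p with hO
  have e2 : S1 - S2 - ν * S3 - S4 - (I1 + I2 + ν * I3 + I4) =
      (S1 - I1) - (S2 + I2) - ν * (S3 - -I3) - (S4 + I4) := by ring
  rw [e2]
  have hδi : 0 < δ⁻¹ := inv_pos.2 hδ
  have hσi : 0 < σ⁻¹ := inv_pos.2 hσ
  have h3' : |ν * (S3 - -I3)| ≤ (d + 1) * σ⁻¹ * (ν * (d * vol) + 1) * (δ * N) := by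
    rw [abs_mul, abs_of_nonneg hν]
    calc ν * |S3 - -I3| ≤ ν * ((d + 1) * σ⁻¹ * δ * (d * vol + gradSq u)) :=
          mul_le_mul_of_nonneg_left h3 hν
      _ = (d + 1) * σ⁻¹ * δ * (ν * (d * vol) * 1 + 1 * (ν * gradSq u)) := by ring
      _ ≤ (d + 1) * σ⁻¹ * δ * (ν * (d * vol) * N + 1 * N) := by
          gcongr <;> linarith
      _ = _ := by ring
  have h1' : |S1 - I1| ≤ ((d + 1) * vol + 1) * (δ * N) := by
    refine h1.trans ?_
    calc δ * ((d + 1) * vol + nodalSq u) = δ * ((d + 1) * vol * 1 + nodalSq u) := by ring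
      _ ≤ δ * ((d + 1) * vol * N + N) := by gcongr <;> linarith
      _ = _ := by ring
  have h4' : |S4 + I4| ≤ d * (d + 1) * σ⁻¹ * ((d + 1) * vol + 1) * (δ * N) := by
    refine h4.trans ?_
    calc d * (d + 1) * σ⁻¹ * δ * ((d + 1) * vol + nodalSq p)
        = d * (d + 1) * σ⁻¹ * δ * ((d + 1) * vol * 1 + nodalSq p) := by ring
      _ ≤ d * (d + 1) * σ⁻¹ * δ * ((d + 1) * vol * N + N) := by gcongr <;> linarith
      _ = _ := by ring
  have h2' : |S2 + I2| ≤ ((d + 1) * σ⁻¹ + (σ⁻¹ + 1) * L * (d + 1) + ω * V * (d + 1)) * (δ * N) +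
      ((σ⁻¹ + 1) * L + ω * V) * (δ⁻¹ * O) := by
    refine h2.trans ?_
    calc (d + 1) * σ⁻¹ * δ * nodalSq u +
        (σ⁻¹ + 1) * L * ((d + 1) * δ * nodalSq u + δ⁻¹ * nodalOsc u) +
        ω * V * ((d + 1) * δ * nodalSq u + δ⁻¹ * nodalOsc p)
        ≤ (d + 1) * σ⁻¹ * δ * N + (σ⁻¹ + 1) * L * ((d + 1) * δ * N + δ⁻¹ * O) +
        ω * V * ((d + 1) * δ * N + δ⁻¹ * O) := by gcongr <;> linarith
      _ = _ := by ring
  have hX : 0 ≤ δ * N := by positivity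
  have hY : 0 ≤ δ⁻¹ * O := by positivity
  have habs : |S1 - I1 - (S2 + I2) - ν * (S3 - -I3) - (S4 + I4)| ≤
      |S1 - I1| + |S2 + I2| + |ν * (S3 - -I3)| + |S4 + I4| := by
    refine (abs_sub _ _).trans (add_le_add ((abs_sub _ _).trans (add_le_add (abs_sub _ _) le_rfl))
      le_rfl)
  refine habs.trans ((add_le_add (add_le_add (add_le_add h1' h2') h3') h4').trans ?_)
  have t1 : 0 ≤ (((d + 1) * vol + 1) + (d + 1) * σ⁻¹ + (σ⁻¹ + 1) * L * (d + 1) + ω * V * (d + 1) +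
    (d + 1) * σ⁻¹ * (ν * (d * vol) + 1) + d * (d + 1) * σ⁻¹ * ((d + 1) * vol + 1)) *
      (δ⁻¹ * O) := by positivity
  have t2 : 0 ≤ ((σ⁻¹ + 1) * L + ω * V) * (δ * N) := by positivity
  linarith

end PeriodicMesh

/-! ### Regular families of meshes -/

theorem exists_isRegular {M : ℕ → PeriodicMesh b} (h : ShapeRegular M) :
    ∃ σ > 0, ∀ n, (M n).IsRegular σ := by
  obtain ⟨σ, hσ, h⟩ := h
  exact ⟨σ, hσ, fun n K => h n K.1 K.2⟩

/-- In two space dimensions, or for quasi-uniform meshes in three, the artificial viscosity is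
asymptotically small. -/
theorem exists_viscosity_const (hd : d = 2 ∨ d = 3) {M : ℕ → PeriodicMesh b} {σ : ℝ} (hσ : 0 < σ)
    (hM : ∀ n, (M n).IsRegular σ) (hq : d = 3 → QuasiUniform M) :
    ∃ κ, ∀ n, ∀ K : (M n).Elem,
      (M n).meshSize ^ (d - 1) * Metric.diam (PeriodicMesh.body K) ^ 2 ≤
        κ * (M n).meshSize * volume.real (PeriodicMesh.body K) := by
  set c := σ ^ d * volume.real (Metric.ball (0 : Euc d) 1) with hc
  have hc0 : 0 < c := by
    have : 0 < volume.real (Metric.ball (0 : Euc d) 1) :=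
      ENNReal.toReal_pos (Metric.measure_ball_pos _ _ one_pos).ne' measure_ball_lt_top.ne
    positivity
  have hd0 : 0 < d := by omega
  have key : ∀ n, ∀ K : (M n).Elem, Metric.diam (PeriodicMesh.body K) ^ d ≤
      c⁻¹ * volume.real (PeriodicMesh.body K) := fun n K => by
    rw [le_inv_mul_iff₀ hc0]
    exact PeriodicMesh.IsRegular.le_volume hd0 hσ (hM n) K
  rcases hd with rfl | rfl
  · refine ⟨c⁻¹, fun n K => ?_⟩
    calc _ = (M n).meshSize * Metric.diam (PeriodicMesh.body K) ^ 2 := by norm_num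
      _ ≤ (M n).meshSize * (c⁻¹ * volume.real (PeriodicMesh.body K)) :=
        mul_le_mul_of_nonneg_left (key n K) (PeriodicMesh.meshSize_nonneg _)
      _ = _ := by ring
  · obtain ⟨κ, hκ, hq⟩ := hq rfl
    refine ⟨κ⁻¹ * c⁻¹, fun n K => ?_⟩
    have h1 : (M n).meshSize ≤ κ⁻¹ * Metric.diam (PeriodicMesh.body K) := by
      rw [le_inv_mul_iff₀ hκ]; exact hq n K.1 K.2
    have h0 : 0 ≤ (M n).meshSize := PeriodicMesh.meshSize_nonneg _
    have hD : 0 ≤ Metric.diam (PeriodicMesh.body K) := Metric.diam_nonneg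
    calc _ = (M n).meshSize * Metric.diam (PeriodicMesh.body K) ^ 2 * (M n).meshSize := by
          norm_num; ring
      _ ≤ (M n).meshSize * Metric.diam (PeriodicMesh.body K) ^ 2 *
          (κ⁻¹ * Metric.diam (PeriodicMesh.body K)) := by gcongr
      _ = (M n).meshSize * κ⁻¹ * Metric.diam (PeriodicMesh.body K) ^ 3 := by ring
      _ ≤ (M n).meshSize * κ⁻¹ * (c⁻¹ * volume.real (PeriodicMesh.body K)) := by
          gcongr; exact key n K
      _ = _ := by ring

/-! ### Functions on the space-time cylinder -/

instance (T : ℝ) : IsFiniteMeasure (cylinder b T) := by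
  unfold cylinder; infer_instance

theorem ae_cylinder (b : Module.Basis (Fin d) ℝ (Euc d)) (T : ℝ) :
    ∀ᵐ z ∂(cylinder b T), z.1 ∈ Ioo 0 T := by
  have h : ∀ᵐ t ∂(volume.restrict (Ioo 0 T)), t ∈ Ioo 0 T := ae_restrict_mem measurableSet_Ioo
  exact Measure.quasiMeasurePreserving_fst.ae h

theorem integral_cylinder {T : ℝ} (hT : 0 ≤ T) {F : Type*} [NormedAddCommGroup F]
    [NormedSpace ℝ F] {f : ℝ × Euc d → F} (hf : Integrable f (cylinder b T)) :
    ∫ z, f z ∂(cylinder b T) = ∫ t in 0..T, ∫ x in cell b, f (t, x) := by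
  rw [intervalIntegral.integral_of_le hT, integral_Ioc_eq_integral_Ioo]
  exact integral_prod f hf

theorem BddMeas.comp {X Y F : Type*} [MeasurableSpace X] [MeasurableSpace Y]
    [NormedAddCommGroup F] {f : X → F} (hf : BddMeas f) {g : Y → X} (hg : Measurable g) :
    BddMeas fun y => f (g y) := by
  obtain ⟨C, hC⟩ := hf.bound
  exact ⟨hf.1.comp_measurable hg, C, fun y => hC _⟩

/-- The projection of the time axis to `[0,T]`. -/
def clamp (T t : ℝ) : ℝ := max 0 (min t T)

theorem continuous_clamp (T : ℝ) : Continuous (clamp T) := by unfold clamp; fun_prop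

theorem clamp_mem {T : ℝ} (hT : 0 ≤ T) (t : ℝ) : clamp T t ∈ Icc 0 T :=
  ⟨le_max_left _ _, max_le hT (min_le_right _ _)⟩

theorem clamp_eq {T t : ℝ} (ht : t ∈ Icc 0 T) : clamp T t = t := by
  rw [clamp, min_eq_left ht.2, max_eq_right ht.1]

section Slices

variable {F : Type*} [NormedAddCommGroup F] [NormedSpace ℝ F] {f : ℝ → Euc d → F}

theorem fderiv_slice (hf : Differentiable ℝ fun z : ℝ × Euc d => f z.1 z.2) (t : ℝ) (x : Euc d) :
    fderiv ℝ (f t) x = (fderiv ℝ (fun z : ℝ × Euc d => f z.1 z.2) (t, x)).comp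
      (ContinuousLinearMap.inr ℝ ℝ (Euc d)) := by
  have h := (hf (t, x)).hasFDerivAt.comp x (hasFDerivAt_prodMk_right t x)
  exact h.fderiv

theorem hasDerivAt_slice (hf : Differentiable ℝ fun z : ℝ × Euc d => f z.1 z.2) (t : ℝ)
    (x : Euc d) : HasDerivAt (fun s => f s x) (deriv (fun s => f s x) t) t := by
  have h := ((hf (t, x)).hasFDerivAt.comp t (hasFDerivAt_prodMk_left t x)).hasDerivAt
  exact (HasDerivAt.differentiableAt h).hasDerivAt

theorem deriv_slice (hf : Differentiable ℝ fun z : ℝ × Euc d => f z.1 z.2) (t : ℝ) (x : Euc d) :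
    deriv (fun s => f s x) t = fderiv ℝ (fun z : ℝ × Euc d => f z.1 z.2) (t, x) (1, 0) := by
  have h := ((hf (t, x)).hasFDerivAt.comp t (hasFDerivAt_prodMk_left t x)).hasDerivAt
  exact h.deriv.trans (by simp)

theorem contDiff_fderiv_slice {m n : WithTop ℕ∞} (hmn : m + 1 ≤ n)
    (hf : ContDiff ℝ n fun z : ℝ × Euc d => f z.1 z.2) :
    ContDiff ℝ m fun z : ℝ × Euc d => fderiv ℝ (f z.1) z.2 := by
  have h0 : n ≠ 0 := by
    rintro rfl
    simp at hmn
  have h1 : (fun z : ℝ × Euc d => fderiv ℝ (f z.1) z.2) = fun z =>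
      (fderiv ℝ (fun z : ℝ × Euc d => f z.1 z.2) z).comp (ContinuousLinearMap.inr ℝ ℝ (Euc d)) :=
    funext fun z => fderiv_slice (hf.differentiable h0) z.1 z.2
  rw [h1]
  exact (hf.fderiv_right hmn).clm_comp contDiff_const

theorem contDiff_deriv_slice {m n : WithTop ℕ∞} (hmn : m + 1 ≤ n)
    (hf : ContDiff ℝ n fun z : ℝ × Euc d => f z.1 z.2) :
    ContDiff ℝ m fun z : ℝ × Euc d => deriv (fun s => f s z.2) z.1 := by
  have h0 : n ≠ 0 := by
    rintro rfl
    simp at hmn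
  have h1 : (fun z : ℝ × Euc d => deriv (fun s => f s z.2) z.1) = fun z =>
      fderiv ℝ (fun z : ℝ × Euc d => f z.1 z.2) z (1, 0) :=
    funext fun z => deriv_slice (hf.differentiable h0) z.1 z.2
  rw [h1]
  exact (hf.fderiv_right hmn).clm_apply contDiff_const

theorem IsPeriodic.deriv_slice (hp : ∀ t, IsPeriodic b (f t)) (t : ℝ) :
    IsPeriodic b fun x => _root_.deriv (fun s => f s x) t := fun k x => by
  simp only [fun s => hp s k x]

theorem contDiff_slice {n : WithTop ℕ∞} (hf : ContDiff ℝ n fun z : ℝ × Euc d => f z.1 z.2)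
    (t : ℝ) : ContDiff ℝ n (f t) := hf.comp (contDiff_prodMk_right t)

/-- Smooth periodic functions are approximated to first order on the simplices of fine meshes,
uniformly in time. -/
theorem exists_testBounds (hf : ContDiff ℝ 1 fun z : ℝ × Euc d => f z.1 z.2)
    (hp : ∀ t, IsPeriodic b (f t)) (T : ℝ) :
    ∃ V L : ℝ, 0 ≤ V ∧ 0 ≤ L ∧ ∀ ε > 0, ∃ δ > 0, ∀ M : PeriodicMesh b, M.meshSize ≤ δ →
      ∀ t ∈ Icc 0 T, PeriodicMesh.TestBounds M (f t) V L ε := by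
  have hf' := (contDiff_fderiv_slice (m := 0) (by norm_num) hf).continuous
  obtain ⟨V, hV0, hV⟩ := exists_bound_of_periodic hf.continuous hp T
  obtain ⟨L, hL0, hL⟩ := exists_bound_of_periodic hf' (fun t => (hp t).fderiv) T
  refine ⟨V, L, hV0, hL0, fun ε hε => ?_⟩
  obtain ⟨δ, hδ, hm⟩ := exists_modulus_of_periodic hf' (fun t => (hp t).fderiv) T hε
  refine ⟨δ, hδ, fun M hM t ht => ⟨contDiff_slice hf t, hp t, hε.le, hV t ht, hL t ht, ?_⟩⟩
  intro K x hx z hz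
  exact (PeriodicMesh.convex_body K).norm_image_sub_le_of_norm_fderiv_le' (𝕜 := ℝ)
    (fun y _ => (contDiff_slice hf t).differentiable one_ne_zero y)
    (fun y hy => hm t ht x y ((PeriodicMesh.norm_sub_le_meshSize hy hx).trans hM)) hx hz

end Slices

/-! ### Finite element functions in space-time -/

namespace PeriodicMesh

variable {M : PeriodicMesh b}

variable {F : Type*} [NormedAddCommGroup F] [NormedSpace ℝ F] {c : ℝ → M.Node → F}

theorem bddMeas_fe_time (hc : ∀ i, BddMeas fun t => c t i) :
    BddMeas fun z : ℝ × Euc d => M.fe (c z.1) z.2 :=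
  BddMeas.sum _ fun i _ => ((bddMeas_basisFun i).comp measurable_snd).smul
    ((hc i).comp measurable_fst)

theorem bddMeas_feD_time (hc : ∀ i, BddMeas fun t => c t i) (k : Fin d) :
    BddMeas fun z : ℝ × Euc d => feD (c z.1) k z.2 :=
  BddMeas.sum _ fun i _ => ((bddMeas_fderiv_basisFun i _).comp measurable_snd).smul
    ((hc i).comp measurable_fst)

theorem integral_nodalSq_le {T : ℝ} (hT : 0 ≤ T) (hc : ∀ i, Continuous fun t => c t i)
    (hcb : ∀ i, BddMeas fun t => c t i) :
    ∫ t in 0..T, nodalSq (c t) ≤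
      (d + 1) * (8 * 2 ^ d + 2) * ∫ z, ‖M.fe (c z.1) z.2‖ ^ 2 ∂(cylinder b T) := by
  have hb := ((bddMeas_fe_time hcb).norm.pow 2).integrable (cylinder b T)
  rw [integral_cylinder hT hb, ← intervalIntegral.integral_const_mul]
  refine intervalIntegral.integral_mono_on hT ((continuous_nodalSq hc).intervalIntegrable _ _) ?_
    fun t _ => nodalSq_le (c t)
  rw [intervalIntegrable_iff_integrableOn_Ioo_of_le hT]
  exact hb.integral_prod_left.const_mul _

/-- The oscillation of the nodal values is controlled by the distance to any function that
varies little on the simplices. -/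
theorem integral_nodalOsc_le {T : ℝ} (hT : 0 ≤ T) (hc : ∀ i, Continuous fun t => c t i)
    (hcb : ∀ i, BddMeas fun t => c t i) {g : ℝ → Euc d → F}
    (hg : BddMeas fun z : ℝ × Euc d => g z.1 z.2) (hgp : ∀ t, IsPeriodic b (g t)) {ε : ℝ}
    (hε : ∀ t, ∀ K : M.Elem, ∀ x ∈ body K, ∀ z ∈ body K, ‖g t x - g t z‖ ≤ ε) :
    ∫ t in 0..T, nodalOsc (c t) ≤ 8 * (d + 1) ^ 2 * (8 * 2 ^ d + 2) *
      ((∫ z, ‖M.fe (c z.1) z.2 - g z.1 z.2‖ ^ 2 ∂(cylinder b T)) +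
        T * (ε ^ 2 * volume.real (cell b))) := by
  have hb := (((bddMeas_fe_time hcb).sub hg).norm.pow 2).integrable (cylinder b T)
  have hi : IntervalIntegrable (fun t => ∫ x in cell b, ‖M.fe (c t) x - g t x‖ ^ 2) volume 0 T := by
    rw [intervalIntegrable_iff_integrableOn_Ioo_of_le hT]
    exact hb.integral_prod_left
  have e1 : (∫ z, ‖M.fe (c z.1) z.2 - g z.1 z.2‖ ^ 2 ∂(cylinder b T)) +
        T * (ε ^ 2 * volume.real (cell b)) = ∫ t in 0..T,
      ((∫ x in cell b, ‖M.fe (c t) x - g t x‖ ^ 2) + ε ^ 2 * volume.real (cell b)) := by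
    rw [integral_cylinder hT hb, intervalIntegral.integral_add hi intervalIntegrable_const,
      intervalIntegral.integral_const, sub_zero, smul_eq_mul]
  rw [e1, ← intervalIntegral.integral_const_mul]
  refine intervalIntegral.integral_mono_on hT ((continuous_nodalOsc hc).intervalIntegrable _ _)
    ((hi.add intervalIntegrable_const).const_mul _) fun t _ => ?_
  exact nodalOsc_le (c t) (hg.comp (measurable_prodMk_left (x := t))) (hgp t) (hε t)

theorem exists_lipschitz_fe (hcb : ∀ i, BddMeas fun t => c t i) :
    ∃ L, 0 ≤ L ∧ ∀ t x z, ‖M.fe (c t) x - M.fe (c t) z‖ ≤ L * ‖x - z‖ := by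
  obtain ⟨C, hC0, hC⟩ := M.exists_lipschitz_basisFun
  choose B hB using fun i => (hcb i).bound
  have hB0 : ∀ i, 0 ≤ B i := fun i => (norm_nonneg _).trans (hB i 0)
  refine ⟨∑ i, C * B i, Finset.sum_nonneg fun i _ => mul_nonneg hC0 (hB0 i), fun t x z => ?_⟩
  rw [fe, fe, ← Finset.sum_sub_distrib, Finset.sum_mul]
  refine (norm_sum_le _ _).trans (Finset.sum_le_sum fun i _ => ?_)
  rw [← sub_smul, norm_smul, mul_right_comm]
  exact mul_le_mul (hC i z x) (hB i t) (norm_nonneg _) (by positivity)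

end PeriodicMesh

/-- If a sequence of finite element functions on a sequence of refined meshes converges in `L²`,
then its oscillation on the simplices tends to zero: the members of the sequence are compared with
a fixed member, which is Lipschitz continuous in space. -/
theorem tendsto_integral_nodalOsc {F : Type*} [NormedAddCommGroup F] [NormedSpace ℝ F]
    {M : ℕ → PeriodicMesh b} (hmesh : Tendsto (fun n => (M n).meshSize) atTop (𝓝 0))
    {T : ℝ} (hT : 0 ≤ T) {c : (n : ℕ) → ℝ → (M n).Node → F}
    (hc : ∀ n i, Continuous fun t => c n t i) (hcb : ∀ n i, BddMeas fun t => c n t i)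
    {g : ℝ × Euc d → F} (hg : MemLp g 2 (cylinder b T))
    (h : Tendsto (fun n => ∫ z, ‖(M n).fe (c n z.1) z.2 - g z‖ ^ 2 ∂(cylinder b T)) atTop (𝓝 0)) :
    Tendsto (fun n => ∫ t in 0..T, PeriodicMesh.nodalOsc (c n t)) atTop (𝓝 0) := by
  set A : ℝ := 8 * (d + 1) ^ 2 * (8 * 2 ^ d + 2) with hA
  have hA0 : 0 < A := by positivity
  rw [Metric.tendsto_atTop']
  intro η hη
  set θ := η / (A * 6) with hθ
  have hθ0 : 0 < θ := by positivity
  have hmem : ∀ n, MemLp (fun z : ℝ × Euc d => (M n).fe (c n z.1) z.2) 2 (cylinder b T) := fun n =>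
    (PeriodicMesh.bddMeas_fe_time (hcb n)).memLp 2
  obtain ⟨m, hm⟩ := (h.eventually (gt_mem_nhds hθ0)).exists
  obtain ⟨L, hL0, hL⟩ := PeriodicMesh.exists_lipschitz_fe (hcb m)
  have h1 : Tendsto (fun n => T * ((L * (M n).meshSize) ^ 2 * volume.real (cell b))) atTop
      (𝓝 0) := by
    have := (((hmesh.const_mul L).pow 2).mul_const (volume.real (cell b))).const_mul T
    simpa using this
  obtain ⟨N, hN⟩ := eventually_atTop.1
    ((h.eventually (gt_mem_nhds hθ0)).and (h1.eventually (gt_mem_nhds hθ0)))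
  refine ⟨N, fun n hn => ?_⟩
  obtain ⟨h2, h3⟩ := hN n hn.le
  have h0 : 0 ≤ ∫ t in 0..T, PeriodicMesh.nodalOsc (c n t) :=
    intervalIntegral.integral_nonneg hT fun t _ => PeriodicMesh.nodalOsc_nonneg _
  rw [Real.dist_eq, sub_zero, abs_of_nonneg h0]
  have h4 := PeriodicMesh.integral_nodalOsc_le hT (hc n) (hcb n)
    (PeriodicMesh.bddMeas_fe_time (hcb m)) (fun t => PeriodicMesh.periodic_fe (c m t))
    (ε := L * (M n).meshSize) (fun t K x hx z hz => (hL t x z).trans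
      (mul_le_mul_of_nonneg_left (PeriodicMesh.norm_sub_le_meshSize hx hz) hL0))
  have h5 := integral_norm_sq_le_two_mul ((hmem n).sub (hmem m)) ((hmem n).sub hg)
  simp only [Pi.sub_apply, sub_sub_sub_cancel_left, norm_sub_rev (g _)] at h5
  refine h4.trans_lt ?_
  calc _ < A * (2 * θ + 2 * θ + θ) := by
        refine mul_lt_mul_of_pos_left ?_ hA0
        linarith
    _ ≤ A * (6 * θ) := by nlinarith
    _ = η := by rw [hθ]; field_simp

/-! ### Passage to the limit in the weak form -/

theorem memLp_top_of_periodic {F : Type*} [NormedAddCommGroup F] {f : ℝ → Euc d → F}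
    (hf : Continuous fun z : ℝ × Euc d => f z.1 z.2) (hp : ∀ t, IsPeriodic b (f t)) (T : ℝ) :
    MemLp (fun z : ℝ × Euc d => f z.1 z.2) ⊤ (cylinder b T) := by
  obtain ⟨C, -, hC⟩ := exists_bound_of_periodic hf hp T
  refine memLp_top_of_bound hf.stronglyMeasurable.aestronglyMeasurable C ?_
  filter_upwards [ae_cylinder b T] with z hz
  exact hC _ (Ioo_subset_Icc_self hz) _

theorem continuous_lap_slice {v : ℝ → Euc d → Euc d}
    (hv : ContDiff ℝ 2 fun z : ℝ × Euc d => v z.1 z.2) :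
    Continuous fun z : ℝ × Euc d => lap (v z.1) z.2 := by
  refine continuous_finsetSum _ fun k _ => ?_
  have h1 : ContDiff ℝ 1 fun z : ℝ × Euc d =>
      fderiv ℝ (v z.1) z.2 (EuclideanSpace.single k (1 : ℝ)) :=
    (contDiff_fderiv_slice (m := 1) (by norm_num) hv).clm_apply contDiff_const
  exact ((contDiff_fderiv_slice (m := 0) (n := 1)
    (f := fun t x => fderiv ℝ (v t) x (EuclideanSpace.single k (1 : ℝ))) (by norm_num)
    h1).clm_apply contDiff_const).continuous

theorem IsPeriodic.lap {v : Euc d → Euc d} (hv : IsPeriodic b v) :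
    IsPeriodic b (PeriodicFEM.lap v) := fun k x => Finset.sum_congr rfl fun j _ =>
  (hv.fderiv_apply (EuclideanSpace.single j 1)).fderiv_apply (EuclideanSpace.single j 1) k x

theorem contDiff_pderiv_slice {v : ℝ → Euc d → Euc d}
    (hv : ContDiff ℝ 2 fun z : ℝ × Euc d => v z.1 z.2) (i j : Fin d) :
    ContDiff ℝ 1 fun z : ℝ × Euc d => pderiv (v z.1) z.2 i j := by
  have h1 : ContDiff ℝ 1 fun z : ℝ × Euc d =>
      fderiv ℝ (v z.1) z.2 (EuclideanSpace.single j (1 : ℝ)) :=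
    (contDiff_fderiv_slice (m := 1) (by norm_num) hv).clm_apply contDiff_const
  exact (EuclideanSpace.proj (𝕜 := ℝ) i).contDiff.comp h1

theorem IsPeriodic.pderiv {v : Euc d → Euc d} (hv : IsPeriodic b v) (i j : Fin d) :
    IsPeriodic b fun x => PeriodicFEM.pderiv v x i j := fun k x => by
  simp only [PeriodicFEM.pderiv, hv.fderiv k x]

namespace IsTestField

variable {T : ℝ} {v : ℝ → Euc d → Euc d}

theorem memLp_deriv (h : IsTestField b T v) :
    MemLp (fun z : ℝ × Euc d => deriv (fun s => v s z.2) z.1) ⊤ (cylinder b T) :=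
  memLp_top_of_periodic (f := fun t x => deriv (fun s => v s x) t)
    (contDiff_deriv_slice (m := 0) (by norm_num) h.contDiff).continuous
    (fun t => IsPeriodic.deriv_slice h.periodic t) T

theorem memLp_fderiv (h : IsTestField b T v) :
    MemLp (fun z : ℝ × Euc d => fderiv ℝ (v z.1) z.2) ⊤ (cylinder b T) :=
  memLp_top_of_periodic (f := fun t x => fderiv ℝ (v t) x)
    (contDiff_fderiv_slice (m := 0) (by norm_num) h.contDiff).continuous
    (fun t => (h.periodic t).fderiv) T

theorem memLp_lap (h : IsTestField b T v) :
    MemLp (fun z : ℝ × Euc d => lap (v z.1) z.2) ⊤ (cylinder b T) :=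
  memLp_top_of_periodic (f := fun t x => lap (v t) x) (continuous_lap_slice h.contDiff)
    (fun t => (h.periodic t).lap) T

theorem memLp_divergence (h : IsTestField b T v) :
    MemLp (fun z : ℝ × Euc d => divergence (v z.1) z.2) ⊤ (cylinder b T) :=
  memLp_top_of_periodic (f := fun t x => divergence (v t) x)
    (continuous_finsetSum _ fun k _ => (contDiff_pderiv_slice h.contDiff k k).continuous)
    (fun t k x => Finset.sum_congr rfl fun j _ => (h.periodic t).pderiv j j k x) T

variable {ν : ℝ}

theorem integrable_weakForm (h : IsTestField b T v) {u : ℝ → Euc d → Euc d} {p : ℝ → Euc d → ℝ}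
    (hu : MemLp (fun z : ℝ × Euc d => u z.1 z.2) 2 (cylinder b T))
    (hp : MemLp (fun z : ℝ × Euc d => p z.1 z.2) 2 (cylinder b T)) :
    Integrable (fun z : ℝ × Euc d =>
      weakForm ν (u z.1) (p z.1) (v z.1) (fun x => deriv (fun s => v s x) z.1) z.2)
      (cylinder b T) := by
  have h4 := integrable_inner_of_memLp_top hp h.memLp_divergence
  simp only [RCLike.inner_apply, conj_trivial, mul_comm] at h4
  exact (((integrable_inner_of_memLp_top hu h.memLp_deriv).add
    (integrable_inner_clm hu h.memLp_fderiv)).add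
    ((integrable_inner_of_memLp_top hu h.memLp_lap).const_mul ν)).add h4

theorem integral_weakForm (h : IsTestField b T v) {u : ℝ → Euc d → Euc d} {p : ℝ → Euc d → ℝ}
    (hu : MemLp (fun z : ℝ × Euc d => u z.1 z.2) 2 (cylinder b T))
    (hp : MemLp (fun z : ℝ × Euc d => p z.1 z.2) 2 (cylinder b T)) :
    ∫ z, weakForm ν (u z.1) (p z.1) (v z.1) (fun x => deriv (fun s => v s x) z.1) z.2
      ∂(cylinder b T) =
    (∫ z, inner ℝ (u z.1 z.2) (deriv (fun s => v s z.2) z.1) ∂(cylinder b T)) +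
    (∫ z, inner ℝ (u z.1 z.2) (fderiv ℝ (v z.1) z.2 (u z.1 z.2)) ∂(cylinder b T)) +
    ν * (∫ z, inner ℝ (u z.1 z.2) (lap (v z.1) z.2) ∂(cylinder b T)) +
    ∫ z, inner ℝ (p z.1 z.2) (divergence (v z.1) z.2) ∂(cylinder b T) := by
  have h1 := integrable_inner_of_memLp_top hu h.memLp_deriv
  have h2 := integrable_inner_clm hu h.memLp_fderiv
  have h3 := (integrable_inner_of_memLp_top hu h.memLp_lap).const_mul ν
  have h4 := integrable_inner_of_memLp_top hp h.memLp_divergence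
  have h12 := h1.add h2
  have h123 := h12.add h3
  rw [← integral_const_mul, ← integral_add' h1 h2, ← integral_add' h12 h3, ← integral_add' h123 h4]
  refine integral_congr_ae (Eventually.of_forall fun z => ?_)
  simp [weakForm, mul_comm]

theorem tendsto_integral_weakForm (h : IsTestField b T v) {u : ℝ → Euc d → Euc d}
    {p : ℝ → Euc d → ℝ} {un : ℕ → ℝ → Euc d → Euc d} {pn : ℕ → ℝ → Euc d → ℝ}
    (hu : MemLp (fun z : ℝ × Euc d => u z.1 z.2) 2 (cylinder b T))
    (hp : MemLp (fun z : ℝ × Euc d => p z.1 z.2) 2 (cylinder b T))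
    (hun : ∀ n, MemLp (fun z : ℝ × Euc d => un n z.1 z.2) 2 (cylinder b T))
    (hpn : ∀ n, MemLp (fun z : ℝ × Euc d => pn n z.1 z.2) 2 (cylinder b T))
    (hu' : Tendsto (fun n => ∫ z, ‖un n z.1 z.2 - u z.1 z.2‖ ^ 2 ∂(cylinder b T)) atTop (𝓝 0))
    (hp' : Tendsto (fun n => ∫ z, ‖pn n z.1 z.2 - p z.1 z.2‖ ^ 2 ∂(cylinder b T)) atTop (𝓝 0)) :
    Tendsto (fun n => ∫ z, weakForm ν (un n z.1) (pn n z.1) (v z.1)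
      (fun x => deriv (fun s => v s x) z.1) z.2 ∂(cylinder b T)) atTop
      (𝓝 (∫ z, weakForm ν (u z.1) (p z.1) (v z.1) (fun x => deriv (fun s => v s x) z.1) z.2
        ∂(cylinder b T))) := by
  simp only [h.integral_weakForm hu hp, fun n => h.integral_weakForm (ν := ν) (hun n) (hpn n)]
  exact (((tendsto_integral_inner hun hu hu' h.memLp_deriv).add
    (tendsto_integral_inner_clm hun hu hu' h.memLp_fderiv)).add
    ((tendsto_integral_inner hun hu hu' h.memLp_lap).const_mul ν)).add
    (tendsto_integral_inner hpn hp hp' h.memLp_divergence)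

end IsTestField

/-! ### Convergent sequences of semi-discrete solutions -/

/-- A sequence of semi-discrete solutions, with nodal values extended to all times as bounded
continuous functions, on a sequence of meshes of regularity `σ`, that converges strongly to
`(u, p)`. The bound `viscosity_le` says that the artificial viscosity is asymptotically small. -/
structure ConvergentScheme (ν ω T σ : ℝ) (M : ℕ → PeriodicMesh b)
    (du : (n : ℕ) → ℝ → (M n).Node → (M n).Node → ℝ) (U : (n : ℕ) → ℝ → (M n).Node → Euc d)
    (P : (n : ℕ) → ℝ → (M n).Node → ℝ) (u₀ : Euc d → Euc d) (u : ℝ → Euc d → Euc d)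
    (p : ℝ → Euc d → ℝ) : Prop where
  nonneg_ν : 0 ≤ ν
  nonneg_ω : 0 ≤ ω
  pos_T : 0 < T
  pos_σ : 0 < σ
  regular : ∀ n, (M n).IsRegular σ
  tendsto_meshSize : Tendsto (fun n => (M n).meshSize) atTop (𝓝 0)
  solution : ∀ n, (M n).IsSemiDiscreteSolution ν ω T (du n) (U n) (P n)
  viscosity_le : ∀ V L : ℝ, ∃ C : ℝ, ∀ n, ∀ t ∈ Ioo 0 T, ∀ (v : Euc d → Euc d) (ε : ℝ),
    PeriodicMesh.TestBounds (M n) v V L ε →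
      PeriodicMesh.lapSq (du n t) (fun i => v i.1) ≤ C * (M n).meshSize
  continuous_U : ∀ n i, Continuous fun t => U n t i
  continuous_P : ∀ n i, Continuous fun t => P n t i
  bddMeas_U : ∀ n i, BddMeas fun t => U n t i
  bddMeas_P : ∀ n i, BddMeas fun t => P n t i
  memLp_u₀ : MemLp u₀ 2 (volume.restrict (cell b))
  memLp_u : MemLp (fun z : ℝ × Euc d => u z.1 z.2) 2 (cylinder b T)
  memLp_p : MemLp (fun z : ℝ × Euc d => p z.1 z.2) 2 (cylinder b T)
  tendsto_u₀ : Tendsto (fun n => ∫ x in cell b, ‖(M n).fe (U n 0) x - u₀ x‖ ^ 2) atTop (𝓝 0)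
  tendsto_u : Tendsto (fun n => ∫ z, ‖(M n).fe (U n z.1) z.2 - u z.1 z.2‖ ^ 2 ∂(cylinder b T))
    atTop (𝓝 0)
  tendsto_p : Tendsto (fun n => ∫ z, ‖(M n).fe (P n z.1) z.2 - p z.1 z.2‖ ^ 2 ∂(cylinder b T))
    atTop (𝓝 0)

namespace ConvergentScheme

open PeriodicMesh

variable {ν ω T σ : ℝ} {M : ℕ → PeriodicMesh b}
  {du : (n : ℕ) → ℝ → (M n).Node → (M n).Node → ℝ} {U : (n : ℕ) → ℝ → (M n).Node → Euc d}
  {P : (n : ℕ) → ℝ → (M n).Node → ℝ} {u₀ : Euc d → Euc d} {u : ℝ → Euc d → Euc d}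
  {p : ℝ → Euc d → ℝ}

theorem memLp_U (h : ConvergentScheme ν ω T σ M du U P u₀ u p) (n : ℕ) :
    MemLp (fun z : ℝ × Euc d => (M n).fe (U n z.1) z.2) 2 (cylinder b T) :=
  (bddMeas_fe_time (h.bddMeas_U n)).memLp 2

theorem memLp_P (h : ConvergentScheme ν ω T σ M du U P u₀ u p) (n : ℕ) :
    MemLp (fun z : ℝ × Euc d => (M n).fe (P n z.1) z.2) 2 (cylinder b T) :=
  (bddMeas_fe_time (h.bddMeas_P n)).memLp 2

theorem tendsto_osc (h : ConvergentScheme ν ω T σ M du U P u₀ u p) :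
    Tendsto (fun n => (∫ t in 0..T, nodalOsc (U n t)) + ∫ t in 0..T, nodalOsc (P n t)) atTop
      (𝓝 0) := by
  simpa using (tendsto_integral_nodalOsc h.tendsto_meshSize h.pos_T.le h.continuous_U h.bddMeas_U
    h.memLp_u h.tendsto_u).add (tendsto_integral_nodalOsc h.tendsto_meshSize h.pos_T.le
    h.continuous_P h.bddMeas_P h.memLp_p h.tendsto_p)

/-- The a priori bounds. -/
theorem exists_bound (h : ConvergentScheme ν ω T σ M du U P u₀ u p) :
    ∃ B, ∀ n, nodalSq (U n 0) ≤ B ∧ ∫ t in 0..T, nodalSq (U n t) ≤ B ∧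
      ∫ t in 0..T, nodalSq (P n t) ≤ B := by
  obtain ⟨B₁, h₁, h₁'⟩ := exists_bound_integral_norm_sq
    (fun n => (bddMeas_fe (U n 0)).memLp 2) h.memLp_u₀ h.tendsto_u₀
  obtain ⟨B₂, h₂, h₂'⟩ := exists_bound_integral_norm_sq h.memLp_U h.memLp_u h.tendsto_u
  obtain ⟨B₃, h₃, h₃'⟩ := exists_bound_integral_norm_sq h.memLp_P h.memLp_p h.tendsto_p
  set A : ℝ := (d + 1) * (8 * 2 ^ d + 2) with hA
  have hA0 : 0 ≤ A := by positivity
  refine ⟨A * (B₁ + B₂ + B₃), fun n => ⟨(nodalSq_le _).trans ?_,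
    (integral_nodalSq_le h.pos_T.le (h.continuous_U n) (h.bddMeas_U n)).trans ?_,
    (integral_nodalSq_le h.pos_T.le (h.continuous_P n) (h.bddMeas_P n)).trans ?_⟩⟩
  · exact mul_le_mul_of_nonneg_left (by linarith [h₁' n]) hA0
  · exact mul_le_mul_of_nonneg_left (by linarith [h₂' n]) hA0
  · exact mul_le_mul_of_nonneg_left (by linarith [h₃' n]) hA0

theorem integral_gradSq_le (h : ConvergentScheme ν ω T σ M du U P u₀ u p) (n : ℕ) :
    ∫ t in 0..T, ν * gradSq (U n t) ≤ nodalSq (U n 0) :=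
  ((h.solution n).integral_gradSq_le h.nonneg_ω h.pos_T.le (h.continuous_U n)).trans
    (energy_le_nodalSq _)

theorem integral_error_eq (T C δ : ℝ) {f₁ f₂ f₃ f₄ f₅ : ℝ → ℝ} (h₁ : Continuous f₁)
    (h₂ : Continuous f₂) (h₃ : Continuous f₃) (h₄ : Continuous f₄) (h₅ : Continuous f₅) :
    ∫ t in 0..T, C * (δ * (1 + f₁ t + f₂ t + f₃ t) + δ⁻¹ * (f₄ t + f₅ t)) =
      C * (δ * (T + (∫ t in 0..T, f₁ t) + (∫ t in 0..T, f₂ t) + ∫ t in 0..T, f₃ t) +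
        δ⁻¹ * ((∫ t in 0..T, f₄ t) + ∫ t in 0..T, f₅ t)) := by
  rw [intervalIntegral.integral_const_mul, intervalIntegral.integral_add,
    intervalIntegral.integral_const_mul, intervalIntegral.integral_const_mul,
    intervalIntegral.integral_add, intervalIntegral.integral_add, intervalIntegral.integral_add,
    intervalIntegral.integral_add, intervalIntegral.integral_const, sub_zero, smul_eq_mul, mul_one]
  all_goals exact Continuous.intervalIntegrable (by fun_prop) _ _

/-- The semi-discrete solutions satisfy the weak form of the momentum equation up to a
consistency error that tends to zero. -/
theorem tendsto_weakForm (h : ConvergentScheme ν ω T σ M du U P u₀ u p)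
    {v : ℝ → Euc d → Euc d} (hv : IsTestField b T v) :
    Tendsto (fun n => (∫ x in cell b, inner ℝ ((M n).fe (U n 0) x) (v 0 x)) +
      ∫ z, weakForm ν ((M n).fe (U n z.1)) ((M n).fe (P n z.1)) (v z.1)
        (fun x => deriv (fun s => v s x) z.1) z.2 ∂(cylinder b T)) atTop (𝓝 0) := by
  have hT := h.pos_T.le
  set w : ℝ → Euc d → Euc d := fun t x => deriv (fun s => v s x) t with hw
  have hwc : Continuous fun z : ℝ × Euc d => w z.1 z.2 :=
    (contDiff_deriv_slice (m := 0) (by norm_num) hv.contDiff).continuous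
  have hwp : ∀ t, IsPeriodic b (w t) := fun t => IsPeriodic.deriv_slice hv.periodic t
  have hwt : ∀ t, Continuous (w t) := fun t => hwc.comp (by fun_prop : Continuous fun x => (t, x))
  have hv1 : ContDiff ℝ 1 fun z : ℝ × Euc d => v z.1 z.2 := hv.contDiff.of_le (by norm_num)
  obtain ⟨V, L, hV, hL, htest⟩ := exists_testBounds hv1 hv.periodic T
  obtain ⟨C, hC0, hC⟩ := exists_consistency_const b h.nonneg_ν h.nonneg_ω h.pos_σ hV hL
  obtain ⟨B, hB⟩ := h.exists_bound
  obtain ⟨D, hD⟩ := h.viscosity_le V L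
  have he : Tendsto (fun n => (M n).meshSize + ((∫ t in 0..T, nodalOsc (U n t)) +
      ∫ t in 0..T, nodalOsc (P n t))) atTop (𝓝 0) := by
    simpa using h.tendsto_meshSize.add h.tendsto_osc
  refine tendsto_zero_of_young (B := B + ((d + 1) * volume.real (cell b) + B) +
    C * (T + B + B + B)) he fun δ hδ => ⟨(1 / 2) * δ⁻¹ * |D| * T + C * δ⁻¹, ?_⟩
  obtain ⟨δ₁, hδ₁, hδ₁'⟩ := htest δ hδ
  obtain ⟨δ₂, hδ₂, hδ₂'⟩ := exists_modulus_of_periodic hwc hwp T hδ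
  obtain ⟨δ₃, hδ₃, hδ₃'⟩ := exists_modulus_of_periodic hv1.continuous hv.periodic T hδ
  filter_upwards [h.tendsto_meshSize.eventually (gt_mem_nhds hδ₁),
    h.tendsto_meshSize.eventually (gt_mem_nhds hδ₂),
    h.tendsto_meshSize.eventually (gt_mem_nhds hδ₃)] with n hn₁ hn₂ hn₃
  have h0 : (0 : ℝ) ∈ Icc 0 T := ⟨le_rfl, hT⟩
  obtain ⟨hB₁, hB₂, hB₃⟩ := hB n
  have hm0 := (M n).meshSize_nonneg
  -- the weak form of the scheme
  have k1 := (h.solution n).abs_add_integral_le h.nonneg_ν h.nonneg_ω hT (h.continuous_U n)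
    (h.continuous_P n) (v := fun t i => v t i.1) (v' := fun t i => w t i.1)
    (fun i t => hasDerivAt_slice (hv1.differentiable one_ne_zero) t i.1)
    (fun i => hwc.comp (by fun_prop : Continuous fun t : ℝ => (t, i.1)))
    (fun i => by obtain ⟨τ, hτ, hs⟩ := hv.support; exact hs T hτ.le i.1) hδ
    (B := |D| * (M n).meshSize) (fun t ht =>
      (hD n t ht _ _ (hδ₁' (M n) hn₁.le t (Ioo_subset_Icc_self ht))).trans
        (mul_le_mul_of_nonneg_right (le_abs_self D) hm0))
  have k1' := mul_le_mul_of_nonneg_left ((energy_le_nodalSq (U n 0)).trans hB₁) hδ.le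
  -- the initial values
  have k2 := abs_massL_sub_le (U n 0)
    (bddMeas_of_periodic (contDiff_slice hv1 0).continuous (hv.periodic 0)) (hv.periodic 0)
    (fun K x hx z hz => hδ₃' 0 h0 x z ((norm_sub_le_meshSize hz hx).trans hn₃.le))
  have k2' : δ * ((d + 1) * volume.real (cell b) + nodalSq (U n 0)) ≤
      δ * ((d + 1) * volume.real (cell b) + B) :=
    mul_le_mul_of_nonneg_left (by linarith) hδ.le
  -- the consistency error
  have hΨ := hv.integrable_weakForm (ν := ν) (u := fun t => (M n).fe (U n t))
    (p := fun t => (M n).fe (P n t)) (h.memLp_U n) (h.memLp_P n)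
  have hΨi : IntervalIntegrable (fun t => ∫ x in cell b,
      weakForm ν ((M n).fe (U n t)) ((M n).fe (P n t)) (v t) (w t) x) volume 0 T := by
    rw [intervalIntegrable_iff_integrableOn_Ioo_of_le hT]
    exact hΨ.integral_prod_left
  have hcU := h.continuous_U n
  have hcP := h.continuous_P n
  have hvc : ∀ i : (M n).Node, Continuous fun t => v t i.1 := fun i =>
    hv1.continuous.comp (by fun_prop : Continuous fun t : ℝ => (t, i.1))
  have hwc' : ∀ i : (M n).Node, Continuous fun t => w t i.1 := fun i =>
    hwc.comp (by fun_prop : Continuous fun t : ℝ => (t, i.1))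
  have hSi : Continuous fun t => schemeForm ν (U n t) (P n t) (fun i => v t i.1)
      (fun i => w t i.1) := by
    simp only [schemeForm, convec]
    fun_prop
  have c1 := continuous_nodalSq hcU
  have c2 := continuous_nodalSq hcP
  have c3 := (continuous_gradSq hcU).const_mul ν
  have c4 := continuous_nodalOsc hcU
  have c5 := continuous_nodalOsc hcP
  have k3 : |(∫ t in 0..T, schemeForm ν (U n t) (P n t) (fun i => v t i.1) (fun i => w t i.1)) -
      ∫ t in 0..T, ∫ x in cell b,
        weakForm ν ((M n).fe (U n t)) ((M n).fe (P n t)) (v t) (w t) x| ≤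
      C * (δ * (T + (∫ t in 0..T, nodalSq (U n t)) + (∫ t in 0..T, nodalSq (P n t)) +
        ∫ t in 0..T, ν * gradSq (U n t)) + δ⁻¹ * ((∫ t in 0..T, nodalOsc (U n t)) +
          ∫ t in 0..T, nodalOsc (P n t))) := by
    have e1 : C * (δ * (T + (∫ t in 0..T, nodalSq (U n t)) + (∫ t in 0..T, nodalSq (P n t)) +
        ∫ t in 0..T, ν * gradSq (U n t)) + δ⁻¹ * ((∫ t in 0..T, nodalOsc (U n t)) +
          ∫ t in 0..T, nodalOsc (P n t))) =
        ∫ t in 0..T, C * (δ * (1 + nodalSq (U n t) + nodalSq (P n t) + ν * gradSq (U n t)) +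
          δ⁻¹ * (nodalOsc (U n t) + nodalOsc (P n t))) := by
      exact (integral_error_eq T C δ c1 c2 c3 c4 c5).symm
    rw [e1, ← intervalIntegral.integral_sub (hSi.intervalIntegrable _ _) hΨi]
    refine intervalIntegral.norm_integral_le_of_norm_le (E := ℝ) hT ?_
      (Continuous.intervalIntegrable (by fun_prop) _ _)
    filter_upwards [Measure.ae_ne volume T] with t htT ht
    have ht' : t ∈ Ioo 0 T := ⟨ht.1, lt_of_le_of_ne ht.2 htT⟩
    exact hC (M n) (h.regular n) (U n t) (P n t) ((h.solution n).discreteContinuity ht') (v t)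
      (w t) δ hδ (contDiff_slice hv.contDiff t) (hδ₁' (M n) hn₁.le t (Ioo_subset_Icc_self ht'))
      (bddMeas_of_periodic (hwt t) (hwp t)) (hwp t) fun K x hx z hz =>
        hδ₂' t (Ioo_subset_Icc_self ht') x z ((norm_sub_le_meshSize hz hx).trans hn₂.le)
  have hG := (h.integral_gradSq_le n).trans hB₁
  rw [integral_cylinder hT hΨ]
  set OU := ∫ t in 0..T, nodalOsc (U n t)
  set OP := ∫ t in 0..T, nodalOsc (P n t)
  have k3' : C * (δ * (T + (∫ t in 0..T, nodalSq (U n t)) + (∫ t in 0..T, nodalSq (P n t)) +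
        ∫ t in 0..T, ν * gradSq (U n t)) + δ⁻¹ * (OU + OP)) ≤
      C * (δ * (T + B + B + B) + δ⁻¹ * (OU + OP)) := by
    gcongr
  have hO : 0 ≤ OU + OP := add_nonneg
    (intervalIntegral.integral_nonneg hT fun t _ => nodalOsc_nonneg _)
    (intervalIntegral.integral_nonneg hT fun t _ => nodalOsc_nonneg _)
  have hδi := (inv_pos.2 hδ).le
  have k4 : 0 ≤ (1 / 2) * δ⁻¹ * |D| * T * (OU + OP) := by positivity
  have k5 : 0 ≤ C * δ⁻¹ * (M n).meshSize := by positivity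
  rw [abs_le] at k1 k2 k3 ⊢
  constructor
  · linarith [k1.1, k2.2, k3.2]
  · linarith [k1.2, k2.1, k3.1]

/-- The limit satisfies the weak form of the momentum equation, with the viscous term in its very
weak form. -/
theorem weakForm_eq_zero (h : ConvergentScheme ν ω T σ M du U P u₀ u p)
    {v : ℝ → Euc d → Euc d} (hv : IsTestField b T v) :
    (∫ x in cell b, inner ℝ (u₀ x) (v 0 x)) +
      ∫ z, weakForm ν (u z.1) (p z.1) (v z.1) (fun x => deriv (fun s => v s x) z.1) z.2
        ∂(cylinder b T) = 0 := by
  have h0 : MemLp (v 0) ⊤ (volume.restrict (cell b)) :=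
    (bddMeas_of_periodic (contDiff_slice hv.contDiff 0).continuous (hv.periodic 0)).memLp ⊤
  exact tendsto_nhds_unique ((tendsto_integral_inner
    (fun n => (bddMeas_fe (U n 0)).memLp 2) h.memLp_u₀ h.tendsto_u₀ h0).add
    (hv.tendsto_integral_weakForm (un := fun n t => (M n).fe (U n t))
      (pn := fun n t => (M n).fe (P n t)) h.memLp_u h.memLp_p h.memLp_U h.memLp_P h.tendsto_u
      h.tendsto_p)) (h.tendsto_weakForm hv)

end ConvergentScheme

/-! ### The weak gradient -/

theorem inner_toLp {X : Type*} [MeasurableSpace X] {μ : Measure X} {F : Type*}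
    [NormedAddCommGroup F] [InnerProductSpace ℝ F] {f g : X → F} (hf : MemLp f 2 μ)
    (hg : MemLp g 2 μ) : inner ℝ (hf.toLp f) (hg.toLp g) = ∫ x, inner ℝ (f x) (g x) ∂μ := by
  rw [L2.inner_def]
  refine integral_congr_ae ?_
  filter_upwards [hf.coeFn_toLp, hg.coeFn_toLp] with x hx hy
  rw [hx, hy]

theorem norm_toLp_le {X : Type*} [MeasurableSpace X] {μ : Measure X} {F : Type*}
    [NormedAddCommGroup F] {f : X → F} (hf : MemLp f 2 μ) {B : ℝ} (h : ∫ x, ‖f x‖ ^ 2 ∂μ ≤ B) :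
    ‖hf.toLp f‖ ≤ √B := by
  rw [Lp.norm_toLp]
  refine Real.le_sqrt_of_sq_le ?_
  rwa [← integral_norm_sq_eq hf]

theorem fderiv_smul_single {φ : Euc d → ℝ} (hφ : ContDiff ℝ 1 φ) (i : Fin d) (x e : Euc d) :
    fderiv ℝ (fun y => φ y • EuclideanSpace.single i (1 : ℝ)) x e =
      fderiv ℝ φ x e • EuclideanSpace.single i (1 : ℝ) := by
  have h := ((hφ.differentiable one_ne_zero x).hasFDerivAt).smul_const
    (EuclideanSpace.single i (1 : ℝ))
  rw [h.fderiv]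
  rfl

theorem inner_smul_single (w : Euc d) (a : ℝ) (i : Fin d) :
    inner ℝ w (a • EuclideanSpace.single i (1 : ℝ)) = w i * a := by
  rw [inner_smul_right, EuclideanSpace.inner_single_right]
  simp [mul_comm]

namespace ConvergentScheme

open PeriodicMesh

variable {ν ω T σ : ℝ} {M : ℕ → PeriodicMesh b}
  {du : (n : ℕ) → ℝ → (M n).Node → (M n).Node → ℝ} {U : (n : ℕ) → ℝ → (M n).Node → Euc d}
  {P : (n : ℕ) → ℝ → (M n).Node → ℝ} {u₀ : Euc d → Euc d} {u : ℝ → Euc d → Euc d}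
  {p : ℝ → Euc d → ℝ}

theorem bddMeas_feD_apply (h : ConvergentScheme ν ω T σ M du U P u₀ u p) (n : ℕ) (i k : Fin d) :
    BddMeas fun z : ℝ × Euc d => feD (U n z.1) k z.2 i :=
  (bddMeas_feD_time (h.bddMeas_U n) k).clm (EuclideanSpace.proj (𝕜 := ℝ) i)

theorem integral_feD_apply_le (h : ConvergentScheme ν ω T σ M du U P u₀ u p) (hν : 0 < ν) (n : ℕ)
    (i k : Fin d) :
    ∫ z, ‖feD (U n z.1) k z.2 i‖ ^ 2 ∂(cylinder b T) ≤ ν⁻¹ * nodalSq (U n 0) := by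
  have hT := h.pos_T.le
  have hi := ((h.bddMeas_feD_apply n i k).norm.pow 2).integrable (cylinder b T)
  rw [integral_cylinder hT hi, le_inv_mul_iff₀ hν, ← intervalIntegral.integral_const_mul]
  refine (intervalIntegral.integral_mono_on hT ?_ (((continuous_gradSq
    (h.continuous_U n)).const_mul ν).intervalIntegrable _ _) fun t _ =>
      mul_le_mul_of_nonneg_left ?_ hν.le).trans (h.integral_gradSq_le n)
  · rw [intervalIntegrable_iff_integrableOn_Ioo_of_le hT]
    exact hi.integral_prod_left.const_mul _
  · rw [gradSq_eq]
    refine le_trans ?_ (Finset.single_le_sum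
      (f := fun k => ∫ x in cell b, ‖feD (U n t) k x‖ ^ 2)
      (fun k _ => integral_nonneg fun _ => by positivity) (Finset.mem_univ k))
    refine integral_mono ((((bddMeas_feD (U n t) k).clm
      (EuclideanSpace.proj (𝕜 := ℝ) i)).norm.pow 2).integrable _)
      (((bddMeas_feD (U n t) k).norm.pow 2).integrable _) fun x => ?_
    exact pow_le_pow_left₀ (norm_nonneg _) (PiLp.norm_apply_le _ i) 2

/-- The limit velocity has a weak gradient, a weak limit point of the bounded sequence of
gradients of the approximations. -/
theorem exists_isWeakGradient (h : ConvergentScheme ν ω T σ M du U P u₀ u p) (hν : 0 < ν) :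
    ∃ G : Fin d → Fin d → ℝ → Euc d → ℝ, IsWeakGradient b T u G := by
  have hT := h.pos_T.le
  obtain ⟨B, hB⟩ := h.exists_bound
  have hmem : ∀ n i k, MemLp (fun z : ℝ × Euc d => feD (U n z.1) k z.2 i) 2 (cylinder b T) :=
    fun n i k => (h.bddMeas_feD_apply n i k).memLp 2
  have hbd : ∀ i k n, ‖(hmem n i k).toLp _‖ ≤ √(ν⁻¹ * B) := fun i k n =>
    norm_toLp_le (hmem n i k) ((h.integral_feD_apply_le hν n i k).trans
      (mul_le_mul_of_nonneg_left (hB n).1 (inv_pos.2 hν).le))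
  choose G hG using fun i k => exists_weak_limit (hbd i k)
  refine ⟨fun i k t x => G i k (t, x), fun i k => Lp.memLp (G i k), fun i k φ hφ hp => ?_⟩
  have hφm : MemLp (fun z : ℝ × Euc d => φ z.1 z.2) 2 (cylinder b T) :=
    (memLp_top_of_periodic hφ.continuous hp T).mono_exponent le_top
  set e : Euc d := EuclideanSpace.single k 1 with he
  set D : ℝ → Euc d → Euc d := fun t x => fderiv ℝ (φ t) x e • EuclideanSpace.single i (1 : ℝ)
    with hD
  have hDm : MemLp (fun z : ℝ × Euc d => D z.1 z.2) ⊤ (cylinder b T) := by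
    refine memLp_top_of_periodic ?_ (fun t j x => ?_) T
    · exact (((contDiff_fderiv_slice (m := 0) (by norm_num) hφ).clm_apply
        contDiff_const).smul contDiff_const).continuous
    · simp only [hD, (hp t).fderiv j x]
  have hlim := (tendsto_integral_inner h.memLp_U h.memLp_u h.tendsto_u hDm).neg
  have hparts : ∀ n, inner ℝ ((hmem n i k).toLp _) (hφm.toLp _) =
      -∫ z, inner ℝ ((M n).fe (U n z.1) z.2) (D z.1 z.2) ∂(cylinder b T) := fun n => by
    rw [inner_toLp, integral_cylinder hT (integrable_inner_of_memLp_top (h.memLp_U n) hDm),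
      integral_cylinder hT, ← intervalIntegral.integral_neg]
    · refine intervalIntegral.integral_congr fun t _ => ?_
      have h1 := integral_feD_inner
        (φ := fun x => φ t x • EuclideanSpace.single i (1 : ℝ)) (U n t) k
        (contDiff_slice hφ t |>.smul
        (contDiff_const (c := EuclideanSpace.single i (1 : ℝ))))
        (fun j x => by simp only [hp t j x] : IsPeriodic b fun x =>
          φ t x • EuclideanSpace.single i (1 : ℝ))
      simp only [fderiv_smul_single (contDiff_slice hφ t)] at h1
      simp only [hD, inner_smul_single] at h1 ⊢
      simpa [mul_comm] using h1
    · exact integrable_inner_of_memLp_top (hmem n i k) (memLp_top_of_periodic hφ.continuous hp T)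
  have h1 := hG i k (hφm.toLp _) _ (by simpa only [hparts] using hlim)
  have h2 : inner ℝ (G i k) (hφm.toLp _) =
      ∫ z, G i k z * φ z.1 z.2 ∂(cylinder b T) := by
    rw [L2.inner_def]
    refine integral_congr_ae ?_
    filter_upwards [hφm.coeFn_toLp] with z hz
    rw [hz]
    simp [mul_comm]
  rw [h2] at h1
  simp only [hD, inner_smul_single] at h1
  show _ = -∫ z, G i k z * φ z.1 z.2 ∂(cylinder b T)
  rw [h1, neg_neg]

/-- The weak form of the momentum equation for the limit. -/
theorem momentum_limit (h : ConvergentScheme ν ω T σ M du U P u₀ u p) :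
    ∃ G : Fin d → Fin d → ℝ → Euc d → ℝ, (0 < ν → IsWeakGradient b T u G) ∧
    ∀ v : ℝ → Euc d → Euc d, IsTestField b T v →
      (∫ z, (inner ℝ (u z.1 z.2) (deriv (fun s => v s z.2) z.1)
          + ∑ i, ∑ j, (u z.1 z.2 i * u z.1 z.2 j - ν * G i j z.1 z.2) * pderiv (v z.1) z.2 i j
          + p z.1 z.2 * ∑ i, pderiv (v z.1) z.2 i i) ∂(cylinder b T))
        + ∫ x in cell b, inner ℝ (u₀ x) (v 0 x) = 0 := by
  have key : ∃ G : Fin d → Fin d → ℝ → Euc d → ℝ, (0 < ν → IsWeakGradient b T u G) ∧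
      (∀ i j, MemLp (fun z : ℝ × Euc d => G i j z.1 z.2) 2 (cylinder b T)) ∧
      ∀ v : ℝ → Euc d → Euc d, IsTestField b T v →
        ν * ∑ i, ∑ j, ∫ z, G i j z.1 z.2 * pderiv (v z.1) z.2 i j ∂(cylinder b T) =
        -(ν * ∫ z, inner ℝ (u z.1 z.2) (lap (v z.1) z.2) ∂(cylinder b T)) := by
    rcases h.nonneg_ν.eq_or_lt with h0 | h0
    · refine ⟨fun _ _ _ _ => 0, fun h1 => absurd h0 h1.ne, fun _ _ => MemLp.zero, fun v _ => ?_⟩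
      rw [← h0, zero_mul, zero_mul, neg_zero]
    · obtain ⟨G, hG⟩ := h.exists_isWeakGradient h0
      refine ⟨G, fun _ => hG, hG.1, fun v hv => ?_⟩
      rw [← mul_neg]
      congr 1
      have hpd : ∀ i j, ContDiff ℝ 1 fun z : ℝ × Euc d => pderiv (v z.1) z.2 i j :=
        contDiff_pderiv_slice hv.contDiff
      have hparts := fun i j => hG.2 i j (fun t x => pderiv (v t) x i j) (hpd i j)
        fun t => (hv.periodic t).pderiv i j
      have e1 : ∀ z : ℝ × Euc d, inner ℝ (u z.1 z.2) (lap (v z.1) z.2) = ∑ i, ∑ j, u z.1 z.2 i *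
          fderiv ℝ (fun x => pderiv (v z.1) x i j) z.2 (EuclideanSpace.single j 1) := by
        intro z
        have e2 : ∀ i j, fderiv ℝ (fun x => pderiv (v z.1) x i j) z.2 (EuclideanSpace.single j 1) =
            fderiv ℝ (fun y => fderiv ℝ (v z.1) y (EuclideanSpace.single j 1)) z.2
              (EuclideanSpace.single j 1) i := by
          intro i j
          have hc := ContDiff.fderiv_apply_const (contDiff_slice hv.contDiff z.1)
            (EuclideanSpace.single j (1 : ℝ))
          have h1 := (EuclideanSpace.proj (𝕜 := ℝ) (ι := Fin d) i).hasFDerivAt.comp z.2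
            (hc.differentiable one_ne_zero z.2).hasFDerivAt
          have h2 := h1.fderiv
          exact congrArg (fun A : Euc d →L[ℝ] ℝ => A (EuclideanSpace.single j 1)) h2
        rw [PiLp.inner_apply]
        refine Finset.sum_congr rfl fun i _ => ?_
        simp only [e2, ← Finset.mul_sum, lap]
        simp [mul_comm]
      have hi : ∀ i j, Integrable (fun z : ℝ × Euc d => u z.1 z.2 i *
          fderiv ℝ (fun x => pderiv (v z.1) x i j) z.2 (EuclideanSpace.single j 1))
          (cylinder b T) := by
        intro i j
        have hD : MemLp (fun z : ℝ × Euc d => fderiv ℝ (fun x => pderiv (v z.1) x i j) z.2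
            (EuclideanSpace.single j 1) • EuclideanSpace.single i (1 : ℝ)) ⊤ (cylinder b T) := by
          refine memLp_top_of_periodic (f := fun t y => fderiv ℝ (fun x => pderiv (v t) x i j) y
            (EuclideanSpace.single j 1) • EuclideanSpace.single i (1 : ℝ)) ?_ (fun t k x => ?_) T
          · exact (((contDiff_fderiv_slice (m := 0) (f := fun t x => pderiv (v t) x i j)
              (by norm_num) (hpd i j)).clm_apply contDiff_const).smul contDiff_const).continuous
          · simp only [((hv.periodic t).pderiv i j).fderiv k x]
        simpa only [inner_smul_single] using integrable_inner_of_memLp_top h.memLp_u hD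
      simp only [e1]
      rw [integral_finsetSum _ fun i _ => integrable_finsetSum _ fun j _ => hi i j,
        ← Finset.sum_neg_distrib]
      refine Finset.sum_congr rfl fun i _ => ?_
      rw [integral_finsetSum _ fun j _ => hi i j, ← Finset.sum_neg_distrib]
      refine Finset.sum_congr rfl fun j _ => ?_
      rw [hparts i j, neg_neg]
  obtain ⟨G, hG1, hG2, hG3⟩ := key
  refine ⟨G, hG1, fun v hv => ?_⟩
  have hw := h.weakForm_eq_zero hv
  rw [hv.integral_weakForm h.memLp_u h.memLp_p] at hw
  have hpd : ∀ i j, MemLp (fun z : ℝ × Euc d => pderiv (v z.1) z.2 i j) ⊤ (cylinder b T) :=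
    fun i j => memLp_top_of_periodic (f := fun t x => pderiv (v t) x i j)
      (contDiff_pderiv_slice hv.contDiff i j).continuous (fun t => (hv.periodic t).pderiv i j) T
  have hGi : ∀ i j, Integrable (fun z : ℝ × Euc d => G i j z.1 z.2 * pderiv (v z.1) z.2 i j)
      (cylinder b T) := fun i j => by
    have := integrable_inner_of_memLp_top (hG2 i j) (hpd i j)
    simpa [mul_comm] using this
  have h1 := integrable_inner_of_memLp_top h.memLp_u hv.memLp_deriv
  have h2 := integrable_inner_clm h.memLp_u hv.memLp_fderiv
  have h3 : Integrable (fun z : ℝ × Euc d => -ν * ∑ i, ∑ j,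
      G i j z.1 z.2 * pderiv (v z.1) z.2 i j) (cylinder b T) :=
    (integrable_finsetSum _ fun i _ => integrable_finsetSum _ fun j _ => hGi i j).const_mul _
  have h4 := integrable_inner_of_memLp_top h.memLp_p hv.memLp_divergence
  have h12 := h1.add h2
  have h123 := h12.add h3
  have e3 : ∫ z, -ν * ∑ i, ∑ j, G i j z.1 z.2 * pderiv (v z.1) z.2 i j ∂(cylinder b T) =
      ν * ∫ z, inner ℝ (u z.1 z.2) (lap (v z.1) z.2) ∂(cylinder b T) := by
    rw [integral_const_mul, integral_finsetSum _ fun i _ =>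
      integrable_finsetSum _ fun j _ => hGi i j]
    simp only [fun i => integral_finsetSum Finset.univ fun j (_ : j ∈ Finset.univ) => hGi i j]
    linarith [hG3 v hv]
  rw [← e3, ← integral_add' h1 h2, ← integral_add' h12 h3, ← integral_add' h123 h4, add_comm] at hw
  refine Eq.trans ?_ hw
  congr 1
  refine integral_congr_ae (Eventually.of_forall fun z => ?_)
  have e4 := inner_fderiv_eq (v z.1) z.2 (u z.1 z.2)
  simp only [Pi.add_apply, e4, divergence, sub_mul, Finset.sum_sub_distrib, mul_assoc,
    ← Finset.mul_sum]
  simp [mul_comm]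
  ring

/-! ### The limit is solenoidal -/

/-- For a fixed test function, the continuity equation holds in the limit for almost all times. -/
theorem ae_integral_eq_zero (h : ConvergentScheme ν ω T σ M du U P u₀ u p) {q : Euc d → ℝ}
    (hq : ContDiff ℝ 1 q) (hqp : IsPeriodic b q) :
    ∀ᵐ t ∂(volume.restrict (Ioo 0 T)), ∫ x in cell b, inner ℝ (u t x) (gradient q x) = 0 := by
  have hT := h.pos_T.le
  have hgc : Continuous (gradient q) :=
    (InnerProductSpace.toDual ℝ (Euc d)).symm.continuous.comp (hq.continuous_fderiv one_ne_zero)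
  have hgm : BddMeas (gradient q) := bddMeas_of_periodic hgc hqp.gradient
  have hgT : MemLp (fun z : ℝ × Euc d => gradient q z.2) ⊤ (cylinder b T) :=
    (hgm.comp measurable_snd).memLp ⊤
  have hint := integrable_inner_of_memLp_top h.memLp_u hgT
  refine Integrable.ae_eq_zero_of_forall_setIntegral_eq_zero hint.integral_prod_left
    fun s hs _ => ?_
  -- the time cut-off that localizes the continuity equation to `s`
  set ψ : ℝ → ℝ := s.indicator fun _ => 1 with hψ
  have hψm : BddMeas ψ := by
    refine ⟨(measurable_const.indicator hs).stronglyMeasurable, 1, fun t => ?_⟩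
    by_cases ht : t ∈ s <;> simp [hψ, ht]
  have hψ1 : ∀ t, |ψ t| ≤ 1 := fun t => by by_cases ht : t ∈ s <;> simp [hψ, ht]
  have hw : MemLp (fun z : ℝ × Euc d => ψ z.1 • gradient q z.2) ⊤ (cylinder b T) :=
    ((hψm.comp measurable_fst).smul (hgm.comp measurable_snd)).memLp ⊤
  have hlim := tendsto_integral_inner h.memLp_U h.memLp_u h.tendsto_u hw
  have hzero : Tendsto (fun n => ∫ z, inner ℝ ((M n).fe (U n z.1) z.2)
      (ψ z.1 • gradient q z.2) ∂(cylinder b T)) atTop (𝓝 0) := by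
    obtain ⟨V, L, hV, hL, htest⟩ := exists_testBounds (b := b) (f := fun _ : ℝ => q)
      (hq.comp contDiff_snd) (fun _ => hqp) 0
    obtain ⟨B, hB⟩ := h.exists_bound
    have hσ := h.pos_σ
    have hω := h.nonneg_ω
    set vol := volume.real (cell b)
    refine tendsto_zero_of_young (B := (d + 1) * σ⁻¹ * (T * ((d + 1) * vol) + B) +
      ω * V * (T * ((d + 1) ^ 2 * vol))) h.tendsto_osc fun δ hδ => ⟨ω * V * δ⁻¹, ?_⟩
    obtain ⟨δ₁, hδ₁, hδ₁'⟩ := htest δ hδ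
    filter_upwards [h.tendsto_meshSize.eventually (gt_mem_nhds hδ₁)] with n hn
    have hi := integrable_inner_of_memLp_top (h.memLp_U n) hw
    have c1 := continuous_nodalSq (h.continuous_U n)
    have c2 := continuous_nodalOsc (h.continuous_P n)
    have hOU : 0 ≤ ∫ t in 0..T, nodalOsc (U n t) :=
      intervalIntegral.integral_nonneg hT fun t _ => nodalOsc_nonneg _
    have hB2 := (hB n).2.1
    rw [integral_cylinder hT hi]
    have k1 : |∫ t in 0..T, ∫ x in cell b, inner ℝ ((M n).fe (U n t) x) (ψ t • gradient q x)| ≤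
        ∫ t in 0..T, ((d + 1) * σ⁻¹ * δ * ((d + 1) * vol + nodalSq (U n t)) +
          ω * V * ((d + 1) ^ 2 * δ * vol + δ⁻¹ * nodalOsc (P n t))) := by
      refine intervalIntegral.norm_integral_le_of_norm_le (E := ℝ) hT ?_
        (Continuous.intervalIntegrable (by fun_prop) _ _)
      filter_upwards [Measure.ae_ne volume T] with t htT ht
      have ht' : t ∈ Ioo 0 T := ⟨ht.1, lt_of_le_of_ne ht.2 htT⟩
      have k2 := ((h.solution n).discreteContinuity ht').abs_integral_le hω hσ (h.regular n)
        (hδ₁' (M n) hn.le 0 (by simp)) hδ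
      refine le_trans ?_ k2
      have e1 : ∀ x, inner ℝ ((M n).fe (U n t) x) (ψ t • gradient q x) =
          ψ t * fderiv ℝ q x ((M n).fe (U n t) x) := fun x => by
        rw [inner_smul_right, real_inner_comm, gradient, InnerProductSpace.toDual_symm_apply]
      simp only [e1]
      rw [integral_const_mul, norm_mul]
      exact mul_le_of_le_one_left (norm_nonneg _) (hψ1 t)
    refine k1.trans ?_
    rw [intervalIntegral.integral_add, intervalIntegral.integral_const_mul,
      intervalIntegral.integral_const_mul, intervalIntegral.integral_add,
      intervalIntegral.integral_add, intervalIntegral.integral_const_mul,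
      intervalIntegral.integral_const, intervalIntegral.integral_const, sub_zero]
    rotate_left
    iterate 6 exact Continuous.intervalIntegrable (by fun_prop) _ _
    simp only [smul_eq_mul, intervalIntegral.integral_const_mul]
    have k3 : (d + 1) * σ⁻¹ * δ * (T * ((d + 1) * vol) + ∫ t in 0..T, nodalSq (U n t)) ≤
        (d + 1) * σ⁻¹ * δ * (T * ((d + 1) * vol) + B) := by gcongr
    have k4 : 0 ≤ ω * V * δ⁻¹ * ∫ t in 0..T, nodalOsc (U n t) := by positivity
    linarith
  have hfin := tendsto_nhds_unique hlim hzero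
  rw [cylinder, integral_prod _ (integrable_inner_of_memLp_top h.memLp_u hw)] at hfin
  rw [← integral_indicator hs]
  refine Eq.trans ?_ hfin
  refine integral_congr_ae (Eventually.of_forall fun t => ?_)
  by_cases ht : t ∈ s <;> simp [hψ, ht]

/-- The exceptional set of times can be chosen independently of the test function, since the
space of square integrable functions is separable. -/
theorem solenoidal_limit (h : ConvergentScheme ν ω T σ M du U P u₀ u p) :
    ∀ᵐ t ∂(volume.restrict (Ioo 0 T)), ∀ q : Euc d → ℝ, ContDiff ℝ 1 q →
      IsPeriodic b q → ∫ x in cell b, inner ℝ (u t x) (gradient q x) = 0 := by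
  have hgm : ∀ q : {q : Euc d → ℝ // ContDiff ℝ 1 q ∧ IsPeriodic b q},
      MemLp (gradient q.1) 2 (volume.restrict (cell b)) := fun q =>
    (bddMeas_of_periodic ((InnerProductSpace.toDual ℝ (Euc d)).symm.continuous.comp
      (q.2.1.continuous_fderiv one_ne_zero)) q.2.2.gradient).memLp 2
  set Q : {q : Euc d → ℝ // ContDiff ℝ 1 q ∧ IsPeriodic b q} →
    Lp (Euc d) 2 (volume.restrict (cell b)) := fun q => (hgm q).toLp _ with hQ
  have : Nonempty (range Q) :=
    ⟨Q ⟨fun _ => 0, contDiff_const, fun _ _ => rfl⟩, mem_range_self _⟩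
  have : Fact ((2 : ENNReal) ≠ ⊤) := ⟨ENNReal.ofNat_ne_top⟩
  have : SecondCountableTopology (Lp (Euc d) 2 (volume.restrict (cell b))) := inferInstance
  choose q hq using fun k : ℕ => (TopologicalSpace.denseSeq (range Q) k).2
  have h1 : ∀ᵐ t ∂(volume.restrict (Ioo 0 T)), ∀ k,
      ∫ x in cell b, inner ℝ (u t x) (gradient (q k).1 x) = 0 :=
    ae_all_iff.2 fun k => h.ae_integral_eq_zero (q k).2.1 (q k).2.2
  have h2 : ∀ᵐ t ∂(volume.restrict (Ioo 0 T)),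
      AEStronglyMeasurable (u t) (volume.restrict (cell b)) := h.memLp_u.1.prodMk_left
  have h3 := (MemLp.integrable_norm_sq h.memLp_u).prod_right_ae
  filter_upwards [h1, h2, h3] with t h1 h2 h3 f hf hfp
  have hut : MemLp (u t) 2 (volume.restrict (cell b)) :=
    (memLp_two_iff_integrable_sq_norm h2).2 h3
  have hdense : ∀ g : range Q, inner ℝ (hut.toLp _) g.1 = (0 : ℝ) := by
    intro g
    refine (TopologicalSpace.denseRange_denseSeq (range Q)).induction_on g ?_ ?_
    · exact isClosed_eq (continuous_const.inner continuous_subtype_val) continuous_const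
    · intro k
      rw [← hq k, hQ, inner_toLp]
      exact h1 k
  have := hdense ⟨Q ⟨f, hf, hfp⟩, mem_range_self _⟩
  rwa [hQ, inner_toLp] at this

end ConvergentScheme

/-! ### Extension of semi-discrete solutions to all times -/

theorem continuous_comp_clamp {F : Type*} [TopologicalSpace F] {T : ℝ} (hT : 0 ≤ T) {f : ℝ → F}
    (hf : ContinuousOn f (Icc 0 T)) : Continuous fun t => f (clamp T t) :=
  hf.comp_continuous (continuous_clamp T) (clamp_mem hT)

theorem bddMeas_comp_clamp {F : Type*} [NormedAddCommGroup F] {T : ℝ} (hT : 0 ≤ T) {f : ℝ → F}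
    (hf : ContinuousOn f (Icc 0 T)) : BddMeas fun t => f (clamp T t) := by
  obtain ⟨C, hC⟩ := isCompact_Icc.exists_bound_of_continuousOn hf
  exact ⟨(continuous_comp_clamp hT hf).stronglyMeasurable, C, fun t => hC _ (clamp_mem hT t)⟩

/-- The extension of a semi-discrete solution by constants in time. -/
theorem PeriodicMesh.IsSemiDiscreteSolution.comp_clamp {M : PeriodicMesh b} {ν ω T : ℝ}
    (hT : 0 ≤ T) {du : ℝ → M.Node → M.Node → ℝ} {U : ℝ → M.Node → Euc d} {P : ℝ → M.Node → ℝ}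
    (h : M.IsSemiDiscreteSolution ν ω T du U P) :
    M.IsSemiDiscreteSolution ν ω T du (fun t => U (clamp T t)) (fun t => P (clamp T t)) := by
  have hev : ∀ t ∈ Ioo 0 T, ∀ i, (fun s => U (clamp T s) i) =ᶠ[𝓝 t] fun s => U s i := by
    intro t ht i
    filter_upwards [isOpen_Ioo.mem_nhds ht] with s hs
    rw [clamp_eq (Ioo_subset_Icc_self hs)]
  constructor
  · exact h.laplacian
  · exact fun i => (continuous_comp_clamp (f := fun t => U t i) hT
      (h.continuousOn_velocity i)).continuousOn
  · exact fun i => (continuous_comp_clamp (f := fun t => P t i) hT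
      (h.continuousOn_pressure i)).continuousOn
  · exact fun i t ht => (h.differentiableAt_velocity i t ht).congr_of_eventuallyEq (hev t ht i)
  · intro t ht i
    rw [(hev t ht i).deriv_eq, clamp_eq (Ioo_subset_Icc_self ht)]
    exact h.momentum t ht i
  · intro t ht
    rw [clamp_eq (Ioo_subset_Icc_self ht)]
    exact h.continuity t ht
  · intro t ht
    rw [clamp_eq (Ioo_subset_Icc_self ht)]
    exact h.zeroMean t ht

/-- Convergence in `L²` of finite element functions and of their extensions by constants in
time. -/
theorem tendsto_integral_fe_clamp {F : Type*} [NormedAddCommGroup F] [NormedSpace ℝ F]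
    {M : ℕ → PeriodicMesh b} {T : ℝ} (hT : 0 ≤ T) {c : (n : ℕ) → ℝ → (M n).Node → F}
    (hc : ∀ n i, ContinuousOn (fun t => c n t i) (Icc 0 T)) {g : ℝ × Euc d → F}
    (hg : MemLp g 2 (cylinder b T))
    (h : Tendsto (fun n => eLpNorm (fun z : ℝ × Euc d => (M n).fe (c n z.1) z.2 - g z) 2
      (cylinder b T)) atTop (𝓝 0)) :
    Tendsto (fun n => ∫ z, ‖(M n).fe (c n (clamp T z.1)) z.2 - g z‖ ^ 2 ∂(cylinder b T)) atTop
      (𝓝 0) := by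
  have hm : ∀ n, MemLp (fun z : ℝ × Euc d => (M n).fe (c n (clamp T z.1)) z.2 - g z) 2
      (cylinder b T) := fun n => ((PeriodicMesh.bddMeas_fe_time (c := fun t => c n (clamp T t))
    fun i => bddMeas_comp_clamp (f := fun t => c n t i) hT (hc n i)).memLp 2).sub hg
  refine tendsto_integral_norm_sq hm (h.congr fun n => eLpNorm_congr_ae ?_)
  filter_upwards [ae_cylinder b T] with z hz
  rw [clamp_eq (Ioo_subset_Icc_self hz)]

end PeriodicFEM

end

theorem theorem2 (d : ℕ) (hd : d = 2 ∨ d = 3)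
    (b : Module.Basis (Fin d) ℝ (PeriodicFEM.Euc d))
    (ν ω T : ℝ) (hν : 0 ≤ ν) (hω : 0 < ω) (hT : 0 < T)
    -- a sequence of meshes with mesh size tending to zero
    (M : ℕ → PeriodicFEM.PeriodicMesh b)
    (hmesh : Tendsto (fun n => (M n).meshSize) atTop (𝓝 0))
    (hshape : PeriodicFEM.ShapeRegular M)
    (hquasi : d = 3 → PeriodicFEM.QuasiUniform M)
    -- solutions of the semi-discrete scheme
    (du : (n : ℕ) → ℝ → (M n).Node → (M n).Node → ℝ)
    (U : (n : ℕ) → ℝ → (M n).Node → PeriodicFEM.Euc d)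
    (P : (n : ℕ) → ℝ → (M n).Node → ℝ)
    (hsol : ∀ n, (M n).IsSemiDiscreteSolution ν ω T (du n) (U n) (P n))
    -- the artificial viscosity coefficients are of the order `h ^ (d - 1)`
    (hdu : ∃ C : ℝ, ∀ n, ∀ t ∈ Ioo 0 T, ∀ i j, j ≠ i →
      du n t i j ≤ C * (M n).meshSize ^ (d - 1))
    -- strong convergence of the initial data, the velocities and the pressures
    (u₀ : PeriodicFEM.Euc d → PeriodicFEM.Euc d)
    (u : ℝ → PeriodicFEM.Euc d → PeriodicFEM.Euc d)
    (p : ℝ → PeriodicFEM.Euc d → ℝ)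
    (hu₀ : MemLp u₀ 2 (volume.restrict (PeriodicFEM.cell b)))
    (hu : MemLp (fun z : ℝ × PeriodicFEM.Euc d => u z.1 z.2) 2 (PeriodicFEM.cylinder b T))
    (hp : MemLp (fun z : ℝ × PeriodicFEM.Euc d => p z.1 z.2) 2 (PeriodicFEM.cylinder b T))
    (hconv₀ : Tendsto (fun n => eLpNorm (fun x => (M n).fe (U n 0) x - u₀ x) 2
      (volume.restrict (PeriodicFEM.cell b))) atTop (𝓝 0))
    (hconvu : Tendsto (fun n => eLpNorm
      (fun z : ℝ × PeriodicFEM.Euc d => (M n).fe (U n z.1) z.2 - u z.1 z.2) 2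
      (PeriodicFEM.cylinder b T)) atTop (𝓝 0))
    (hconvp : Tendsto (fun n => eLpNorm
      (fun z : ℝ × PeriodicFEM.Euc d => (M n).fe (P n z.1) z.2 - p z.1 z.2) 2
      (PeriodicFEM.cylinder b T)) atTop (𝓝 0)) :
    PeriodicFEM.IsWeakSolution b ν T u₀ u p := by
  open PeriodicFEM in
  obtain ⟨σ, hσ, hreg⟩ := exists_isRegular hshape
  obtain ⟨κ, hκ⟩ := exists_viscosity_const hd hσ hreg hquasi
  obtain ⟨C, hC⟩ := hdu
  have h : ConvergentScheme ν ω T σ M du (fun n t => U n (clamp T t))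
      (fun n t => P n (clamp T t)) u₀ u p :=
    { nonneg_ν := hν
      nonneg_ω := hω.le
      pos_T := hT
      pos_σ := hσ
      regular := hreg
      tendsto_meshSize := hmesh
      solution := fun n => (hsol n).comp_clamp hT.le
      viscosity_le := fun V L => ⟨_, fun n t ht v ε hv =>
        ((hsol n).laplacian t ht).lapSq_le (abs_nonneg C) (fun i j hij => (hC n t ht i j hij).trans
          (mul_le_mul_of_nonneg_right (le_abs_self C)
            (pow_nonneg (PeriodicMesh.meshSize_nonneg _) _))) (hκ n) hv⟩
      continuous_U := fun n i => continuous_comp_clamp (f := fun t => U n t i) hT.le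
        ((hsol n).continuousOn_velocity i)
      continuous_P := fun n i => continuous_comp_clamp (f := fun t => P n t i) hT.le
        ((hsol n).continuousOn_pressure i)
      bddMeas_U := fun n i => bddMeas_comp_clamp (f := fun t => U n t i) hT.le
        ((hsol n).continuousOn_velocity i)
      bddMeas_P := fun n i => bddMeas_comp_clamp (f := fun t => P n t i) hT.le
        ((hsol n).continuousOn_pressure i)
      memLp_u₀ := hu₀
      memLp_u := hu
      memLp_p := hp
      tendsto_u₀ := by
        rw [clamp_eq ⟨le_rfl, hT.le⟩]
        exact tendsto_integral_norm_sq
          (fun n => ((PeriodicMesh.bddMeas_fe (U n 0)).memLp 2).sub hu₀) hconv₀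
      tendsto_u := tendsto_integral_fe_clamp hT.le (fun n => (hsol n).continuousOn_velocity) hu
        hconvu
      tendsto_p := tendsto_integral_fe_clamp hT.le (fun n => (hsol n).continuousOn_pressure) hp
        hconvp }
  exact ⟨hu₀, hu, hp, h.momentum_limit, h.solenoidal_limit⟩
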